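/- Let $\mathbb S^1=\mathbb R/2\pi\mathbb Z$, let $d\sigma=\frac{dx}{2\pi}$ be the uniform probability measure on $\mathbb S^1$, and for real-valued $u$ write $\|u\|_r=\big(\int_{\mathbb S^1}|u|^r\,d\sigma\big)^{1/r}$. For $p>2$ let $\mathcal W_1$ be the set of all $v\in W^{1,p}(\mathbb S^1)\setminus\{0\}$ with $\int_{\mathbb S^1}v\,d\sigma=0$, and put $$\lambda_1=\inf_{v\in\mathcal W_1}\frac{\|v'\|_p^2}{\|v\|_p^2},\qquad \lambda_1^\star=\inf_{v\in\mathcal W_1}\frac{\|v'\|_p^2}{\|v\|_2^2}.$$ **Theorem.** Let $p\in(2,+\infty)$ and let $q>p-1$ be a real number. Then there exists a constant $\Lambda_{p,q}>0$ such that every $u\in W^{1,p}(\mathbb S^1)$ satisfies $$\|u'\|_p^2\ \ge\ \frac{\Lambda_{p,q}}{p-q}\,\big(\|u\|_p^2-\|u\|_q^2\big)\qquad\text{if } q\neq p,$$ $$\|u'\|_p^2\ \ge\ \frac2p\,\Lambda_{p,p}\,\|u\|_p^{2-p}\int_{\mathbb S^1}|u|^p\,\log\Big(\frac{|u|}{\|u\|_p}\Big)\,d\sigma\qquad\text{if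 } q=p \text{ and } u\not\equiv0,$$ where all the integrals are finite. Moreover, there is a largest constant $\Lambda_{p,q}$ for which the respective inequality holds for all such $u$, and this sharp constant satisfies $$\lambda_1\ \le\ \Lambda_{p,q}\ \le\ \lambda_1^\star .$$ -/

import Mathlib

open MeasureTheory Set

/-- The unit circle, identified with `ℝ / 2πℤ`. -/
abbrev Circ : Type := AddCircle (2 * Real.pi)

instance circ_fact : Fact (0 < 2 * Real.pi) := ⟨Real.two_pi_pos⟩

/-- The uniform probability measure `dσ = dx / 2π` on the circle. -/
noncomputable def circMeasure : Measure Circ := AddCircle.haarAddCircle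

/-- The derivative of a function on the circle with respect to the angle. -/
noncomputable def circDeriv (φ : Circ → ℝ) (x : Circ) : ℝ :=
  deriv (fun t : ℝ => φ (x + (t : Circ))) 0

/-- Smooth functions on the circle: those whose `2π`-periodic lift to `ℝ` is `C^∞`. -/
def CircSmooth (φ : Circ → ℝ) : Prop :=
  ContDiff ℝ (⊤ : ℕ∞) (fun t : ℝ => φ (t : Circ))

/-- `u ∈ W^{1,p}(S¹)` with weak derivative `u'`: both functions are in `L^p`, and
`∫ u φ' dσ = - ∫ u' φ dσ` for every smooth `φ` on the circle. -/
structure IsSobolev (p : ℝ) (u u' : Circ → ℝ) : Prop where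
  memLp : MemLp u (ENNReal.ofReal p) circMeasure
  memLp_deriv : MemLp u' (ENNReal.ofReal p) circMeasure
  weak_deriv : ∀ φ : Circ → ℝ, CircSmooth φ →
    ∫ x, u x * circDeriv φ x ∂circMeasure = - ∫ x, u' x * φ x ∂circMeasure

/-- `‖u‖_r = (∫ |u|^r dσ)^{1/r}`. -/
noncomputable def circNorm (r : ℝ) (u : Circ → ℝ) : ℝ :=
  (∫ x, |u x| ^ r ∂circMeasure) ^ (1 / r)

/-- The infimum of `‖v'‖_p² / ‖v‖_r²` over the nonzero `v ∈ W^{1,p}(S¹)` of zero average. -/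
noncomputable def rayleighInf (p r : ℝ) : ℝ :=
  sInf {y : ℝ | ∃ v v' : Circ → ℝ, IsSobolev p v v' ∧ ¬ (v =ᵐ[circMeasure] 0) ∧
    ∫ x, v x ∂circMeasure = 0 ∧ y = circNorm p v' ^ 2 / circNorm r v ^ 2}

/-- `λ₁ = inf ‖v'‖_p² / ‖v‖_p²`. -/
noncomputable def lambdaOne (p : ℝ) : ℝ := rayleighInf p p

/-- `λ₁^⋆ = inf ‖v'‖_p² / ‖v‖_2²`. -/
noncomputable def lambdaOneStar (p : ℝ) : ℝ := rayleighInf p 2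

/-- The interpolation inequality (for `p ≠ q`) with constant `L`. -/
def InterpolationInequality (p q L : ℝ) : Prop :=
  ∀ u u' : Circ → ℝ, IsSobolev p u u' →
    circNorm p u' ^ 2 ≥ L / (p - q) * (circNorm p u ^ 2 - circNorm q u ^ 2)

/-- The `L^p` logarithmic Sobolev inequality with constant `L`. -/
def LogSobolevInequality (p L : ℝ) : Prop :=
  ∀ u u' : Circ → ℝ, IsSobolev p u u' → ¬ (u =ᵐ[circMeasure] 0) →
    circNorm p u' ^ 2 ≥ 2 / p * L * circNorm p u ^ (2 - p) *
      ∫ x, |u x| ^ p * Real.log (|u x| / circNorm p u) ∂circMeasure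

/-!
Write `δ(u) = (‖u‖_p² - ‖u‖_q²) / (p - q)`. The heart of the matter is the inequality
`‖u'‖_p² ≥ λ₁ δ(u)` for `q ≠ p`; everything else is soft.

**The inequality with the constant `λ₁`.** By the approximation `√(u² + δ²)` it is enough to treat
positive functions (`PerAC.deficit`), and by homogeneity those with `∫ u^q = 1`
(`PerAC.deficit_of_pos`). The deficit `‖u'‖_p² - λ₁ δ(u)` has no obvious minimiser among positive
functions, so it is penalised: a term `B (∫ u^q - 1)²` makes it coercive on positive functions, and a
term `ε ∫ u^(-4)` keeps minimising sequences away from zero, because functions of finite energy are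
Hölder continuous of exponent `1 - 1/p > 1/2` (`exists_lower_bound`). The direct method provides a
positive minimiser (`exists_minimiser`), which solves
`(|u'|^(p-2) u')' = -(a u^(p-1) - C u^(q-1) + D u^(-5))` with `D ≥ 0` and a coefficient `a` that is
explicit in `λ₁`, `‖u‖_p` and `‖u'‖_p` (`euler_lagrange`). By `rigidity` such a solution is constant:
two integrations over a period eliminate the unknown constant `C`, and the Poincaré inequality
together with `q > p - 1` leaves no room for a nonzero `u'`. At constants the penalised deficit is
nonnegative; letting `ε → 0` gives the inequality.

Absolutely continuous functions on a period (`PerAC`) serve as the model of `W^{1,p}` throughout this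
part. The energy is shown to be lower semicontinuous through difference quotients and Fatou's lemma
(`PerAC.of_tendsto`), which dispenses with weak convergence. The passage from weak derivatives on the
circle to this model is `IsSobolev.exists_perAC`.

**The logarithmic case.** The derivative at `q = p` of `q ↦ ‖u‖_q²` is the right-hand side of the
logarithmic inequality up to the factor `λ₁` (`hasDerivAt_sq_norm_exponent`), so that inequality is
the limit of the previous ones as `q → p`.

**The sharp constant.** The admissible constants form a closed set containing `λ₁ > 0`. Testing
with `u = 1 + ε v`, where `v` has zero mean, and expanding to second order shows
`L ∫ v² ≤ ‖v'‖_p²` for every admissible `L`, that is `L ≤ λ₁^⋆`. Hence the supremum of this set is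
attained and lies between `λ₁` and `λ₁^⋆`.
-/

open Filter Topology

/-! ### Signed powers -/

/-- The odd power `y ↦ |y|^(a-1) y`, of modulus `|y|^a`. -/
noncomputable def spow (a y : ℝ) : ℝ := |y| ^ (a - 1) * y

theorem abs_spow {a : ℝ} (ha : 0 < a) (y : ℝ) : |spow a y| = |y| ^ a := by
  rcases eq_or_ne y 0 with rfl | hy
  · simp [spow, Real.zero_rpow ha.ne']
  · have h : 0 < |y| := abs_pos.2 hy
    rw [spow, abs_mul, abs_of_nonneg (by positivity), ← Real.rpow_add_one h.ne']
    ring_nf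

theorem spow_mul_self {a : ℝ} (ha : 0 < a + 1) (y : ℝ) : spow a y * y = |y| ^ (a + 1) := by
  rcases eq_or_ne y 0 with rfl | hy
  · simp [spow, Real.zero_rpow ha.ne']
  · have h : 0 < |y| := abs_pos.2 hy
    have : a + 1 = (a - 1) + 2 := by ring
    rw [spow, this, Real.rpow_add h, mul_assoc, Real.rpow_two, sq_abs, sq]

theorem spow_spow {a b : ℝ} (hb : 0 < b) (y : ℝ) : spow a (spow b y) = spow (a * b) y := by
  rcases eq_or_ne y 0 with rfl | hy
  · simp [spow]
  · have h : 0 < |y| := abs_pos.2 hy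
    have h1 : spow a (spow b y) = |spow b y| ^ (a - 1) * spow b y := rfl
    rw [h1, abs_spow hb, spow, spow, ← Real.rpow_mul h.le, ← mul_assoc, ← Real.rpow_add h]
    ring_nf

theorem spow_one (y : ℝ) : spow 1 y = y := by simp [spow]

theorem spow_eq_max {a : ℝ} (ha : 0 < a) (y : ℝ) :
    spow a y = (max y 0) ^ a - (max (-y) 0) ^ a := by
  rcases lt_trichotomy y 0 with h | rfl | h
  · rw [max_eq_right h.le, max_eq_left (by linarith), Real.zero_rpow ha.ne', spow, abs_of_neg h]
    have : a = (a - 1) + 1 := by ring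
    rw [this, Real.rpow_add_one (by linarith)]
    ring_nf
  · simp [spow]
  · rw [max_eq_left h.le, max_eq_right (by linarith), Real.zero_rpow ha.ne', spow, abs_of_pos h,
      ← Real.rpow_add_one h.ne']
    ring_nf

theorem continuous_spow {a : ℝ} (ha : 0 < a) : Continuous (spow a) := by
  have : spow a = fun y => (max y 0) ^ a - (max (-y) 0) ^ a := funext (spow_eq_max ha)
  rw [this]
  exact ((continuous_id.max continuous_const).rpow_const fun _ => Or.inr ha.le).sub
    ((continuous_neg.max continuous_const).rpow_const fun _ => Or.inr ha.le)

theorem hasDerivAt_spow {a : ℝ} (ha : 1 < a) (y : ℝ) :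
    HasDerivAt (spow a) (a * |y| ^ (a - 1)) y := by
  rcases eq_or_ne y 0 with rfl | hy
  · rw [abs_zero, Real.zero_rpow (by linarith), mul_zero, hasDerivAt_iff_tendsto_slope]
    have hc : Filter.Tendsto (fun y : ℝ => |y| ^ (a - 1)) (nhdsWithin 0 {0}ᶜ) (nhds 0) := by
      have : Continuous fun y : ℝ => |y| ^ (a - 1) :=
        continuous_abs.rpow_const fun _ => Or.inr (by linarith)
      have h := this.tendsto 0
      rw [abs_zero, Real.zero_rpow (by linarith)] at h
      exact h.mono_left nhdsWithin_le_nhds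
    refine hc.congr' ?_
    filter_upwards [self_mem_nhdsWithin] with y hy
    have hy : y ≠ 0 := hy
    simp [slope_def_field, spow, hy]
  · have h : 0 < |y| := abs_pos.2 hy
    have h1 : HasDerivAt (fun y : ℝ => |y| ^ (a - 1) * y)
        (((SignType.sign y : ℝ) * (a - 1) * |y| ^ (a - 1 - 1)) * y + |y| ^ (a - 1) * 1) y :=
      ((hasDerivAt_abs hy).rpow_const (Or.inl h.ne')).mul (hasDerivAt_id y)
    refine h1.congr_deriv (Eq.symm ?_)
    have h2 : (SignType.sign y : ℝ) * y = |y| := sign_mul_self y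
    have h3 : |y| ^ (a - 1) = |y| ^ (a - 1 - 1) * |y| := by
      rw [← Real.rpow_add_one h.ne']; ring_nf
    calc a * |y| ^ (a - 1) = (a - 1) * |y| ^ (a - 1) + |y| ^ (a - 1) * 1 := by ring
      _ = _ := by rw [h3, ← h2]; ring

/-! ### Hölder's inequality on an interval -/

theorem ContinuousOn.memLp_Ioc {T : ℝ} {f : ℝ → ℝ} (hf : ContinuousOn f (Icc 0 T))
    (r : ENNReal) : MemLp f r (volume.restrict (Ioc 0 T)) := by
  obtain ⟨C, hC⟩ := isCompact_Icc.exists_bound_of_continuousOn hf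
  refine MemLp.of_bound ((hf.mono Ioc_subset_Icc_self).aestronglyMeasurable measurableSet_Ioc) C ?_
  filter_upwards [ae_restrict_mem measurableSet_Ioc] with t ht using hC t (Ioc_subset_Icc_self ht)

theorem intervalIntegral_mul_le_holder {T : ℝ} (hT : 0 ≤ T) {r s : ℝ} (hrs : r.HolderConjugate s)
    {f g : ℝ → ℝ} (hf : ContinuousOn f (Icc 0 T)) (hg : ContinuousOn g (Icc 0 T))
    (hf0 : ∀ t ∈ Icc 0 T, 0 ≤ f t) (hg0 : ∀ t ∈ Icc 0 T, 0 ≤ g t) :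
    ∫ t in 0..T, f t * g t ≤
      (∫ t in 0..T, f t ^ r) ^ (1 / r) * (∫ t in 0..T, g t ^ s) ^ (1 / s) := by
  simp only [intervalIntegral.integral_of_le hT]
  refine integral_mul_le_Lp_mul_Lq_of_nonneg hrs ?_ ?_ (hf.memLp_Ioc _) (hg.memLp_Ioc _)
  · filter_upwards [ae_restrict_mem measurableSet_Ioc] with t ht using
      hf0 t (Ioc_subset_Icc_self ht)
  · filter_upwards [ae_restrict_mem measurableSet_Ioc] with t ht using
      hg0 t (Ioc_subset_Icc_self ht)

/-! ### Rigidity of the Euler-Lagrange system -/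

theorem intervalIntegral_eq_zero_of_periodic {T : ℝ} (hT : 0 ≤ T) {F F' : ℝ → ℝ}
    (hF : ∀ t ∈ Icc 0 T, HasDerivAt F (F' t) t) (hF' : ContinuousOn F' (Icc 0 T))
    (hper : F 0 = F T) : ∫ t in 0..T, F' t = 0 := by
  rw [intervalIntegral.integral_eq_sub_of_hasDerivAt (f := F)
    (by rwa [uIcc_of_le hT]) (hF'.intervalIntegrable_of_Icc hT), hper, sub_self]

/-- A positive `T`-periodic solution of `(|U'|^(p-2) U')' = -(a U^(p-1) - C U^(q-1) + D U^(-5))`,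
written as a first-order system in `U` and `Y = |U'|^(p-2) U'`, is constant. Here `lam` is a
Poincaré constant, and `a` is the coefficient that comes from a functional of the form
`‖U'‖_p² - lam / (p - q) ‖U‖_p² + ...`.

Put `w = Y'`, `Q = |U'|^p = Y U'` and `z = w U^(1-p)`. Integrating the derivatives of `z Y U` and of
`|U'|^p Y U^(1-p)` over a period gives two identities free of the constant `C`: the first one, with
the Poincaré inequality, yields `∫ z Q ≤ 0` as `q > p - 1` and `D ≥ 0`, while the second one says
that `∫ z Q` is a positive multiple of `∫ Q² U^(-p)`. -/
theorem rigidity {T p q a C D lam : ℝ} (hT : 0 < T) (hp : 2 < p) (hq : p - 1 < q)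
    (hD : 0 ≤ D) (hlam : 0 ≤ lam)
    {U Y G w : ℝ → ℝ} (hpos : ∀ t ∈ Icc 0 T, 0 < U t)
    (hU : ∀ t ∈ Icc 0 T, HasDerivAt U (G t) t)
    (hG : ContinuousOn G (Icc 0 T)) (hYG : ∀ t, Y t = spow (p - 1) (G t))
    (hY : ∀ t ∈ Icc 0 T, HasDerivAt Y (w t) t)
    (hw : ∀ t, w t = -(a * U t ^ (p - 1) - C * U t ^ (q - 1) + D * U t ^ (-5 : ℝ)))
    (hU0 : U 0 = U T) (hY0 : Y 0 = Y T)
    (m : ℝ) (hpoin : lam * (∫ t in 0..T, |U t - m| ^ p) ^ (2 / p)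
      ≤ (∫ t in 0..T, |G t| ^ p) ^ (2 / p))
    (ha : (p - q) * a = lam * (∫ t in 0..T, U t ^ p) ^ (2 / p - 1)
      * (∫ t in 0..T, |G t| ^ p) ^ (1 - 2 / p)) :
    ∀ t ∈ Icc 0 T, G t = 0 := by
  have hUc : ContinuousOn U (Icc 0 T) := fun t ht => (hU t ht).continuousAt.continuousWithinAt
  have hYc : ContinuousOn Y (Icc 0 T) := fun t ht => (hY t ht).continuousAt.continuousWithinAt
  have hUr : ∀ r : ℝ, ContinuousOn (fun t => U t ^ r) (Icc 0 T) := fun r =>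
    hUc.rpow_const fun t ht => Or.inl (hpos t ht).ne'
  have hwc : ContinuousOn w (Icc 0 T) := by
    rw [show w = _ from funext hw]
    exact ((((hUr _).const_mul a).sub ((hUr _).const_mul C)).add ((hUr _).const_mul D)).neg
  have hii : ∀ {f : ℝ → ℝ}, ContinuousOn f (Icc 0 T) → IntervalIntegrable f volume 0 T :=
    fun h => h.intervalIntegrable_of_Icc hT.le
  set Q : ℝ → ℝ := fun t => |G t| ^ p with hQ
  have hQc : ContinuousOn Q (Icc 0 T) := hG.abs.rpow_const fun t _ => Or.inr (by linarith)
  have hQ0 : ∀ t, 0 ≤ Q t := fun t => by positivity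
  have hYQ : ∀ t, Y t * G t = Q t := fun t => by
    rw [hYG, spow_mul_self (by linarith)]; simp [hQ]
  set z : ℝ → ℝ := fun t => w t * U t ^ (1 - p) with hz
  have hzc : ContinuousOn z (Icc 0 T) := hwc.mul (hUr _)
  have hz' : ∀ t ∈ Icc 0 T, z t = -(a - C * U t ^ (q - p) + D * U t ^ (-4 - p)) := by
    intro t ht
    have hu := hpos t ht
    have e1 : U t ^ (p - 1) * U t ^ (1 - p) = 1 := by
      rw [← Real.rpow_add hu]; simp
    have e2 : U t ^ (q - 1) * U t ^ (1 - p) = U t ^ (q - p) := by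
      rw [← Real.rpow_add hu]; ring_nf
    have e3 : U t ^ (-5 : ℝ) * U t ^ (1 - p) = U t ^ (-4 - p) := by
      rw [← Real.rpow_add hu]; ring_nf
    simp only [hz, hw]
    linear_combination -a * e1 + C * e2 - D * e3
  have hq1 : ContinuousOn (fun t => w t ^ 2 * U t ^ (2 - p)) (Icc 0 T) := (hwc.pow 2).mul (hUr _)
  have hq2 : ContinuousOn (fun t => z t * Q t) (Icc 0 T) := hzc.mul hQc
  -- first identity: integrate the derivative of `z Y U`
  have key1 : (∫ t in 0..T, w t ^ 2 * U t ^ (2 - p)) + (1 + q - p) * (∫ t in 0..T, z t * Q t)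
      + D * (q + 4) * (∫ t in 0..T, U t ^ (-4 - p) * Q t)
      = (p - q) * a * ∫ t in 0..T, Q t := by
    have hq3 : ContinuousOn (fun t => U t ^ (-4 - p) * Q t) (Icc 0 T) := (hUr _).mul hQc
    have h0 : ∫ t in 0..T, (w t ^ 2 * U t ^ (2 - p) + (1 + q - p) * (z t * Q t)
        + D * (q + 4) * (U t ^ (-4 - p) * Q t) - (p - q) * a * Q t) = 0 := by
      refine intervalIntegral_eq_zero_of_periodic hT.le
        (F := fun t => -(a - C * U t ^ (q - p) + D * U t ^ (-4 - p)) * Y t * U t) ?_ ?_ ?_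
      · intro t ht
        have hu := hpos t ht
        have d1 := (hU t ht).rpow_const (p := q - p) (Or.inl hu.ne')
        have d2 := (hU t ht).rpow_const (p := -4 - p) (Or.inl hu.ne')
        have d := ((((d1.const_mul C).const_sub a).add (d2.const_mul D)).neg.mul (hY t ht)).mul
          (hU t ht)
        refine d.congr_deriv ?_
        have e1 : U t ^ (q - p - 1) * U t = U t ^ (q - p) := by
          rw [← Real.rpow_add_one hu.ne']; ring_nf
        have e2 : U t ^ (-4 - p - 1) * U t = U t ^ (-4 - p) := by
          rw [← Real.rpow_add_one hu.ne']; ring_nf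
        have e3 : z t * U t = w t * U t ^ (2 - p) := by
          simp only [hz]
          rw [mul_assoc, ← Real.rpow_add_one hu.ne']; ring_nf
        have e4 := hYQ t
        have e5 := hz' t ht
        simp only [Pi.mul_apply, Pi.neg_apply, Pi.add_apply]
        rw [← e4, ← e5]
        linear_combination w t * e3 + (C * (q - p) * G t * Y t) * e1
          - (D * (-4 - p) * G t * Y t) * e2 - ((q - p) * Y t * G t) * e5
      · exact ((hq1.add (hq2.const_mul _)).add (hq3.const_mul _)).sub (hQc.const_mul _)
      · simp only [hU0, hY0]
    have hA : ContinuousOn (fun t => w t ^ 2 * U t ^ (2 - p) + (1 + q - p) * (z t * Q t))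
      (Icc 0 T) := hq1.add (hq2.const_mul _)
    have hB : ContinuousOn (fun t => w t ^ 2 * U t ^ (2 - p) + (1 + q - p) * (z t * Q t)
      + D * (q + 4) * (U t ^ (-4 - p) * Q t)) (Icc 0 T) := hA.add (hq3.const_mul _)
    rw [intervalIntegral.integral_sub (hii hB) (hii (hQc.const_mul _)),
      intervalIntegral.integral_add (hii hA) (hii (hq3.const_mul _)),
      intervalIntegral.integral_add (hii hq1) (hii (hq2.const_mul _)),
      intervalIntegral.integral_const_mul, intervalIntegral.integral_const_mul,
      intervalIntegral.integral_const_mul] at h0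
    linarith
  -- second identity: integrate the derivative of `|U'|^p Y U^(1-p)`, where
  -- `|U'|^p Y = spow (1 + p / (p - 1)) Y` is differentiable since `Y` is
  have hq4 : ContinuousOn (fun t => Q t ^ 2 * U t ^ (-p)) (Icc 0 T) := (hQc.pow 2).mul (hUr _)
  have hs : 0 < p / (p - 1) := by apply div_pos <;> linarith
  have key2 : (1 + p / (p - 1)) * (∫ t in 0..T, z t * Q t)
      = (p - 1) * ∫ t in 0..T, Q t ^ 2 * U t ^ (-p) := by
    have h0 : ∫ t in 0..T, ((1 + p / (p - 1)) * (z t * Q t)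
        - (p - 1) * (Q t ^ 2 * U t ^ (-p))) = 0 := by
      refine intervalIntegral_eq_zero_of_periodic hT.le
        (F := fun t => spow (1 + p / (p - 1)) (Y t) * U t ^ (1 - p)) ?_ ?_ ?_
      · intro t ht
        have hu := hpos t ht
        have d1 := (hU t ht).rpow_const (p := 1 - p) (Or.inl hu.ne')
        have d2 := (hasDerivAt_spow (a := 1 + p / (p - 1)) (by linarith) (Y t)).comp t (hY t ht)
        refine (d2.mul d1).congr_deriv ?_
        have e1 : |Y t| ^ (1 + p / (p - 1) - 1) = Q t := by
          rw [hYG, abs_spow (by linarith), ← Real.rpow_mul (abs_nonneg _), hQ]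
          congr 1
          have : p - 1 ≠ 0 := by linarith
          field_simp
          ring
        have e2 : spow (1 + p / (p - 1)) (Y t) = Q t * Y t := by
          rw [← e1, spow]
        have e3 : U t ^ (1 - p - 1) = U t ^ (-p) := by ring_nf
        have e4 := hYQ t
        simp only [Function.comp, e1, e2, e3, hz]
        linear_combination ((1 - p) * Q t * U t ^ (-p)) * e4
      · exact (hq2.const_mul _).sub (hq4.const_mul _)
      · simp only [hU0, hY0]
    rw [intervalIntegral.integral_sub (hii (hq2.const_mul _)) (hii (hq4.const_mul _)),
      intervalIntegral.integral_const_mul, intervalIntegral.integral_const_mul] at h0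
    linarith
  -- lower bound: integration by parts, Cauchy-Schwarz, Hölder and the Poincaré inequality
  have key3 : (p - q) * a * (∫ t in 0..T, Q t) ≤ ∫ t in 0..T, w t ^ 2 * U t ^ (2 - p) := by
    set W := ∫ t in 0..T, w t ^ 2 * U t ^ (2 - p) with hW
    have hW0 : 0 ≤ W := intervalIntegral.integral_nonneg hT.le fun t ht =>
      mul_nonneg (sq_nonneg _) (Real.rpow_nonneg (hpos t ht).le _)
    set P := ∫ t in 0..T, Q t with hP
    have hP0 : 0 ≤ P := intervalIntegral.integral_nonneg hT.le fun t _ => hQ0 t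
    rcases hP0.eq_or_lt with h0 | hPpos
    · rw [← h0]; simpa using hW0
    set S := ∫ t in 0..T, U t ^ p with hS
    have hSpos : 0 < S := intervalIntegral.intervalIntegral_pos_of_pos_on (hii (hUr _))
      (fun t ht => Real.rpow_pos_of_pos (hpos t (Ioo_subset_Icc_self ht)) _) hT
    set X := ∫ t in 0..T, |U t - m| ^ p with hX
    have hdc : ContinuousOn (fun t => |U t - m|) (Icc 0 T) := (hUc.sub continuousOn_const).abs
    set V := ∫ t in 0..T, U t ^ (p - 2) * |U t - m| ^ (2 : ℝ) with hV
    have hV0 : 0 ≤ V := intervalIntegral.integral_nonneg hT.le fun t ht =>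
      mul_nonneg (Real.rpow_nonneg (hpos t ht).le _) (by positivity)
    have hPW : P ≤ W ^ (1 / 2 : ℝ) * V ^ (1 / 2 : ℝ) := by
      have h0 : ∫ t in 0..T, (w t * (U t - m) + Q t) = 0 := by
        refine intervalIntegral_eq_zero_of_periodic hT.le (F := fun t => Y t * (U t - m)) ?_ ?_ ?_
        · intro t ht
          refine ((hY t ht).mul ((hU t ht).sub_const m)).congr_deriv ?_
          rw [← hYQ]
        · exact (hwc.mul (hUc.sub continuousOn_const)).add hQc
        · simp only [hU0, hY0]
      have hA : ContinuousOn (fun t => w t * (U t - m)) (Icc 0 T) :=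
        hwc.mul (hUc.sub continuousOn_const)
      rw [intervalIntegral.integral_add (hii hA) (hii hQc)] at h0
      have h1 : P = ∫ t in 0..T, -(w t * (U t - m)) := by
        rw [intervalIntegral.integral_neg]; linarith
      rw [h1]
      have hf : ContinuousOn (fun t => |w t| * U t ^ ((2 - p) / 2)) (Icc 0 T) :=
        hwc.abs.mul (hUr _)
      have hg : ContinuousOn (fun t => U t ^ ((p - 2) / 2) * |U t - m|) (Icc 0 T) :=
        (hUr _).mul hdc
      have h2 : ∫ t in 0..T, -(w t * (U t - m)) ≤
          ∫ t in 0..T, (|w t| * U t ^ ((2 - p) / 2)) * (U t ^ ((p - 2) / 2) * |U t - m|) := by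
        refine intervalIntegral.integral_mono_on hT.le
          (hii (hwc.mul (hUc.sub continuousOn_const)).neg) (hii (hf.mul hg)) fun t ht => ?_
        have hu := hpos t ht
        have e : U t ^ ((2 - p) / 2) * U t ^ ((p - 2) / 2) = 1 := by
          rw [← Real.rpow_add hu, show (2 - p) / 2 + (p - 2) / 2 = 0 by ring, Real.rpow_zero]
        calc -(w t * (U t - m)) ≤ |w t * (U t - m)| := neg_le_abs _
          _ = |w t| * |U t - m| * (U t ^ ((2 - p) / 2) * U t ^ ((p - 2) / 2)) := by
            rw [e, abs_mul, mul_one]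
          _ = _ := by ring
      refine h2.trans ((intervalIntegral_mul_le_holder hT.le Real.HolderConjugate.two_two hf hg
        (fun t ht => mul_nonneg (abs_nonneg _) (Real.rpow_nonneg (hpos t ht).le _))
        (fun t ht => mul_nonneg (Real.rpow_nonneg (hpos t ht).le _) (abs_nonneg _))).trans_eq ?_)
      congr 2
      · refine intervalIntegral.integral_congr fun t ht => ?_
        rw [uIcc_of_le hT.le] at ht
        have hu := hpos t ht
        rw [Real.mul_rpow (abs_nonneg _) (Real.rpow_nonneg hu.le _), ← Real.rpow_mul hu.le,
          Real.rpow_two, sq_abs]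
        congr 2; ring
      · refine intervalIntegral.integral_congr fun t ht => ?_
        rw [uIcc_of_le hT.le] at ht
        have hu := hpos t ht
        rw [Real.mul_rpow (Real.rpow_nonneg hu.le _) (abs_nonneg _), ← Real.rpow_mul hu.le]
        congr 2; ring
    have hVX : V ≤ S ^ (1 - 2 / p) * X ^ (2 / p) := by
      have hc : (p / (p - 2)).HolderConjugate (p / 2) := by
        rw [Real.holderConjugate_iff]
        constructor
        · rw [lt_div_iff₀ (by linarith)]; linarith
        · have : p - 2 ≠ 0 := by linarith
          have : p ≠ 0 := by linarith
          field_simp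
          ring
      refine (intervalIntegral_mul_le_holder hT.le hc (hUr _)
        (hdc.rpow_const fun t _ => Or.inr (by norm_num))
        (fun t ht => Real.rpow_nonneg (hpos t ht).le _) (fun t _ => by positivity)).trans_eq ?_
      have hp2 : p - 2 ≠ 0 := by linarith
      have hp0 : p ≠ 0 := by linarith
      congr 1
      · congr 1
        · refine intervalIntegral.integral_congr fun t ht => ?_
          rw [uIcc_of_le hT.le] at ht
          rw [← Real.rpow_mul (hpos t ht).le]
          congr 1; field_simp
        · field_simp
      · congr 1
        · refine intervalIntegral.integral_congr fun t _ => ?_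
          rw [← Real.rpow_mul (abs_nonneg _)]
          congr 1; field_simp
        · field_simp
    have hP2 : P ^ 2 ≤ W * V := by
      calc P ^ 2 ≤ (W ^ (1 / 2 : ℝ) * V ^ (1 / 2 : ℝ)) ^ 2 := by gcongr
        _ = W * V := by
          rw [← Real.sqrt_eq_rpow, ← Real.sqrt_eq_rpow, mul_pow, Real.sq_sqrt hW0,
            Real.sq_sqrt hV0]
    have hSS : S ^ (2 / p - 1) * S ^ (1 - 2 / p) = 1 := by
      rw [← Real.rpow_add hSpos]; simp
    have hPP : P ^ (1 - 2 / p) * P ^ (2 / p) = P := by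
      rw [← Real.rpow_add hPpos]; simp
    have hs0 := Real.rpow_pos_of_pos hSpos (2 / p - 1)
    have hs1 := Real.rpow_pos_of_pos hSpos (1 - 2 / p)
    have hp0 := Real.rpow_pos_of_pos hPpos (2 / p)
    have h1 : lam * P ^ 2 ≤ W * S ^ (1 - 2 / p) * P ^ (2 / p) := by
      calc lam * P ^ 2 ≤ lam * (W * (S ^ (1 - 2 / p) * X ^ (2 / p))) := by
            gcongr; exact hP2.trans (by gcongr)
        _ = (W * S ^ (1 - 2 / p)) * (lam * X ^ (2 / p)) := by ring
        _ ≤ _ := by gcongr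
    rw [ha]
    refine le_of_mul_le_mul_right ?_ hp0
    calc lam * S ^ (2 / p - 1) * P ^ (1 - 2 / p) * P * P ^ (2 / p)
        = S ^ (2 / p - 1) * (lam * (P ^ (1 - 2 / p) * P ^ (2 / p)) * P) := by ring
      _ = S ^ (2 / p - 1) * (lam * P ^ 2) := by rw [hPP]; ring
      _ ≤ S ^ (2 / p - 1) * (W * S ^ (1 - 2 / p) * P ^ (2 / p)) := by gcongr
      _ = (S ^ (2 / p - 1) * S ^ (1 - 2 / p)) * (W * P ^ (2 / p)) := by ring
      _ = W * P ^ (2 / p) := by rw [hSS, one_mul]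
  have hnn : 0 ≤ ∫ t in 0..T, U t ^ (-4 - p) * Q t :=
    intervalIntegral.integral_nonneg hT.le fun t ht =>
      mul_nonneg (Real.rpow_nonneg (hpos t ht).le _) (hQ0 t)
  have h1 : (∫ t in 0..T, z t * Q t) ≤ 0 := by
    have h2 : 0 ≤ D * (q + 4) * ∫ t in 0..T, U t ^ (-4 - p) * Q t :=
      mul_nonneg (mul_nonneg hD (by linarith)) hnn
    have h3 : (1 + q - p) * (∫ t in 0..T, z t * Q t) ≤ 0 := by linarith
    by_contra h
    push Not at h
    exact absurd h3 (not_le.2 (mul_pos (by linarith) h))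
  intro t ht
  by_contra hne
  have hpos' : 0 < ∫ t in 0..T, Q t ^ 2 * U t ^ (-p) := by
    refine intervalIntegral.integral_pos hT hq4 (fun s hs => ?_) ⟨t, ht, ?_⟩
    · exact mul_nonneg (sq_nonneg _) (Real.rpow_nonneg (hpos s (Ioc_subset_Icc_self hs)).le _)
    · exact mul_pos (pow_pos (Real.rpow_pos_of_pos (abs_pos.2 hne) _) 2)
        (Real.rpow_pos_of_pos (hpos t ht) _)
  have h4 : 0 < (p - 1) * ∫ t in 0..T, Q t ^ 2 * U t ^ (-p) := mul_pos (by linarith) hpos'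
  have h5 : (1 + p / (p - 1)) * (∫ t in 0..T, z t * Q t) ≤ 0 :=
    mul_nonpos_of_nonneg_of_nonpos (by linarith) h1
  linarith

/-! ### Absolutely continuous periodic functions of finite energy -/

/-- `W^{1,p}` of the circle of length `T`, seen on a period: absolutely continuous functions on
`[0, T]` with equal values at both ends and a derivative in `L^p`. -/
structure PerAC (p T : ℝ) (U : ℝ → ℝ) : Prop where
  ac : AbsolutelyContinuousOnInterval U 0 T
  per : U 0 = U T
  int : IntervalIntegrable (fun t => |deriv U t| ^ p) volume 0 T

/-- The `p`-energy `∫ |U'|^p` over a period. -/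
noncomputable def energy (p T : ℝ) (U : ℝ → ℝ) : ℝ := ∫ t in 0..T, |deriv U t| ^ p

theorem energy_nonneg {p T : ℝ} (hT : 0 ≤ T) (U : ℝ → ℝ) : 0 ≤ energy p T U :=
  intervalIntegral.integral_nonneg hT fun _ _ => by positivity

/-- Young's inequality with a free parameter. -/
theorem le_young {p K x : ℝ} (hp : 1 < p) (hK : 0 < K) (hx : 0 ≤ x) :
    x ≤ (1 - 1 / p) * K + 1 / p * K ^ (1 - p) * x ^ p := by
  have h := one_add_mul_self_le_rpow_one_add (s := x / K - 1) (p := p)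
    (by have : 0 ≤ x / K := by positivity
        linarith) hp.le
  have h1 : (1 + (x / K - 1)) ^ p = x ^ p / K ^ p := by
    rw [add_sub_cancel, Real.div_rpow hx hK.le]
  have h2 : K ^ (1 - p) = K / K ^ p := by rw [Real.rpow_sub hK, Real.rpow_one]
  rw [h1] at h
  have hp0 : 0 < p := by linarith
  have hKp : 0 < K ^ p := by positivity
  rw [h2]
  have h3 : x = (1 - 1 / p) * K + K / p * (1 + p * (x / K - 1)) := by field_simp; ring
  calc x = (1 - 1 / p) * K + K / p * (1 + p * (x / K - 1)) := h3
    _ ≤ (1 - 1 / p) * K + K / p * (x ^ p / K ^ p) := by gcongr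
    _ = _ := by field_simp

namespace PerAC

variable {p T : ℝ} {U : ℝ → ℝ}

theorem continuousOn (hU : PerAC p T U) (hT : 0 ≤ T) : ContinuousOn U (Icc 0 T) := by
  have := hU.ac.continuousOn
  rwa [uIcc_of_le hT] at this

theorem intervalIntegrable_sub (hU : PerAC p T U) (hT : 0 ≤ T) {s t : ℝ} (hs : s ∈ Icc 0 T)
    (ht : t ∈ Icc 0 T) : IntervalIntegrable (fun t => |deriv U t| ^ p) volume s t :=
  hU.int.mono_set (uIcc_subset_uIcc (by rwa [uIcc_of_le hT]) (by rwa [uIcc_of_le hT]))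

theorem abs_sub_le_young (hU : PerAC p T U) (hT : 0 ≤ T) (hp : 1 < p) {K : ℝ} (hK : 0 < K)
    {s t : ℝ} (hs : s ∈ Icc 0 T) (ht : t ∈ Icc 0 T) (hst : s ≤ t) :
    |U t - U s| ≤ (1 - 1 / p) * K * (t - s)
      + 1 / p * K ^ (1 - p) * ∫ x in s..t, |deriv U x| ^ p := by
  have hac : AbsolutelyContinuousOnInterval U s t :=
    hU.ac.mono (uIcc_subset_uIcc (by rwa [uIcc_of_le hT]) (by rwa [uIcc_of_le hT]))
  rw [← hac.integral_deriv_eq_sub]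
  have hi := hU.intervalIntegrable_sub hT hs ht
  refine (intervalIntegral.abs_integral_le_integral_abs hst).trans ?_
  calc ∫ x in s..t, |deriv U x|
      ≤ ∫ x in s..t, ((1 - 1 / p) * K + 1 / p * K ^ (1 - p) * |deriv U x| ^ p) :=
        intervalIntegral.integral_mono_on hst hac.intervalIntegrable_deriv.abs
          (intervalIntegrable_const.add (hi.const_mul _))
          fun x _ => le_young hp hK (abs_nonneg _)
    _ = _ := by
      rw [intervalIntegral.integral_add intervalIntegrable_const (hi.const_mul _),
        intervalIntegral.integral_const, intervalIntegral.integral_const_mul, smul_eq_mul]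
      ring

/-- Hölder's inequality for the increments, obtained by optimising Young's inequality. -/
theorem abs_sub_rpow_le (hU : PerAC p T U) (hT : 0 ≤ T) (hp : 1 < p)
    {s t : ℝ} (hs : s ∈ Icc 0 T) (ht : t ∈ Icc 0 T) (hst : s ≤ t) :
    |U t - U s| ^ p ≤ (t - s) ^ (p - 1) * ∫ x in s..t, |deriv U x| ^ p := by
  have he : 0 ≤ ∫ x in s..t, |deriv U x| ^ p :=
    intervalIntegral.integral_nonneg hst fun _ _ => by positivity
  rcases (abs_nonneg (U t - U s)).eq_or_lt with h0 | hX
  · rw [← h0, Real.zero_rpow (by linarith)]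
    exact mul_nonneg (Real.rpow_nonneg (by linarith) _) he
  have hst' : 0 < t - s := by
    rcases hst.eq_or_lt with h | h
    · subst h; simp at hX
    · linarith
  -- the optimal choice of the parameter is the mean slope
  have h := hU.abs_sub_le_young hT hp (K := |U t - U s| / (t - s)) (by positivity) hs ht hst
  set X := |U t - U s|
  set e := ∫ x in s..t, |deriv U x| ^ p
  have hp0 : 0 < p := by linarith
  have h1 : (1 - 1 / p) * (X / (t - s)) * (t - s) = (1 - 1 / p) * X := by field_simp
  rw [h1] at h
  have h2 : X ≤ (X / (t - s)) ^ (1 - p) * e := by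
    have h3 : 1 / p * X ≤ 1 / p * ((X / (t - s)) ^ (1 - p) * e) := by linarith
    exact le_of_mul_le_mul_left h3 (by positivity)
  rw [Real.div_rpow hX.le hst'.le] at h2
  have h4 : X ^ p = X * X ^ (p - 1) := by
    rw [mul_comm, ← Real.rpow_add_one hX.ne']; ring_nf
  have h5 : X ^ (1 - p) * X ^ (p - 1) = 1 := by rw [← Real.rpow_add hX]; simp
  have h6 : (t - s) ^ (p - 1) * (t - s) ^ (1 - p) = 1 := by rw [← Real.rpow_add hst']; simp
  have h7 : 0 < (t - s) ^ (1 - p) := by positivity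
  calc X ^ p = X * X ^ (p - 1) := h4
    _ ≤ (X ^ (1 - p) / (t - s) ^ (1 - p) * e) * X ^ (p - 1) := by gcongr
    _ = (X ^ (1 - p) * X ^ (p - 1)) * ((t - s) ^ (p - 1) * (t - s) ^ (1 - p))
        / (t - s) ^ (1 - p) * e := by rw [h5, h6]; field_simp; linear_combination e * h5
    _ = _ := by rw [h5]; field_simp

theorem integral_le_energy (hU : PerAC p T U) {s t : ℝ} (hs : s ∈ Icc 0 T)
    (ht : t ∈ Icc 0 T) (hst : s ≤ t) : ∫ x in s..t, |deriv U x| ^ p ≤ energy p T U :=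
  intervalIntegral.integral_mono_interval hs.1 hst ht.2
    (Eventually.of_forall fun _ => by positivity) hU.int

/-- The Hölder estimate of Morrey type. -/
theorem abs_sub_le (hU : PerAC p T U) (hT : 0 ≤ T) (hp : 1 < p)
    {s t : ℝ} (hs : s ∈ Icc 0 T) (ht : t ∈ Icc 0 T) :
    |U t - U s| ≤ |t - s| ^ (1 - 1 / p) * energy p T U ^ (1 / p) := by
  wlog hst : s ≤ t generalizing s t
  · have := this ht hs (by linarith)
    rwa [abs_sub_comm, abs_sub_comm s t] at this
  have hp0 : 0 < p := by linarith
  have h := (hU.abs_sub_rpow_le hT hp hs ht hst).trans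
    (mul_le_mul_of_nonneg_left (hU.integral_le_energy hs ht hst)
      (Real.rpow_nonneg (by linarith) _))
  have h2 := Real.rpow_le_rpow (by positivity) h (show 0 ≤ 1 / p by positivity)
  rw [← Real.rpow_mul (abs_nonneg _), mul_one_div_cancel hp0.ne', Real.rpow_one,
    Real.mul_rpow (Real.rpow_nonneg (by linarith) _) (energy_nonneg hT U),
    ← Real.rpow_mul (by linarith)] at h2
  rw [abs_of_nonneg (show 0 ≤ t - s by linarith)]
  convert h2 using 3
  field_simp

theorem osc_le (hU : PerAC p T U) (hT : 0 ≤ T) (hp : 1 < p)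
    {s t : ℝ} (hs : s ∈ Icc 0 T) (ht : t ∈ Icc 0 T) :
    |U t - U s| ≤ T ^ (1 - 1 / p) * energy p T U ^ (1 / p) := by
  refine (hU.abs_sub_le hT hp hs ht).trans ?_
  have h1 : |t - s| ≤ T := by rw [abs_le]; constructor <;> linarith [hs.1, hs.2, ht.1, ht.2]
  have h2 : 0 ≤ 1 - 1 / p := by rw [sub_nonneg, div_le_one (by linarith)]; exact hp.le
  gcongr
  exact Real.rpow_nonneg (energy_nonneg hT U) _

/-- The mean of the difference quotients of step `h` has at most the energy of the function. -/
theorem lintegral_diffQuot_le (hU : PerAC p T U) (hp : 1 < p) {h : ℝ} (hh : 0 < h) (hhT : h < T) :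
    ∫⁻ t in Ioc 0 (T - h), ENNReal.ofReal (|(U (t + h) - U t) / h| ^ p)
      ≤ ENNReal.ofReal (energy p T U) := by
  have hT : 0 ≤ T := by linarith
  have hUc := hU.continuousOn hT
  set Φ : ℝ → ℝ := fun t => ∫ x in 0..t, |deriv U x| ^ p with hΦ
  have hΦc : ContinuousOn Φ (Icc 0 T) := by
    have := intervalIntegral.continuousOn_primitive_interval (μ := volume) (a := 0) (b := T)
      (f := fun x => |deriv U x| ^ p) ((intervalIntegrable_iff_integrableOn_Icc_of_le hT).1 hU.int
        |> fun h => by rwa [uIcc_of_le hT])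
    rwa [uIcc_of_le hT] at this
  have hΦi : ∀ {a b}, a ∈ Icc 0 T → b ∈ Icc 0 T → IntervalIntegrable Φ volume a b := by
    intro a b ha hb
    exact (hΦc.mono (by
      rw [← uIcc_of_le hT]
      exact uIcc_subset_uIcc (by rwa [uIcc_of_le hT]) (by rwa [uIcc_of_le hT]))).intervalIntegrable
  have m0 : (0 : ℝ) ∈ Icc 0 T := ⟨le_rfl, hT⟩
  have mT : T ∈ Icc 0 T := ⟨hT, le_rfl⟩
  have mh : h ∈ Icc 0 T := ⟨hh.le, hhT.le⟩
  have mTh : T - h ∈ Icc 0 T := ⟨by linarith, by linarith⟩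
  have hΦmono : ∀ {s t}, s ∈ Icc 0 T → t ∈ Icc 0 T → s ≤ t →
      Φ t - Φ s = ∫ x in s..t, |deriv U x| ^ p := by
    intro s t hs ht hst
    exact intervalIntegral.integral_interval_sub_left (hU.intervalIntegrable_sub hT m0 ht)
      (hU.intervalIntegrable_sub hT m0 hs)
  have hshift : IntervalIntegrable (fun t => Φ (t + h)) volume 0 (T - h) := by
    have := (hΦi mh mT).comp_add_right h
    simpa using this
  have hI : ∫ t in 0..(T - h), (Φ (t + h) - Φ t) ≤ h * energy p T U := by
    rw [intervalIntegral.integral_sub hshift (hΦi m0 mTh),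
      intervalIntegral.integral_comp_add_right, zero_add, sub_add_cancel]
    have e1 := intervalIntegral.integral_add_adjacent_intervals (hΦi m0 mh) (hΦi mh mT)
    have e2 := intervalIntegral.integral_add_adjacent_intervals (hΦi m0 mTh) (hΦi mTh mT)
    have e3 : 0 ≤ ∫ t in 0..h, Φ t := intervalIntegral.integral_nonneg hh.le fun t ht =>
      intervalIntegral.integral_nonneg ht.1 fun _ _ => by positivity
    have e4 : ∫ t in (T - h)..T, Φ t ≤ ∫ t in (T - h)..T, energy p T U := by
      refine intervalIntegral.integral_mono_on (by linarith) (hΦi mTh mT)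
        intervalIntegrable_const fun t ht => ?_
      exact hU.integral_le_energy m0 ⟨by linarith [ht.1, mTh.1], ht.2⟩
        (by linarith [ht.1, mTh.1])
    rw [intervalIntegral.integral_const, smul_eq_mul, sub_sub_cancel] at e4
    linarith
  have hq : ∀ t ∈ Icc 0 (T - h), |(U (t + h) - U t) / h| ^ p ≤ h⁻¹ * (Φ (t + h) - Φ t) := by
    intro t ht
    have mt : t ∈ Icc 0 T := ⟨ht.1, by linarith [ht.2]⟩
    have mth : t + h ∈ Icc 0 T := ⟨by linarith [ht.1], by linarith [ht.2]⟩
    have := hU.abs_sub_rpow_le hT hp mt mth (by linarith)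
    rw [hΦmono mt mth (by linarith), abs_div, abs_of_pos hh,
      Real.div_rpow (abs_nonneg _) hh.le, div_le_iff₀ (by positivity)]
    refine this.trans_eq ?_
    have : h ^ p = h ^ (p - 1) * h := by rw [← Real.rpow_add_one hh.ne']; ring_nf
    rw [this, add_sub_cancel_left]
    field_simp
  calc ∫⁻ t in Ioc 0 (T - h), ENNReal.ofReal (|(U (t + h) - U t) / h| ^ p)
      ≤ ∫⁻ t in Ioc 0 (T - h), ENNReal.ofReal (h⁻¹ * (Φ (t + h) - Φ t)) := by
        refine setLIntegral_mono' measurableSet_Ioc fun t ht => ?_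
        exact ENNReal.ofReal_le_ofReal (hq t (Ioc_subset_Icc_self ht))
    _ = ENNReal.ofReal (∫ t in 0..(T - h), h⁻¹ * (Φ (t + h) - Φ t)) := by
        rw [intervalIntegral.integral_of_le mTh.1, ofReal_integral_eq_lintegral_ofReal]
        · exact (((hshift.sub (hΦi m0 mTh)).const_mul _).1)
        · filter_upwards [ae_restrict_mem measurableSet_Ioc] with t ht
          exact le_trans (by positivity) (hq t (Ioc_subset_Icc_self ht))
    _ ≤ _ := by
        refine ENNReal.ofReal_le_ofReal ?_
        rw [intervalIntegral.integral_const_mul, inv_mul_le_iff₀ hh]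
        exact hI

end PerAC

/-! ### Compactness and lower semicontinuity -/

/-- Bounded energy makes the modulus of absolute continuity uniform, by Young's inequality with a
large parameter, so that absolute continuity passes to pointwise limits. -/
theorem absolutelyContinuousOnInterval_of_tendsto {p T L : ℝ} {V : ℕ → ℝ → ℝ} {U : ℝ → ℝ}
    (hT : 0 ≤ T) (hp : 1 < p) (hV : ∀ n, PerAC p T (V n)) (hL : ∀ n, energy p T (V n) ≤ L)
    (hlim : ∀ t ∈ Icc 0 T, Tendsto (fun n => V n t) atTop (𝓝 (U t))) :
    AbsolutelyContinuousOnInterval U 0 T := by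
  rw [absolutelyContinuousOnInterval_iff]
  intro ε hε
  have hp0 : 0 < p := by linarith
  have hL0 : 0 ≤ L := (energy_nonneg hT _).trans (hL 0)
  obtain ⟨K, hK, hKε⟩ : ∃ K : ℝ, 0 < K ∧ K ^ (1 - p) * L < ε / 2 := by
    have h : Tendsto (fun K : ℝ => K ^ (1 - p) * L) atTop (𝓝 (0 * L)) := by
      have := tendsto_rpow_neg_atTop (show 0 < p - 1 by linarith)
      rw [neg_sub] at this
      exact this.mul_const L
    rw [zero_mul] at h
    obtain ⟨K, h1, h2⟩ := ((h.eventually (gt_mem_nhds (half_pos hε))).and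
      (eventually_gt_atTop 0)).exists
    exact ⟨K, h2, h1⟩
  refine ⟨ε / (2 * K), by positivity, ?_⟩
  rintro ⟨m, I⟩ hE hlen
  simp only at hlen ⊢
  have hI : ∀ i ∈ Finset.range m, (I i).1 ∈ Icc 0 T ∧ (I i).2 ∈ Icc 0 T := by
    have := hE.1
    simpa only [uIcc_of_le hT] using this
  have hsum : ∀ n, ∑ i ∈ Finset.range m, dist (V n (I i).1) (V n (I i).2)
      ≤ K * (∑ i ∈ Finset.range m, dist (I i).1 (I i).2) + K ^ (1 - p) * L := by
    intro n
    set g : ℝ → ℝ := fun t => |deriv (V n) t| ^ p with hg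
    have h1 : ∀ i ∈ Finset.range m, dist (V n (I i).1) (V n (I i).2)
        ≤ K * dist (I i).1 (I i).2 + K ^ (1 - p) * ∫ x in uIoc (I i).1 (I i).2, g x := by
      intro i hi
      have key : ∀ {s t : ℝ}, s ∈ Icc 0 T → t ∈ Icc 0 T → s ≤ t →
          |V n t - V n s| ≤ K * |t - s| + K ^ (1 - p) * ∫ x in uIoc s t, g x := by
        intro s t hs ht hst
        refine ((hV n).abs_sub_le_young hT hp hK hs ht hst).trans ?_
        rw [abs_of_nonneg (sub_nonneg.2 hst), uIoc_of_le hst,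
          intervalIntegral.integral_of_le hst]
        have e0 : 0 ≤ ∫ x in Ioc s t, |deriv (V n) x| ^ p :=
          integral_nonneg fun _ => by positivity
        have e1 : 1 / p ≤ 1 := by rw [div_le_one hp0]; exact hp.le
        have e2 : 0 < 1 / p := by positivity
        have e3 : 0 ≤ K * (t - s) := mul_nonneg hK.le (by linarith)
        have e4 : 0 ≤ K ^ (1 - p) * ∫ x in Ioc s t, |deriv (V n) x| ^ p := by positivity
        nlinarith
      obtain ⟨ha, hb⟩ := hI i hi
      rcases le_total (I i).1 (I i).2 with h | h
      · have := key ha hb h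
        rwa [dist_comm, dist_comm (I i).1, Real.dist_eq, Real.dist_eq]
      · have := key hb ha h
        rwa [Real.dist_eq, Real.dist_eq, uIoc_comm]
    have hgi : IntegrableOn g (Ioc 0 T) :=
      (intervalIntegrable_iff_integrableOn_Ioc_of_le hT).1 (hV n).int
    have hsub : (⋃ i ∈ Finset.range m, uIoc (I i).1 (I i).2) ⊆ Ioc 0 T := by
      have := AbsolutelyContinuousOnInterval.biUnion_uIoc_subset_of_mem_disjWithin hE
      rwa [uIoc_of_le hT] at this
    have h2 : ∑ i ∈ Finset.range m, ∫ x in uIoc (I i).1 (I i).2, g x ≤ L := by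
      rw [← integral_biUnion_finset (Finset.range m) (fun _ _ => measurableSet_uIoc) hE.2
        fun i hi => hgi.mono_set ((subset_biUnion_of_mem (u := fun i => uIoc (I i).1 (I i).2)
          hi).trans hsub)]
      refine le_trans ?_ (hL n)
      rw [energy, intervalIntegral.integral_of_le hT]
      exact setIntegral_mono_set hgi (Eventually.of_forall fun _ => by positivity)
        (Eventually.of_forall hsub)
    calc _ ≤ ∑ i ∈ Finset.range m, (K * dist (I i).1 (I i).2
          + K ^ (1 - p) * ∫ x in uIoc (I i).1 (I i).2, g x) := Finset.sum_le_sum h1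
      _ = K * (∑ i ∈ Finset.range m, dist (I i).1 (I i).2)
          + K ^ (1 - p) * ∑ i ∈ Finset.range m, ∫ x in uIoc (I i).1 (I i).2, g x := by
        rw [Finset.sum_add_distrib, Finset.mul_sum, Finset.mul_sum]
      _ ≤ _ := by gcongr
  have hlimsum : Tendsto (fun n => ∑ i ∈ Finset.range m, dist (V n (I i).1) (V n (I i).2)) atTop
      (𝓝 (∑ i ∈ Finset.range m, dist (U (I i).1) (U (I i).2))) :=
    tendsto_finsetSum _ fun i hi => (hlim _ (hI i hi).1).dist (hlim _ (hI i hi).2)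
  have := le_of_tendsto' hlimsum hsum
  have h3 : K * (∑ i ∈ Finset.range m, dist (I i).1 (I i).2) < K * (ε / (2 * K)) := by gcongr
  have h4 : K * (ε / (2 * K)) = ε / 2 := by field_simp
  linarith

/-- The energy is lower semicontinuous under pointwise convergence. The energy of the limit is
reached through difference quotients, so that no weak topology is needed. -/
theorem PerAC.of_tendsto {p T L : ℝ} {V : ℕ → ℝ → ℝ} {U : ℝ → ℝ} (hT : 0 < T) (hp : 1 < p)
    (hV : ∀ n, PerAC p T (V n)) (hL : Tendsto (fun n => energy p T (V n)) atTop (𝓝 L))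
    (hlim : ∀ t ∈ Icc 0 T, Tendsto (fun n => V n t) atTop (𝓝 (U t))) :
    PerAC p T U ∧ energy p T U ≤ L := by
  have hp0 : 0 < p := by linarith
  have hL0 : 0 ≤ L := ge_of_tendsto' hL fun n => energy_nonneg hT.le _
  obtain ⟨M, hM⟩ := hL.bddAbove_range
  have hac := absolutelyContinuousOnInterval_of_tendsto hT.le hp hV
    (fun n => hM (mem_range_self n)) hlim
  have hper : U 0 = U T :=
    tendsto_nhds_unique (hlim 0 ⟨le_rfl, hT.le⟩)
      (by simpa only [(hV _).per] using hlim T ⟨hT.le, le_rfl⟩)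
  -- difference quotients of the limit
  have hdq : ∀ h : ℝ, 0 < h → h < T →
      ∫⁻ t in Ioc 0 (T - h), ENNReal.ofReal (|(U (t + h) - U t) / h| ^ p)
        ≤ ENNReal.ofReal L := by
    intro h hh hhT
    have hmem : ∀ t ∈ Ioc 0 (T - h), t ∈ Icc 0 T ∧ t + h ∈ Icc 0 T := fun t ht =>
      ⟨⟨ht.1.le, by linarith [ht.2]⟩, ⟨by linarith [ht.1], by linarith [ht.2]⟩⟩
    calc ∫⁻ t in Ioc 0 (T - h), ENNReal.ofReal (|(U (t + h) - U t) / h| ^ p)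
        = ∫⁻ t in Ioc 0 (T - h), liminf
            (fun n => ENNReal.ofReal (|(V n (t + h) - V n t) / h| ^ p)) atTop := by
          refine setLIntegral_congr_fun measurableSet_Ioc fun t ht => ?_
          obtain ⟨h1, h2⟩ := hmem t ht
          have := (((((hlim _ h2).sub (hlim _ h1)).div_const h).abs).rpow_const
            (p := p) (Or.inr hp0.le))
          exact (ENNReal.tendsto_ofReal this).liminf_eq.symm
      _ ≤ liminf (fun n => ∫⁻ t in Ioc 0 (T - h),
            ENNReal.ofReal (|(V n (t + h) - V n t) / h| ^ p)) atTop := by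
          refine lintegral_liminf_le' fun n => ?_
          have hc := (hV n).continuousOn hT.le
          have : ContinuousOn (fun t => |(V n (t + h) - V n t) / h| ^ p) (Ioc 0 (T - h)) := by
            refine ContinuousOn.rpow_const (ContinuousOn.abs (ContinuousOn.div_const
              (ContinuousOn.sub ?_ ?_) _)) fun _ _ => Or.inr hp0.le
            · exact hc.comp (continuous_add_const h).continuousOn fun t ht => (hmem t ht).2
            · exact hc.mono fun t ht => (hmem t ht).1
          exact (this.aemeasurable measurableSet_Ioc).ennreal_ofReal
      _ ≤ liminf (fun n => ENNReal.ofReal (energy p T (V n))) atTop :=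
          liminf_le_liminf (Eventually.of_forall fun n => (hV n).lintegral_diffQuot_le hp hh hhT)
      _ = _ := (ENNReal.tendsto_ofReal hL).liminf_eq
  have hmeas : Measurable (fun t => |deriv U t| ^ p) := by
    have := measurable_deriv U
    fun_prop
  have hfin : ∫⁻ t in Ioc 0 T, ENNReal.ofReal (|deriv U t| ^ p) ≤ ENNReal.ofReal L := by
    set h : ℕ → ℝ := fun n => T / (n + 2) with hh
    have hh0 : ∀ n, 0 < h n := fun n => by positivity
    have hhT : ∀ n, h n < T := fun n => by
      simp only [hh]
      rw [div_lt_iff₀ (by positivity)]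
      have : (0 : ℝ) ≤ n := Nat.cast_nonneg n
      nlinarith
    have hlim0 : Tendsto h atTop (𝓝 0) := by
      have : Tendsto (fun n : ℕ => (n : ℝ) + 2) atTop atTop :=
        tendsto_atTop_add_const_right _ _ tendsto_natCast_atTop_atTop
      exact this.const_div_atTop T
    have hlim0' : Tendsto h atTop (𝓝[≠] 0) :=
      tendsto_nhdsWithin_iff.2 ⟨hlim0, Eventually.of_forall fun n => (hh0 n).ne'⟩
    set F : ℕ → ℝ → ENNReal := fun n => (Ioc 0 (T - h n)).indicator
      fun t => ENNReal.ofReal (|(U (t + h n) - U t) / h n| ^ p) with hF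
    have hUc : ContinuousOn U (Icc 0 T) := by
      have := hac.continuousOn
      rwa [uIcc_of_le hT.le] at this
    have hFm : ∀ n, AEMeasurable (F n) (volume.restrict (Ioc 0 T)) := by
      intro n
      rw [hF, aemeasurable_indicator_iff measurableSet_Ioc, Measure.restrict_restrict
        measurableSet_Ioc, inter_eq_left.2 (Ioc_subset_Ioc_right (by linarith [hh0 n]))]
      have : ContinuousOn (fun t => |(U (t + h n) - U t) / h n| ^ p) (Ioc 0 (T - h n)) := by
        refine ContinuousOn.rpow_const (ContinuousOn.abs (ContinuousOn.div_const
          (ContinuousOn.sub ?_ ?_) _)) fun _ _ => Or.inr hp0.le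
        · exact hUc.comp (continuous_add_const (h n)).continuousOn fun t ht =>
            ⟨by linarith [ht.1, hh0 n], by linarith [ht.2]⟩
        · exact hUc.mono fun t ht => ⟨ht.1.le, by linarith [ht.2, hh0 n]⟩
      exact (this.aemeasurable measurableSet_Ioc).ennreal_ofReal
    calc ∫⁻ t in Ioc 0 T, ENNReal.ofReal (|deriv U t| ^ p)
        = ∫⁻ t in Ioc 0 T, liminf (fun n => F n t) atTop := by
          refine setLIntegral_congr_fun_ae measurableSet_Ioc ?_
          filter_upwards [hac.ae_differentiableAt, compl_mem_ae_iff.2 (measure_singleton T)]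
            with t ht htT hmem
          have hd := (ht (by rw [uIcc_of_le hT.le]; exact Ioc_subset_Icc_self hmem)).hasDerivAt
          have hs := (hasDerivAt_iff_tendsto_slope_zero.1 hd).comp hlim0'
          have h1 : Tendsto (fun n => ENNReal.ofReal (|(U (t + h n) - U t) / h n| ^ p)) atTop
              (𝓝 (ENNReal.ofReal (|deriv U t| ^ p))) := by
            refine ENNReal.tendsto_ofReal ((Tendsto.abs ?_).rpow_const (Or.inr hp0.le))
            refine hs.congr fun n => ?_
            simp [div_eq_inv_mul]
          have hlt : 0 < T - t := sub_pos.2 (lt_of_le_of_ne hmem.2 htT)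
          have h2 : ∀ᶠ n in atTop, ENNReal.ofReal (|(U (t + h n) - U t) / h n| ^ p) = F n t := by
            filter_upwards [hlim0.eventually (gt_mem_nhds hlt)] with n hn
            rw [hF]
            simp only
            rw [indicator_of_mem]
            exact ⟨hmem.1, by linarith⟩
          exact (h1.congr' h2).liminf_eq.symm
      _ ≤ liminf (fun n => ∫⁻ t in Ioc 0 T, F n t) atTop := lintegral_liminf_le' hFm
      _ ≤ liminf (fun _ => ENNReal.ofReal L) atTop := by
          refine liminf_le_liminf (Eventually.of_forall fun n => ?_)
          refine le_trans (le_of_eq ?_) (hdq (h n) (hh0 n) (hhT n))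
          rw [hF]
          simp only
          rw [lintegral_indicator measurableSet_Ioc, Measure.restrict_restrict measurableSet_Ioc,
            inter_eq_left.2 (Ioc_subset_Ioc_right (by linarith [hh0 n]))]
      _ = _ := liminf_const _
  have hint : Integrable (fun t => |deriv U t| ^ p) (volume.restrict (Ioc 0 T)) := by
    refine ⟨hmeas.aestronglyMeasurable, ?_⟩
    rw [hasFiniteIntegral_iff_ofReal (Eventually.of_forall fun _ => by positivity)]
    exact hfin.trans_lt ENNReal.ofReal_lt_top
  refine ⟨⟨hac, hper, (intervalIntegrable_iff_integrableOn_Ioc_of_le hT.le).2 hint⟩, ?_⟩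
  rw [energy, intervalIntegral.integral_of_le hT.le,
    integral_eq_lintegral_of_nonneg_ae (Eventually.of_forall fun _ => by positivity)
      hmeas.aestronglyMeasurable]
  exact ENNReal.toReal_le_of_le_ofReal hL0 hfin

/-- The Arzelà-Ascoli theorem for sequences of functions on `[0, T]`, with the limit defined on
`ℝ`. -/
theorem exists_subseq_tendsto_of_equicontinuous {T : ℝ} (hT : 0 ≤ T) {V : ℕ → ℝ → ℝ} {B : ℝ}
    (hB : ∀ n, ∀ t ∈ Icc 0 T, |V n t| ≤ B) (hc : ∀ n, ContinuousOn (V n) (Icc 0 T))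
    (heq : ∀ ε > 0, ∃ δ > 0, ∀ n, ∀ s ∈ Icc 0 T, ∀ t ∈ Icc 0 T, |t - s| < δ →
      |V n t - V n s| < ε) :
    ∃ (U : ℝ → ℝ) (φ : ℕ → ℕ), StrictMono φ ∧
      ∀ t ∈ Icc 0 T, Tendsto (fun n => V (φ n) t) atTop (𝓝 (U t)) := by
  let W : ℕ → BoundedContinuousFunction (Icc 0 T) ℝ := fun n =>
    BoundedContinuousFunction.mkOfCompact ⟨_, (hc n).domRestrict⟩
  have hW : ∀ n (x : Icc 0 T), W n x = V n x := fun n x => rfl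
  have hK : IsCompact (closure (range W)) := by
    refine BoundedContinuousFunction.arzela_ascoli (Icc (-B) B) isCompact_Icc _ ?_ ?_
    · rintro _ x ⟨n, rfl⟩
      exact abs_le.1 (hB n x x.2)
    · refine UniformEquicontinuous.equicontinuous (Metric.uniformEquicontinuous_iff.2 ?_)
      intro ε hε
      obtain ⟨δ, hδ, h⟩ := heq ε hε
      refine ⟨δ, hδ, ?_⟩
      rintro x y hxy ⟨_, n, rfl⟩
      rw [dist_comm, Real.dist_eq]
      refine h n x x.2 y y.2 ?_
      rwa [dist_comm, Subtype.dist_eq, Real.dist_eq] at hxy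
  obtain ⟨f, -, φ, hφ, hf⟩ := hK.tendsto_subseq (x := W) fun n => subset_closure (mem_range_self n)
  refine ⟨fun t => f (projIcc 0 T hT t), φ, hφ, fun t ht => ?_⟩
  have h1 := (BoundedContinuousFunction.tendsto_iff_tendstoUniformly.1 hf).tendsto_at
    (projIcc 0 T hT t)
  refine h1.congr fun n => ?_
  simp [hW, projIcc_of_mem hT ht]

/-! ### Minimisation of the penalised deficit -/

/-- The lower-order part of the penalised functional, meant for positive `U`. The term
`B (∫ U^q - 1)^2` makes the functional coercive and vanishes on normalised functions, and
`ε ∫ U^(-4)` keeps its minimisers away from zero. -/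
noncomputable def potentialPart (p q T κ γ B ε : ℝ) (U : ℝ → ℝ) : ℝ :=
  -κ * (∫ t in 0..T, U t ^ p) ^ (2 / p) + γ * (∫ t in 0..T, U t ^ q) ^ (2 / q)
    + B * ((∫ t in 0..T, U t ^ q) - 1) ^ 2 + ε * ∫ t in 0..T, U t ^ (-4 : ℝ)

/-- The penalised deficit, on positive functions. -/
noncomputable def penalised (p q T κ γ B ε : ℝ) (U : ℝ → ℝ) : ℝ :=
  energy p T U ^ (2 / p) + potentialPart p q T κ γ B ε U

theorem integral_rpow_nonneg {T : ℝ} (hT : 0 ≤ T) {U : ℝ → ℝ} (hpos : ∀ t ∈ Icc 0 T, 0 < U t)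
    (r : ℝ) : 0 ≤ ∫ t in 0..T, U t ^ r :=
  intervalIntegral.integral_nonneg hT fun t ht => Real.rpow_nonneg (hpos t ht).le _

/-- A bound from above: the minimum is controlled by `∫ U^q`, the oscillation by the energy. -/
theorem PerAC.le_of_integral {p q T : ℝ} (hT : 0 < T) (hp : 1 < p) (hq : 1 ≤ q) {U : ℝ → ℝ}
    (hU : PerAC p T U) (hpos : ∀ t ∈ Icc 0 T, 0 < U t) {t : ℝ} (ht : t ∈ Icc 0 T) :
    U t ≤ 1 + (∫ t in 0..T, U t ^ q) / T + T ^ (1 - 1 / p) * energy p T U ^ (1 / p) := by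
  have hc := hU.continuousOn hT.le
  obtain ⟨t₀, ht₀, hmin⟩ := isCompact_Icc.exists_isMinOn ⟨0, le_rfl, hT.le⟩ hc
  have h1 : T * U t₀ ^ q ≤ ∫ t in 0..T, U t ^ q := by
    have : ∫ t in 0..T, U t₀ ^ q ≤ ∫ t in 0..T, U t ^ q := by
      refine intervalIntegral.integral_mono_on hT.le intervalIntegrable_const
        ((hc.rpow_const fun t ht => Or.inl (hpos t ht).ne').intervalIntegrable_of_Icc hT.le)
        fun s hs => ?_
      exact Real.rpow_le_rpow (hpos _ ht₀).le (hmin hs) (by linarith)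
    simpa using this
  have h2 : U t₀ ≤ 1 + U t₀ ^ q := by
    rcases le_total (U t₀) 1 with h | h
    · have := Real.rpow_nonneg (hpos _ ht₀).le q
      linarith
    · have := Real.rpow_le_rpow_of_exponent_le h hq
      rw [Real.rpow_one] at this
      linarith
  have h3 : U t₀ ^ q ≤ (∫ t in 0..T, U t ^ q) / T := by
    rw [le_div_iff₀ hT]; linarith
  have h4 := (abs_le.1 (hU.osc_le hT.le hp ht₀ ht)).2
  linarith

theorem rpow_le_of_one_le {x r : ℝ} (hx : 1 ≤ x) (hr : r ≤ 1) : x ^ r ≤ x := by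
  have := Real.rpow_le_rpow_of_exponent_le hx hr
  rwa [Real.rpow_one] at this

/-- Coercivity of the penalised deficit on positive functions, for a penalisation constant `B`
independent of `ε`. For `q < p` the term `‖U‖_p^2` is interpolated between `∫ U^q` and the supremum
of `U` raised to the power `p - q`, which is less than one. The two sign patterns allowed for
`κ` and `γ` are those of `q ≤ p` and of `p < q`. -/
theorem exists_coercive {p q T κ γ : ℝ} (hT : 0 < T) (hp : 2 < p) (hq : p - 1 < q)
    (hκ : (q ≤ p ∧ 0 ≤ κ ∧ 0 ≤ γ) ∨ (κ ≤ 0 ∧ γ ≤ 0)) :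
    ∃ B c : ℝ, 0 ≤ B ∧ ∀ ε, 0 ≤ ε → ∀ U, PerAC p T U → (∀ t ∈ Icc 0 T, 0 < U t) →
      energy p T U ^ (2 / p) / 2 + (∫ t in 0..T, U t ^ q) ^ 2 + ε * (∫ t in 0..T, U t ^ (-4 : ℝ))
        - c ≤ penalised p q T κ γ B ε U := by
  have hp0 : 0 < p := by linarith
  have hq0 : 0 < q := by linarith
  have h2p : 2 / p ≤ 1 := by rw [div_le_one hp0]; exact hp.le
  suffices h : ∃ C : ℝ, 0 ≤ C ∧ ∀ U, PerAC p T U → (∀ t ∈ Icc 0 T, 0 < U t) →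
      -(energy p T U ^ (2 / p) / 2) - C * (1 + ∫ t in 0..T, U t ^ q) ^ 2 ≤
      -κ * (∫ t in 0..T, U t ^ p) ^ (2 / p) + γ * (∫ t in 0..T, U t ^ q) ^ (2 / q) by
    obtain ⟨C, hC, h⟩ := h
    refine ⟨2 * C + 2, 8 * C + 2, by linarith, fun ε hε U hU hpos => ?_⟩
    have h1 := h U hU hpos
    rw [penalised, potentialPart]
    set R := ∫ t in 0..T, U t ^ q
    have e1 : (1 + R) ^ 2 ≤ 2 * (R - 1) ^ 2 + 8 := by nlinarith [sq_nonneg (R - 3)]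
    have e2 : R ^ 2 ≤ 2 * (R - 1) ^ 2 + 2 := by nlinarith [sq_nonneg (R - 2)]
    have e3 : C * (1 + R) ^ 2 ≤ C * (2 * (R - 1) ^ 2 + 8) := by gcongr
    linarith
  rcases hκ with ⟨hqp, hκ, hγ⟩ | ⟨hκ, hγ⟩
  · set c₁ := T ^ (1 - 1 / p) with hc₁
    have hc₁0 : 0 ≤ c₁ := by positivity
    refine ⟨κ * (1 + 1 / T) + κ ^ 2 * c₁ ^ 2 / 2, by positivity, fun U hU hpos => ?_⟩
    have hc := hU.continuousOn hT.le
    set R := ∫ t in 0..T, U t ^ q with hR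
    have hR0 : 0 ≤ R := integral_rpow_nonneg hT.le hpos q
    set S := ∫ t in 0..T, U t ^ p with hS
    have hS0 : 0 ≤ S := integral_rpow_nonneg hT.le hpos p
    have hE0 := energy_nonneg (p := p) hT.le U
    set x := energy p T U ^ (1 / p) with hx
    have hx0 : 0 ≤ x := by positivity
    have hx2 : energy p T U ^ (2 / p) = x ^ 2 := by
      rw [hx, ← Real.rpow_natCast, ← Real.rpow_mul hE0]; congr 1; push_cast; ring
    set M := 1 + R / T + c₁ * x with hM
    have hM1 : 1 ≤ M := by
      have : 0 ≤ R / T := by positivity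
      have : 0 ≤ c₁ * x := by positivity
      linarith
    have hSM : S ≤ M * R := by
      rw [hR, ← intervalIntegral.integral_const_mul]
      have hr : ∀ r : ℝ, IntervalIntegrable (fun t => U t ^ r) volume 0 T := fun r =>
        (hc.rpow_const fun t ht => Or.inl (hpos t ht).ne').intervalIntegrable_of_Icc hT.le
      refine intervalIntegral.integral_mono_on hT.le (hr p) ((hr q).const_mul _) fun t ht => ?_
      have hu := hpos t ht
      have : U t ^ p = U t ^ (p - q) * U t ^ q := by rw [← Real.rpow_add hu]; ring_nf
      rw [this]
      have hUM := hU.le_of_integral hT (by linarith) (by linarith : 1 ≤ q) hpos ht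
      have h1 : U t ^ (p - q) ≤ M := by
        calc U t ^ (p - q) ≤ M ^ (p - q) := Real.rpow_le_rpow hu.le hUM (by linarith)
          -- the exponent is at most one because `q > p - 1`
          _ ≤ M := rpow_le_of_one_le hM1 (by linarith)
      have := Real.rpow_nonneg hu.le q
      gcongr
    have hS2 : S ^ (2 / p) ≤ M * (1 + R) := by
      calc S ^ (2 / p) ≤ (M * (1 + R)) ^ (2 / p) := by
            gcongr
            nlinarith
        _ ≤ M * (1 + R) := rpow_le_of_one_le (by nlinarith) h2p
    have hγR : 0 ≤ γ * R ^ (2 / q) := by positivity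
    have hκS : κ * S ^ (2 / p) ≤ κ * (M * (1 + R)) := by gcongr
    rw [hx2]
    have e1 : M * (1 + R) ≤ (1 + 1 / T) * (1 + R) ^ 2 + c₁ * x * (1 + R) := by
      have h3 : M = 1 + (1 / T) * R + c₁ * x := by rw [hM]; ring
      have h4 : 0 < 1 / T := by positivity
      rw [h3]
      nlinarith [mul_nonneg h4.le hR0]
    have e2 : κ * (M * (1 + R)) ≤ κ * ((1 + 1 / T) * (1 + R) ^ 2 + c₁ * x * (1 + R)) := by gcongr
    have e3 : κ * (c₁ * x * (1 + R)) ≤ x ^ 2 / 2 + κ ^ 2 * c₁ ^ 2 / 2 * (1 + R) ^ 2 := by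
      nlinarith [sq_nonneg (x - κ * c₁ * (1 + R))]
    linarith
  · refine ⟨-γ, by linarith, fun U hU hpos => ?_⟩
    set R := ∫ t in 0..T, U t ^ q with hR
    have hR0 : 0 ≤ R := integral_rpow_nonneg hT.le hpos q
    have hS0 := integral_rpow_nonneg hT.le hpos p
    have hE0 := Real.rpow_nonneg (energy_nonneg (p := p) hT.le U) (2 / p)
    have h1 : 0 ≤ -κ * (∫ t in 0..T, U t ^ p) ^ (2 / p) :=
      mul_nonneg (by linarith) (Real.rpow_nonneg hS0 _)
    have h2 : R ^ (2 / q) ≤ (1 + R) ^ 2 := by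
      calc R ^ (2 / q) ≤ (1 + R) ^ (2 / q) := by gcongr; linarith
        _ ≤ (1 + R) ^ (2 : ℝ) := by
          refine Real.rpow_le_rpow_of_exponent_le (by linarith) ?_
          rw [div_le_iff₀ hq0]; linarith
        _ = _ := Real.rpow_two _
    have h3 : -γ * R ^ (2 / q) ≤ -γ * (1 + R) ^ 2 :=
      mul_le_mul_of_nonneg_left h2 (by linarith)
    linarith

/-- Finite energy and a finite integral of `U^(-4)` bound `U` away from zero: near a point with a
small value `m`, the Hölder estimate makes `U` of order `m` on an interval of length `m^2`. -/
theorem exists_lower_bound {p T : ℝ} (hT : 0 < T) (hp : 2 < p) (M N : ℝ) :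
    ∃ δ > 0, ∀ U, PerAC p T U → (∀ t ∈ Icc 0 T, 0 < U t) → energy p T U ≤ M →
      ∫ t in 0..T, U t ^ (-4 : ℝ) ≤ N → ∀ t ∈ Icc 0 T, δ ≤ U t := by
  have hp0 : 0 < p := by linarith
  set A := 1 + |M| ^ (1 / p) with hA
  have hA0 : 0 < A := by positivity
  obtain ⟨δ, hδ0, hδ1, hδT, hδN⟩ : ∃ δ : ℝ, 0 < δ ∧ δ ≤ 1 ∧ δ ^ 2 ≤ T / 2 ∧
      δ ^ 2 * (|N| * A ^ 4) < 1 := by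
    have hc1 : Tendsto (fun δ : ℝ => δ ^ 2) (𝓝[>] 0) (𝓝 0) := by
      have : Tendsto (fun δ : ℝ => δ ^ 2) (𝓝 0) (𝓝 (0 ^ 2)) := (continuous_pow 2).tendsto 0
      rw [zero_pow two_ne_zero] at this
      exact this.mono_left nhdsWithin_le_nhds
    have hc2 := hc1.mul_const (|N| * A ^ 4)
    rw [zero_mul] at hc2
    obtain ⟨δ, ⟨⟨h1, h2⟩, h3⟩, h4⟩ := (((hc1.eventually (gt_mem_nhds (half_pos hT))).and
      (hc2.eventually (gt_mem_nhds one_pos))).and (Ioo_mem_nhdsGT (zero_lt_one' ℝ))).and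
      self_mem_nhdsWithin |>.exists
    exact ⟨δ, h4, h3.2.le, h1.le, h2⟩
  refine ⟨δ, hδ0, fun U hU hpos hE hN t₀ ht₀ => ?_⟩
  by_contra hlt
  push Not at hlt
  set m := U t₀ with hm
  have hm0 : 0 < m := hpos _ ht₀
  have hm2 : m ^ 2 ≤ T / 2 := le_trans (by gcongr) hδT
  obtain ⟨a, ha0, haT, hat⟩ : ∃ a, 0 ≤ a ∧ a + m ^ 2 ≤ T ∧ t₀ ∈ Icc a (a + m ^ 2) := by
    have := sq_nonneg m
    rcases le_total t₀ (T / 2) with h | h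
    · exact ⟨t₀, ht₀.1, by linarith, le_rfl, by linarith⟩
    · exact ⟨t₀ - m ^ 2, by linarith, by linarith [ht₀.2], by linarith, by linarith⟩
  have hm2' : 0 ≤ m ^ 2 := sq_nonneg m
  have hloc : ∀ t ∈ Icc a (a + m ^ 2), U t ≤ A * m := by
    intro t ht
    have ht' : t ∈ Icc 0 T := ⟨by linarith [ht.1], by linarith [ht.2]⟩
    have h1 := (abs_le.1 (hU.abs_sub_le hT.le (by linarith) ht₀ ht')).2
    have h2 : |t - t₀| ≤ m ^ 2 := by
      rw [abs_le]; constructor <;> linarith [ht.1, ht.2, hat.1, hat.2]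
    have h3 : |t - t₀| ^ (1 - 1 / p) ≤ m := by
      have hexp : 1 / 2 ≤ 1 - 1 / p := by
        have : 1 / p ≤ 1 / 2 := one_div_le_one_div_of_le two_pos hp.le
        linarith
      calc |t - t₀| ^ (1 - 1 / p) ≤ (m ^ 2) ^ (1 - 1 / p) := by
            gcongr
        _ ≤ (m ^ 2) ^ (1 / 2 : ℝ) :=
            Real.rpow_le_rpow_of_exponent_ge (by positivity) (by nlinarith) hexp
        _ = m := by rw [← Real.sqrt_eq_rpow, Real.sqrt_sq hm0.le]
    have h4 : energy p T U ^ (1 / p) ≤ |M| ^ (1 / p) :=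
      Real.rpow_le_rpow (energy_nonneg hT.le U) (hE.trans (le_abs_self M)) (by positivity)
    have h5 : |t - t₀| ^ (1 - 1 / p) * energy p T U ^ (1 / p) ≤ m * |M| ^ (1 / p) :=
      mul_le_mul h3 h4 (Real.rpow_nonneg (energy_nonneg hT.le U) _) hm0.le
    rw [hA]
    linarith
  have hc := hU.continuousOn hT.le
  have hi : IntervalIntegrable (fun t => U t ^ (-4 : ℝ)) volume 0 T :=
    (hc.rpow_const fun t ht => Or.inl (hpos t ht).ne').intervalIntegrable_of_Icc hT.le
  have h1 : m ^ 2 * (A * m) ^ (-4 : ℝ) ≤ N := by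
    calc m ^ 2 * (A * m) ^ (-4 : ℝ) = ∫ t in a..(a + m ^ 2), (A * m) ^ (-4 : ℝ) := by simp
      _ ≤ ∫ t in a..(a + m ^ 2), U t ^ (-4 : ℝ) := by
        refine intervalIntegral.integral_mono_on (by linarith) intervalIntegrable_const
          (hi.mono_set ?_) fun t ht => ?_
        · rw [uIcc_of_le (by linarith), uIcc_of_le hT.le]
          exact Icc_subset_Icc ha0 haT
        · exact Real.rpow_le_rpow_of_nonpos
            (hpos t ⟨by linarith [ht.1], by linarith [ht.2]⟩) (hloc t ht) (by norm_num)
      _ ≤ ∫ t in 0..T, U t ^ (-4 : ℝ) := by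
        refine intervalIntegral.integral_mono_interval ha0 (by linarith) haT ?_ hi
        filter_upwards [ae_restrict_mem measurableSet_Ioc] with t ht
        exact Real.rpow_nonneg (hpos t (Ioc_subset_Icc_self ht)).le _
      _ ≤ N := hN
  have h2 : m ^ 2 * (A * m) ^ (-4 : ℝ) = 1 / (A ^ 4 * m ^ 2) := by
    rw [Real.rpow_neg (by positivity), show (4 : ℝ) = ((4 : ℕ) : ℝ) by norm_num,
      Real.rpow_natCast]
    field_simp
  rw [h2, div_le_iff₀ (by positivity)] at h1
  have h3 : N * (A ^ 4 * m ^ 2) ≤ |N| * (A ^ 4 * δ ^ 2) := by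
    gcongr
    exact le_abs_self N
  linarith

theorem tendsto_integral_rpow {T δ B : ℝ} (hT : 0 ≤ T) (hδ : 0 < δ) {V : ℕ → ℝ → ℝ} {U : ℝ → ℝ}
    (hc : ∀ n, ContinuousOn (V n) (Icc 0 T))
    (hδV : ∀ n, ∀ t ∈ Icc 0 T, δ ≤ V n t) (hVB : ∀ n, ∀ t ∈ Icc 0 T, V n t ≤ B)
    (hlim : ∀ t ∈ Icc 0 T, Tendsto (fun n => V n t) atTop (𝓝 (U t))) (r : ℝ) :
    Tendsto (fun n => ∫ t in 0..T, V n t ^ r) atTop (𝓝 (∫ t in 0..T, U t ^ r)) := by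
  obtain ⟨C, hC⟩ := (isCompact_Icc (a := δ) (b := B)).exists_bound_of_continuousOn
    (f := fun x : ℝ => x ^ r)
    (continuousOn_id.rpow_const fun x hx => Or.inl (hδ.trans_le hx.1).ne')
  refine intervalIntegral.tendsto_integral_filter_of_dominated_convergence (fun _ => C) ?_ ?_
    intervalIntegrable_const ?_
  · refine Eventually.of_forall fun n => ?_
    rw [uIoc_of_le hT]
    have : ContinuousOn (fun t => V n t ^ r) (Icc 0 T) :=
      (hc n).rpow_const fun t ht => Or.inl (hδ.trans_le (hδV n t ht)).ne'
    exact (this.mono Ioc_subset_Icc_self).aestronglyMeasurable measurableSet_Ioc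
  · refine Eventually.of_forall fun n => Eventually.of_forall fun t ht => ?_
    rw [uIoc_of_le hT] at ht
    exact hC _ ⟨hδV n t (Ioc_subset_Icc_self ht), hVB n t (Ioc_subset_Icc_self ht)⟩
  · refine Eventually.of_forall fun t ht => ?_
    rw [uIoc_of_le hT] at ht
    have ht' := Ioc_subset_Icc_self ht
    exact (hlim t ht').rpow_const
      (Or.inl (hδ.trans_le (ge_of_tendsto' (hlim t ht') fun n => hδV n t ht')).ne')

theorem perAC_const {p T : ℝ} (hp : 0 < p) (c : ℝ) : PerAC p T (fun _ => c) where
  ac := LipschitzOnWith.absolutelyContinuousOnInterval (K := 0)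
    (LipschitzWith.const c).lipschitzOnWith
  per := rfl
  int := by simp [Real.zero_rpow hp.ne']

/-- The penalised deficit has a minimiser among positive functions, by the direct method. The
constant `B` does not depend on `ε`, which later allows `ε → 0`. -/
theorem exists_minimiser {p q T κ γ : ℝ} (hT : 0 < T) (hp : 2 < p) (hq : p - 1 < q)
    (hκ : (q ≤ p ∧ 0 ≤ κ ∧ 0 ≤ γ) ∨ (κ ≤ 0 ∧ γ ≤ 0)) :
    ∃ B, 0 ≤ B ∧ ∀ ε > 0, ∃ U, PerAC p T U ∧ (∀ t ∈ Icc 0 T, 0 < U t) ∧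
      ∀ V, PerAC p T V → (∀ t ∈ Icc 0 T, 0 < V t) →
        penalised p q T κ γ B ε U ≤ penalised p q T κ γ B ε V := by
  have hp0 : 0 < p := by linarith
  have hp1 : 1 < p := by linarith
  obtain ⟨B, c, hB, hcoer⟩ := exists_coercive hT hp hq hκ
  refine ⟨B, hB, fun ε hε => ?_⟩
  have hcoer := hcoer ε hε.le
  set J := penalised p q T κ γ B ε with hJ
  set A : Set (ℝ → ℝ) := {U | PerAC p T U ∧ ∀ t ∈ Icc 0 T, 0 < U t} with hA
  have hne : (J '' A).Nonempty := ⟨_, fun _ => 1, ⟨perAC_const hp0 1, fun _ _ => one_pos⟩, rfl⟩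
  have hbdd : BddBelow (J '' A) := by
    refine ⟨-c, ?_⟩
    rintro _ ⟨U, ⟨hU, hpos⟩, rfl⟩
    have h1 := hcoer U hU hpos
    have h2 : 0 ≤ energy p T U ^ (2 / p) / 2 := by
      have := Real.rpow_nonneg (energy_nonneg (p := p) hT.le U) (2 / p)
      positivity
    have h3 : 0 ≤ ε * ∫ t in 0..T, U t ^ (-4 : ℝ) :=
      mul_nonneg hε.le (integral_rpow_nonneg hT.le hpos _)
    linarith [sq_nonneg (∫ t in 0..T, U t ^ q)]
  obtain ⟨y, -, hy, hyA⟩ := exists_seq_tendsto_sInf hne hbdd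
  choose V hVA hVy using hyA
  set m := sInf (J '' A) with hm
  obtain ⟨K, hK⟩ := hy.bddAbove_range
  have hK : ∀ n, J (V n) ≤ K := fun n => (hVy n).trans_le (hK (mem_range_self n))
  -- bounds along the minimising sequence
  have hbounds : ∀ n, energy p T (V n) ≤ (2 * |K + c|) ^ (p / 2) ∧
      (∫ t in 0..T, V n t ^ q) ≤ 1 + |K + c| ∧
      (∫ t in 0..T, V n t ^ (-4 : ℝ)) ≤ |K + c| / ε := by
    intro n
    obtain ⟨hU, hpos⟩ := hVA n
    have h1 := (hcoer _ hU hpos).trans (hK n)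
    have hE0 := energy_nonneg (p := p) hT.le (V n)
    have h2 := Real.rpow_nonneg hE0 (2 / p)
    have h3 : 0 ≤ ε * ∫ t in 0..T, V n t ^ (-4 : ℝ) :=
      mul_nonneg hε.le (integral_rpow_nonneg hT.le hpos _)
    have h4 := le_abs_self (K + c)
    have h5 := sq_nonneg (∫ t in 0..T, V n t ^ q)
    refine ⟨?_, ?_, ?_⟩
    · have h6 : energy p T (V n) ^ (2 / p) ≤ 2 * |K + c| := by linarith
      have h7 := Real.rpow_le_rpow h2 h6 (show 0 ≤ p / 2 by positivity)
      rwa [← Real.rpow_mul hE0, show 2 / p * (p / 2) = 1 by field_simp, Real.rpow_one] at h7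
    · nlinarith [sq_nonneg ((∫ t in 0..T, V n t ^ q) - 1)]
    · rw [le_div_iff₀ hε]; linarith
  set M := (2 * |K + c|) ^ (p / 2) with hM
  have hM0 : 0 ≤ M := by positivity
  obtain ⟨δ, hδ, hlow⟩ := exists_lower_bound hT hp M (|K + c| / ε)
  have hVδ : ∀ n, ∀ t ∈ Icc 0 T, δ ≤ V n t := fun n =>
    hlow _ (hVA n).1 (hVA n).2 (hbounds n).1 (hbounds n).2.2
  have hVc : ∀ n, ContinuousOn (V n) (Icc 0 T) := fun n => (hVA n).1.continuousOn hT.le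
  set Bd := 1 + (1 + |K + c|) / T + T ^ (1 - 1 / p) * M ^ (1 / p) with hBd
  have hVB : ∀ n, ∀ t ∈ Icc 0 T, V n t ≤ Bd := by
    intro n t ht
    refine ((hVA n).1.le_of_integral hT hp1 (by linarith : 1 ≤ q) (hVA n).2 ht).trans ?_
    have h1 := (hbounds n).2.1
    have h2 := (hbounds n).1
    have h3 := energy_nonneg (p := p) hT.le (V n)
    rw [hBd]
    gcongr
  have hexp : 0 < 1 - 1 / p := by
    rw [sub_pos, div_lt_one hp0]; exact hp1
  obtain ⟨U, φ, hφ, hlim⟩ := exists_subseq_tendsto_of_equicontinuous hT.le (V := V) (B := Bd)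
    (fun n t ht => by rw [abs_of_pos ((hVA n).2 t ht)]; exact hVB n t ht) hVc (by
      intro ε' hε'
      have hc : Tendsto (fun x : ℝ => x ^ (1 - 1 / p) * M ^ (1 / p)) (𝓝 0) (𝓝 0) := by
        have : Continuous fun x : ℝ => x ^ (1 - 1 / p) * M ^ (1 / p) :=
          (continuous_id.rpow_const fun _ => Or.inr hexp.le).mul continuous_const
        have h := this.tendsto 0
        rwa [Real.zero_rpow hexp.ne', zero_mul] at h
      obtain ⟨d, hd, h⟩ := Metric.tendsto_nhds_nhds.1 hc ε' hε'
      refine ⟨d, hd, fun n s hs t ht hst => ?_⟩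
      have h1 := h (x := |t - s|) (by simpa [Real.dist_eq] using hst)
      rw [Real.dist_eq, sub_zero] at h1
      refine lt_of_le_of_lt ?_ ((le_abs_self _).trans_lt h1)
      refine ((hVA n).1.abs_sub_le hT.le hp1 hs ht).trans ?_
      have h2 := (hbounds n).1
      have h3 := energy_nonneg (p := p) hT.le (V n)
      gcongr)
  have hpot : Tendsto (fun n => potentialPart p q T κ γ B ε (V (φ n))) atTop
      (𝓝 (potentialPart p q T κ γ B ε U)) := by
    have hr : ∀ r : ℝ, Tendsto (fun n => ∫ t in 0..T, V (φ n) t ^ r) atTop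
        (𝓝 (∫ t in 0..T, U t ^ r)) :=
      tendsto_integral_rpow hT.le hδ (fun n => hVc _) (fun n => hVδ _) (fun n => hVB _) hlim
    exact ((((hr p).rpow_const (Or.inr (by positivity))).const_mul _).add
      (((hr q).rpow_const (Or.inr (div_nonneg zero_le_two (by linarith)))).const_mul _)).add
      ((((hr q).sub_const 1).pow 2).const_mul _) |>.add ((hr _).const_mul _)
  have hE : Tendsto (fun n => energy p T (V (φ n)) ^ (2 / p)) atTop
      (𝓝 (m - potentialPart p q T κ γ B ε U)) := by
    have h1 : Tendsto (fun n => J (V (φ n))) atTop (𝓝 m) := by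
      simp only [hVy]
      exact hy.comp hφ.tendsto_atTop
    refine (h1.sub hpot).congr fun n => ?_
    simp [hJ, penalised]
  set ℓ := m - potentialPart p q T κ γ B ε U with hℓ
  have hℓ0 : 0 ≤ ℓ := ge_of_tendsto' hE fun n => Real.rpow_nonneg (energy_nonneg hT.le _) _
  have hE' : Tendsto (fun n => energy p T (V (φ n))) atTop (𝓝 (ℓ ^ (p / 2))) := by
    refine (hE.rpow_const (p := p / 2) (Or.inr (by positivity))).congr fun n => ?_
    rw [← Real.rpow_mul (energy_nonneg hT.le _), show 2 / p * (p / 2) = 1 by field_simp,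
      Real.rpow_one]
  obtain ⟨hU, hUE⟩ := PerAC.of_tendsto hT hp1 (fun n => (hVA (φ n)).1) hE' hlim
  have hUpos : ∀ t ∈ Icc 0 T, 0 < U t := fun t ht =>
    hδ.trans_le (ge_of_tendsto' (hlim t ht) fun n => hVδ _ t ht)
  refine ⟨U, hU, hUpos, fun W hW hWpos => ?_⟩
  have h1 : J U ≤ m := by
    have h2 := Real.rpow_le_rpow (energy_nonneg hT.le U) hUE (show 0 ≤ 2 / p by positivity)
    rw [← Real.rpow_mul hℓ0, show p / 2 * (2 / p) = 1 by field_simp, Real.rpow_one] at h2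
    rw [hJ, penalised]
    linarith
  exact h1.trans (csInf_le hbdd ⟨W, ⟨hW, hWpos⟩, rfl⟩)

/-! ### The Euler-Lagrange equation -/

theorem hasDerivAt_abs_rpow_spow {p : ℝ} (hp : 1 < p) (x : ℝ) :
    HasDerivAt (fun x : ℝ => |x| ^ p) (p * spow (p - 1) x) x := by
  have h := hasDerivAt_abs_rpow x hp
  rwa [mul_assoc, show p - 2 = p - 1 - 1 by ring] at h

theorem rpow_sub_one_le {x p : ℝ} (hx : 0 ≤ x) (hp : 1 ≤ p) : x ^ (p - 1) ≤ 1 + x ^ p := by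
  rcases le_total x 1 with h | h
  · have := Real.rpow_le_one hx h (show 0 ≤ p - 1 by linarith)
    have := Real.rpow_nonneg hx p
    linarith
  · have := Real.rpow_le_rpow_of_exponent_le h (show p - 1 ≤ p by linarith)
    linarith

theorem add_rpow_le {x y p : ℝ} (hx : 0 ≤ x) (hy : 0 ≤ y) (hp : 0 ≤ p) :
    (x + y) ^ p ≤ 2 ^ p * (x ^ p + y ^ p) := by
  have h0 := Real.rpow_nonneg hx p
  have h1 := Real.rpow_nonneg hy p
  have h2 : (0 : ℝ) ≤ 2 ^ p := by positivity
  rcases le_total x y with h | h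
  · calc (x + y) ^ p ≤ (2 * y) ^ p := by gcongr; linarith
      _ = 2 ^ p * y ^ p := Real.mul_rpow zero_le_two hy
      _ ≤ _ := by gcongr; linarith
  · calc (x + y) ^ p ≤ (2 * x) ^ p := by gcongr; linarith
      _ = 2 ^ p * x ^ p := Real.mul_rpow zero_le_two hx
      _ ≤ _ := by gcongr; linarith

theorem aestronglyMeasurable_spow_deriv {a : ℝ} (ha : 0 < a) (U : ℝ → ℝ) (μ : Measure ℝ) :
    AEStronglyMeasurable (fun t => spow a (deriv U t)) μ :=
  (((continuous_spow ha).measurable).comp (measurable_deriv U)).aestronglyMeasurable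

theorem PerAC.intervalIntegrable_spow {p T : ℝ} {U : ℝ → ℝ} (hU : PerAC p T U)
    (hp : 1 < p) : IntervalIntegrable (fun t => spow (p - 1) (deriv U t)) volume 0 T := by
  refine (intervalIntegrable_const (c := (1 : ℝ)).add hU.int).mono_fun
    (aestronglyMeasurable_spow_deriv (by linarith) U _) (Eventually.of_forall fun t => ?_)
  beta_reduce
  rw [Real.norm_eq_abs, abs_spow (by linarith), Real.norm_eq_abs]
  exact (rpow_sub_one_le (abs_nonneg _) hp.le).trans (le_abs_self _)

theorem ae_deriv_add_const_mul {T : ℝ} (hT : 0 ≤ T) {U η : ℝ → ℝ}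
    (hU : AbsolutelyContinuousOnInterval U 0 T) (hη : AbsolutelyContinuousOnInterval η 0 T)
    (s : ℝ) : ∀ᵐ t, t ∈ Ioc 0 T → deriv (fun t => U t + s * η t) t = deriv U t + s * deriv η t := by
  filter_upwards [hU.ae_differentiableAt, hη.ae_differentiableAt] with t h1 h2 ht
  have ht' : t ∈ uIcc 0 T := by rw [uIcc_of_le hT]; exact Ioc_subset_Icc_self ht
  exact ((h1 ht').hasDerivAt.add ((h2 ht').hasDerivAt.const_mul s)).deriv

section Variation

variable {p T H : ℝ} {U η : ℝ → ℝ}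

theorem PerAC.intervalIntegrable_variation (hU : PerAC p T U) (hT : 0 ≤ T) (hp : 1 < p)
    (hH : ∀ᵐ t, t ∈ Ioc 0 T → |deriv η t| ≤ H) (s : ℝ) :
    IntervalIntegrable (fun t => |deriv U t + s * deriv η t| ^ p) volume 0 T := by
  refine ((hU.int.add (intervalIntegrable_const (c := (|s| * H) ^ p))).const_mul (2 ^ p)).mono_fun
    ?_ ?_
  · have h1 := measurable_deriv U
    have h2 := measurable_deriv η
    exact (by fun_prop : Measurable fun t => |deriv U t + s * deriv η t| ^ p).aestronglyMeasurable
  · rw [uIoc_of_le hT, EventuallyLE, ae_restrict_iff' measurableSet_Ioc]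
    filter_upwards [hH] with t ht hmem
    have h := ht hmem
    have hH0 : 0 ≤ H := (abs_nonneg _).trans h
    rw [Real.norm_of_nonneg (by positivity), Real.norm_of_nonneg (by positivity)]
    refine le_trans ?_ (add_rpow_le (abs_nonneg _) (by positivity) (by linarith))
    gcongr
    calc |deriv U t + s * deriv η t| ≤ |deriv U t| + |s * deriv η t| := abs_add_le _ _
      _ ≤ _ := by rw [abs_mul]; gcongr

theorem PerAC.add_const_mul (hU : PerAC p T U) (hT : 0 ≤ T) (hp : 1 < p)
    (hη : AbsolutelyContinuousOnInterval η 0 T) (hη0 : η 0 = η T)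
    (hH : ∀ᵐ t, t ∈ Ioc 0 T → |deriv η t| ≤ H) (s : ℝ) :
    PerAC p T (fun t => U t + s * η t) where
  ac := hU.ac.add (hη.const_mul s)
  per := by simp only [hU.per, hη0]
  int := by
    refine (hU.intervalIntegrable_variation hT hp hH s).congr_ae ?_
    rw [uIoc_of_le hT, EventuallyEq, ae_restrict_iff' measurableSet_Ioc]
    filter_upwards [ae_deriv_add_const_mul hT hU.ac hη s] with t ht hmem
    rw [ht hmem]

theorem energy_add_const_mul (hT : 0 ≤ T) (hU : AbsolutelyContinuousOnInterval U 0 T)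
    (hη : AbsolutelyContinuousOnInterval η 0 T) (s : ℝ) :
    energy p T (fun t => U t + s * η t) = ∫ t in 0..T, |deriv U t + s * deriv η t| ^ p := by
  refine intervalIntegral.integral_congr_ae ?_
  rw [uIoc_of_le hT]
  filter_upwards [ae_deriv_add_const_mul hT hU hη s] with t ht hmem
  rw [ht hmem]

theorem PerAC.hasDerivAt_energy (hU : PerAC p T U) (hT : 0 ≤ T) (hp : 1 < p)
    (hη : AbsolutelyContinuousOnInterval η 0 T)
    (hH : ∀ᵐ t, t ∈ Ioc 0 T → |deriv η t| ≤ H) :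
    HasDerivAt (fun s => energy p T (fun t => U t + s * η t))
      (p * ∫ t in 0..T, spow (p - 1) (deriv U t) * deriv η t) 0 := by
  have hp0 : 0 < p := by linarith
  have hmU := measurable_deriv U
  have hmη := measurable_deriv η
  simp only [energy_add_const_mul hT hU.ac hη]
  have h := intervalIntegral.hasDerivAt_integral_of_dominated_loc_of_deriv_le (μ := volume)
    (a := 0) (b := T) (x₀ := (0 : ℝ)) (s := Ioo (-1) 1)
    (F := fun s t => |deriv U t + s * deriv η t| ^ p)
    (F' := fun s t => p * spow (p - 1) (deriv U t + s * deriv η t) * deriv η t)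
    (bound := fun t => p * (1 + 2 ^ p * (|deriv U t| ^ p + H ^ p)) * H)
    (Ioo_mem_nhds (by norm_num) (by norm_num))
    (Eventually.of_forall fun s => (by fun_prop :
      Measurable fun t => |deriv U t + s * deriv η t| ^ p).aestronglyMeasurable)
    (by simpa using hU.int) ?_ ?_ ?_ ?_
  · have h2 := h.2
    simp only [zero_mul, add_zero] at h2
    refine h2.congr_deriv ?_
    rw [← intervalIntegral.integral_const_mul]
    simp only [mul_assoc]
  · have := (continuous_spow (a := p - 1) (by linarith)).measurable
    exact (by fun_prop : Measurable fun t =>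
      p * spow (p - 1) (deriv U t + 0 * deriv η t) * deriv η t).aestronglyMeasurable
  · rw [uIoc_of_le hT]
    filter_upwards [hH] with t ht hmem s hs
    have h := ht hmem
    have hH0 : 0 ≤ H := (abs_nonneg _).trans h
    rw [Real.norm_eq_abs, abs_mul, abs_mul, abs_of_pos hp0, abs_spow (by linarith)]
    have h1 : |deriv U t + s * deriv η t| ≤ |deriv U t| + H := by
      have hs1 : |s| ≤ 1 := abs_le.2 ⟨hs.1.le, hs.2.le⟩
      calc |deriv U t + s * deriv η t| ≤ |deriv U t| + |s * deriv η t| := abs_add_le _ _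
        _ ≤ |deriv U t| + 1 * H := by rw [abs_mul]; gcongr
        _ = _ := by ring
    have h2 : |deriv U t + s * deriv η t| ^ (p - 1) ≤ 1 + 2 ^ p * (|deriv U t| ^ p + H ^ p) := by
      calc |deriv U t + s * deriv η t| ^ (p - 1) ≤ (|deriv U t| + H) ^ (p - 1) := by
            gcongr
        _ ≤ 1 + (|deriv U t| + H) ^ p := rpow_sub_one_le (by positivity) hp.le
        _ ≤ _ := by gcongr; exact add_rpow_le (abs_nonneg _) hH0 hp0.le
    gcongr
  · exact (((intervalIntegrable_const.add ((hU.int.add intervalIntegrable_const).const_mul _)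
      ).const_mul p).mul_const H)
  · refine Eventually.of_forall fun t _ s _ => ?_
    have h1 := hasDerivAt_abs_rpow_spow hp (deriv U t + s * deriv η t)
    have h2 : HasDerivAt (fun s => deriv U t + s * deriv η t) (deriv η t) s := by
      simpa using ((hasDerivAt_id s).mul_const (deriv η t)).const_add (deriv U t)
    exact h1.comp s h2

theorem exists_pos_add_const_mul (hT : 0 ≤ T) (hU : ContinuousOn U (Icc 0 T))
    (hη : ContinuousOn η (Icc 0 T)) (hpos : ∀ t ∈ Icc 0 T, 0 < U t) :
    ∃ ρ > 0, ∃ δ > 0, ∃ M, ∀ s ∈ Ioo (-ρ) ρ, ∀ t ∈ Icc 0 T, U t + s * η t ∈ Icc δ M := by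
  obtain ⟨t₀, ht₀, hmin⟩ := isCompact_Icc.exists_isMinOn ⟨0, le_rfl, hT⟩ hU
  obtain ⟨C, hC⟩ := isCompact_Icc.exists_bound_of_continuousOn hη
  obtain ⟨D, hD⟩ := isCompact_Icc.exists_bound_of_continuousOn hU
  have hC0 : 0 ≤ C := (norm_nonneg _).trans (hC t₀ ht₀)
  have hm := hpos t₀ ht₀
  refine ⟨U t₀ / (2 * (C + 1)), by positivity, U t₀ / 2, by positivity, D + U t₀ / 2,
    fun s hs t ht => ?_⟩
  have h1 : |s * η t| ≤ U t₀ / 2 := by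
    have hs' : |s| ≤ U t₀ / (2 * (C + 1)) := abs_le.2 ⟨hs.1.le, hs.2.le⟩
    calc |s * η t| ≤ U t₀ / (2 * (C + 1)) * (C + 1) := by
          rw [abs_mul]
          gcongr
          exact (hC t ht).trans (by linarith)
      _ = U t₀ / 2 := by field_simp
  have h2 := abs_le.1 h1
  have h3 : U t₀ ≤ U t := hmin ht
  have h4 := (abs_le.1 (hD t ht)).2
  constructor <;> linarith

theorem hasDerivAt_integral_rpow (hT : 0 ≤ T) (hU : ContinuousOn U (Icc 0 T))
    (hη : ContinuousOn η (Icc 0 T)) (hpos : ∀ t ∈ Icc 0 T, 0 < U t) (r : ℝ) :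
    HasDerivAt (fun s => ∫ t in 0..T, (U t + s * η t) ^ r)
      (r * ∫ t in 0..T, U t ^ (r - 1) * η t) 0 := by
  obtain ⟨ρ, hρ, δ, hδ, M, hM⟩ := exists_pos_add_const_mul hT hU hη hpos
  obtain ⟨C, hC⟩ := (isCompact_Icc (a := δ) (b := M)).exists_bound_of_continuousOn
    (f := fun x : ℝ => x ^ (r - 1))
    (continuousOn_id.rpow_const fun x hx => Or.inl (hδ.trans_le hx.1).ne')
  obtain ⟨D, hD⟩ := isCompact_Icc.exists_bound_of_continuousOn hη
  have hcont : ∀ s ∈ Ioo (-ρ) ρ, ContinuousOn (fun t => (U t + s * η t) ^ r) (Icc 0 T) :=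
    fun s hs => (hU.add (hη.const_smul s)).rpow_const fun t ht =>
      Or.inl (hδ.trans_le (hM s hs t ht).1).ne'
  have hρ0 : (0 : ℝ) ∈ Ioo (-ρ) ρ := ⟨by linarith, hρ⟩
  have hnhds : Ioo (-ρ) ρ ∈ 𝓝 (0 : ℝ) := Ioo_mem_nhds hρ0.1 hρ0.2
  have hUr : ContinuousOn (fun t => U t ^ (r - 1)) (Icc 0 T) :=
    hU.rpow_const fun t ht => Or.inl (hpos t ht).ne'
  have h := intervalIntegral.hasDerivAt_integral_of_dominated_loc_of_deriv_le (μ := volume)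
    (a := 0) (b := T) (x₀ := (0 : ℝ)) (s := Ioo (-ρ) ρ)
    (F := fun s t => (U t + s * η t) ^ r)
    (F' := fun s t => η t * r * (U t + s * η t) ^ (r - 1))
    (bound := fun _ => D * |r| * C) hnhds ?_
    ((hcont 0 hρ0).intervalIntegrable_of_Icc hT) ?_ ?_ intervalIntegrable_const ?_
  · refine h.2.congr_deriv ?_
    rw [← intervalIntegral.integral_const_mul]
    refine intervalIntegral.integral_congr fun t _ => ?_
    simp only [zero_mul, add_zero]
    ring
  · filter_upwards [hnhds] with s hs
    rw [uIoc_of_le hT]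
    exact ((hcont s hs).mono Ioc_subset_Icc_self).aestronglyMeasurable measurableSet_Ioc
  · rw [uIoc_of_le hT]
    simp only [zero_mul, add_zero]
    exact ((((hη.mul continuousOn_const).mul hUr)).mono
      Ioc_subset_Icc_self).aestronglyMeasurable measurableSet_Ioc
  · rw [uIoc_of_le hT]
    refine Eventually.of_forall fun t ht s hs => ?_
    have ht' := Ioc_subset_Icc_self ht
    rw [norm_mul, norm_mul, Real.norm_eq_abs r]
    have h1 := hC _ (hM s hs t ht')
    have h2 := hD t ht'
    have h3 := (norm_nonneg _).trans h2
    gcongr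
  · rw [uIoc_of_le hT]
    refine Eventually.of_forall fun t ht s hs => ?_
    have h2 : HasDerivAt (fun s => U t + s * η t) (η t) s := by
      simpa using ((hasDerivAt_id s).mul_const (η t)).const_add (U t)
    exact h2.rpow_const (Or.inl (hδ.trans_le (hM s hs t (Ioc_subset_Icc_self ht)).1).ne')

end Variation

/-- The weak Euler-Lagrange equation at a nonconstant positive minimiser. The coefficient of
`U^(q-1)` plays no role later, which is why the constraint term of the functional is harmless. -/
theorem euler_lagrange {p q T κ γ B ε : ℝ} (hT : 0 < T) (hp : 2 < p) (hq : p - 1 < q)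
    {U : ℝ → ℝ} (hU : PerAC p T U) (hpos : ∀ t ∈ Icc 0 T, 0 < U t)
    (hmin : ∀ V, PerAC p T V → (∀ t ∈ Icc 0 T, 0 < V t) →
        penalised p q T κ γ B ε U ≤ penalised p q T κ γ B ε V)
    (hE : 0 < energy p T U) :
    ∃ C, ∀ (η : ℝ → ℝ) (H : ℝ), AbsolutelyContinuousOnInterval η 0 T → η 0 = η T →
      (∀ᵐ t, t ∈ Ioc 0 T → |deriv η t| ≤ H) →
      ∫ t in 0..T, spow (p - 1) (deriv U t) * deriv η t =
        ∫ t in 0..T, (κ * (∫ t in 0..T, U t ^ p) ^ (2 / p - 1) * energy p T U ^ (1 - 2 / p)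
            * U t ^ (p - 1) - C * U t ^ (q - 1)
            + 2 * ε * energy p T U ^ (1 - 2 / p) * U t ^ (-5 : ℝ)) * η t := by
  have hp0 : 0 < p := by linarith
  have hq0 : 0 < q := by linarith
  have hUc := hU.continuousOn hT.le
  have hr : ∀ r : ℝ, ContinuousOn (fun t => U t ^ r) (Icc 0 T) := fun r =>
    hUc.rpow_const fun t ht => Or.inl (hpos t ht).ne'
  have hrpos : ∀ r : ℝ, 0 < ∫ t in 0..T, U t ^ r := fun r =>
    intervalIntegral.intervalIntegral_pos_of_pos_on ((hr r).intervalIntegrable_of_Icc hT.le)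
      (fun t ht => Real.rpow_pos_of_pos (hpos t (Ioo_subset_Icc_self ht)) _) hT
  set E := energy p T U with hEdef
  set S := ∫ t in 0..T, U t ^ p with hS
  set R := ∫ t in 0..T, U t ^ q with hR
  refine ⟨(γ * R ^ (2 / q - 1) + B * (R - 1) * q) * E ^ (1 - 2 / p), fun η H hη hη0 hH => ?_⟩
  have hηc : ContinuousOn η (Icc 0 T) := by
    have := hη.continuousOn; rwa [uIcc_of_le hT.le] at this
  have hii : ∀ r : ℝ, IntervalIntegrable (fun t => U t ^ r * η t) volume 0 T := fun r =>
    ((hr r).mul hηc).intervalIntegrable_of_Icc hT.le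
  have dE := hU.hasDerivAt_energy hT.le (by linarith) hη hH
  have dr := hasDerivAt_integral_rpow hT.le hUc hηc hpos
  have zE : energy p T (fun t => U t + 0 * η t) = E := by simp [hEdef]
  have zr : ∀ r : ℝ, ∫ t in 0..T, (U t + 0 * η t) ^ r = ∫ t in 0..T, U t ^ r := by simp
  have dE2 := dE.rpow_const (p := 2 / p) (Or.inl (by rw [zE]; exact hE.ne'))
  have dp2 := (dr p).rpow_const (p := 2 / p) (Or.inl (by rw [zr]; exact (hrpos p).ne'))
  have dq2 := (dr q).rpow_const (p := 2 / q) (Or.inl (by rw [zr]; exact (hrpos q).ne'))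
  have dB := ((dr q).sub_const 1).pow 2
  have dJ := dE2.add ((((dp2.const_mul (-κ)).add (dq2.const_mul γ)).add (dB.const_mul B)).add
    ((dr (-4)).const_mul ε))
  have hloc : IsLocalMin (fun s => penalised p q T κ γ B ε (fun t => U t + s * η t)) 0 := by
    obtain ⟨ρ, hρ, δ, hδ, M, hM⟩ := exists_pos_add_const_mul hT.le hUc hηc hpos
    filter_upwards [Ioo_mem_nhds (show -ρ < 0 by linarith) hρ] with s hs
    simp only [zero_mul, add_zero]
    exact hmin _ (hU.add_const_mul hT.le (by linarith) hη hη0 hH s)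
      fun t ht => hδ.trans_le (hM s hs t ht).1
  have h0 := hloc.hasDerivAt_eq_zero dJ
  simp only [zE, zr] at h0
  rw [← hS, ← hR] at h0
  set I₀ := ∫ t in 0..T, spow (p - 1) (deriv U t) * deriv η t with hI₀
  set Ip := ∫ t in 0..T, U t ^ (p - 1) * η t with hIp
  set Iq := ∫ t in 0..T, U t ^ (q - 1) * η t with hIq
  rw [show (-4 : ℝ) - 1 = -5 by norm_num] at h0
  set I5 := ∫ t in 0..T, U t ^ (-5 : ℝ) * η t with hI5
  have hEE : E ^ (1 - 2 / p) * E ^ (2 / p - 1) = 1 := by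
    rw [← Real.rpow_add hE]; simp
  have e1 : p * I₀ * (2 / p) = 2 * I₀ := by field_simp
  have e2 : p * Ip * (2 / p) = 2 * Ip := by field_simp
  have e3 : q * Iq * (2 / q) = 2 * Iq := by field_simp
  rw [e1, e2, e3] at h0
  have hrhs : ∫ t in 0..T, (κ * S ^ (2 / p - 1) * E ^ (1 - 2 / p) * U t ^ (p - 1)
        - (γ * R ^ (2 / q - 1) + B * (R - 1) * q) * E ^ (1 - 2 / p) * U t ^ (q - 1)
        + 2 * ε * E ^ (1 - 2 / p) * U t ^ (-5 : ℝ)) * η t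
      = κ * S ^ (2 / p - 1) * E ^ (1 - 2 / p) * Ip
        - (γ * R ^ (2 / q - 1) + B * (R - 1) * q) * E ^ (1 - 2 / p) * Iq
        + 2 * ε * E ^ (1 - 2 / p) * I5 := by
    rw [hIp, hIq, hI5, ← intervalIntegral.integral_const_mul,
      ← intervalIntegral.integral_const_mul, ← intervalIntegral.integral_const_mul,
      ← intervalIntegral.integral_sub ((hii _).const_mul _) ((hii _).const_mul _),
      ← intervalIntegral.integral_add (((hii _).const_mul _).sub ((hii _).const_mul _))
        ((hii _).const_mul _)]
    refine intervalIntegral.integral_congr fun t _ => ?_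
    ring
  rw [hrhs]
  norm_num at h0
  linear_combination (E ^ (1 - 2 / p) / 2) * h0 - I₀ * hEE

/-- The lemma of du Bois-Reymond for integrable functions, tested against bounded functions. -/
theorem ae_eq_const_of_integral_mul_eq_zero {T : ℝ} (hT : 0 < T) {ψ : ℝ → ℝ}
    (hψ : IntervalIntegrable ψ volume 0 T)
    (h : ∀ (h : ℝ → ℝ) (H : ℝ), IntervalIntegrable h volume 0 T → (∀ t, |h t| ≤ H) →
      ∫ t in 0..T, h t = 0 → ∫ t in 0..T, ψ t * h t = 0) :
    ∃ m, ∀ᵐ t, t ∈ Ioc 0 T → ψ t = m := by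
  set m := (∫ t in 0..T, ψ t) / T with hm
  set θ : ℝ → ℝ := fun t => Real.arctan (ψ t - m) with hθ
  have hθb : ∀ t, |θ t| ≤ Real.pi / 2 := fun t =>
    abs_le.2 ⟨(Real.neg_pi_div_two_lt_arctan _).le, (Real.arctan_lt_pi_div_two _).le⟩
  have hψm : IntervalIntegrable (fun t => ψ t - m) volume 0 T := hψ.sub intervalIntegrable_const
  have hθm : AEStronglyMeasurable θ (volume.restrict (uIoc 0 T)) := by
    have h1 := hψm.aestronglyMeasurable
    rw [← uIoc_of_le hT.le] at h1
    exact Real.continuous_arctan.comp_aestronglyMeasurable h1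
  have hθi : IntervalIntegrable θ volume 0 T :=
    (intervalIntegrable_const (c := Real.pi / 2)).mono_fun hθm
      (Eventually.of_forall fun t => by
        beta_reduce
        rw [Real.norm_eq_abs, Real.norm_eq_abs]; exact (hθb t).trans (le_abs_self _))
  set k := (∫ t in 0..T, θ t) / T with hk
  have h1 := h (fun t => θ t - k) (Real.pi / 2 + |k|) (hθi.sub intervalIntegrable_const)
    (fun t => (abs_sub _ _).trans (by gcongr; exact hθb t)) (by
      rw [intervalIntegral.integral_sub hθi intervalIntegrable_const,
        intervalIntegral.integral_const, smul_eq_mul, hk]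
      field_simp
      ring)
  have hψθ : IntervalIntegrable (fun t => (ψ t - m) * θ t) volume 0 T := by
    refine (hψm.norm.mul_const (Real.pi / 2)).mono_fun ?_ (Eventually.of_forall fun t => ?_)
    · have h2 := hψm.aestronglyMeasurable
      rw [← uIoc_of_le hT.le] at h2
      exact h2.mul hθm
    · beta_reduce
      rw [norm_mul, norm_mul, norm_norm]
      gcongr
      rw [Real.norm_eq_abs, Real.norm_eq_abs]
      exact (hθb t).trans (le_abs_self _)
  have h2 : ∫ t in 0..T, (ψ t - m) * θ t = 0 := by
    have e : ∀ t, ψ t * (θ t - k) = (ψ t - m) * θ t - k * (ψ t - m) + m * (θ t - k) := by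
      intro t; ring
    have i1 : IntervalIntegrable (fun t => k * (ψ t - m)) volume 0 T := hψm.const_mul k
    have i2 : IntervalIntegrable (fun t => m * (θ t - k)) volume 0 T :=
      (hθi.sub intervalIntegrable_const).const_mul m
    simp only [e] at h1
    rw [intervalIntegral.integral_add (hψθ.sub i1) i2, intervalIntegral.integral_sub hψθ i1,
      intervalIntegral.integral_const_mul, intervalIntegral.integral_const_mul,
      intervalIntegral.integral_sub hθi intervalIntegrable_const,
      intervalIntegral.integral_sub hψ intervalIntegrable_const,
      intervalIntegral.integral_const, intervalIntegral.integral_const, smul_eq_mul,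
      smul_eq_mul, sub_zero, hk, hm, mul_div_cancel₀ _ hT.ne', mul_div_cancel₀ _ hT.ne'] at h1
    linarith
  have hnn : ∀ x : ℝ, 0 ≤ x * Real.arctan x := by
    intro x
    rcases le_total 0 x with hx | hx
    · exact mul_nonneg hx (Real.arctan_nonneg.2 hx)
    · exact mul_nonneg_of_nonpos_of_nonpos hx (Real.arctan_le_zero.2 hx)
  refine ⟨m, ?_⟩
  rw [intervalIntegral.integral_of_le hT.le, integral_eq_zero_iff_of_nonneg (fun t => hnn _)
    ((intervalIntegrable_iff_integrableOn_Ioc_of_le hT.le).1 hψθ), EventuallyEq,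
    ae_restrict_iff' measurableSet_Ioc] at h2
  filter_upwards [h2] with t ht hmem
  have := ht hmem
  simp only [Pi.zero_apply, mul_eq_zero, Real.arctan_eq_zero_iff, or_self] at this
  linarith

/-! ### Minimisers are constant -/

/-- A minimiser of the penalised deficit is constant. The weak Euler-Lagrange equation and the
lemma of du Bois-Reymond show that `|U'|^(p-2) U'` is of class `C^1` up to a null set,
hence so is `U` after inverting the odd power, and `rigidity` applies. -/
theorem energy_eq_zero_of_minimiser {p q T κ γ B ε lam : ℝ} (hT : 0 < T) (hp : 2 < p)
    (hq : p - 1 < q) (hε : 0 ≤ ε) (hlam : 0 ≤ lam) (hκ : (p - q) * κ = lam)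
    {U : ℝ → ℝ} (hU : PerAC p T U) (hpos : ∀ t ∈ Icc 0 T, 0 < U t)
    (hpoin : ∃ m, lam * (∫ t in 0..T, |U t - m| ^ p) ^ (2 / p) ≤ energy p T U ^ (2 / p))
    (hmin : ∀ V, PerAC p T V → (∀ t ∈ Icc 0 T, 0 < V t) →
        penalised p q T κ γ B ε U ≤ penalised p q T κ γ B ε V) :
    energy p T U = 0 := by
  by_contra hE0
  have hE : 0 < energy p T U := lt_of_le_of_ne (energy_nonneg hT.le U) (Ne.symm hE0)
  have hp1 : 0 < p - 1 := by linarith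
  obtain ⟨C, hEL⟩ := euler_lagrange hT hp hq hU hpos hmin hE
  have hUc := hU.continuousOn hT.le
  set a := κ * (∫ t in 0..T, U t ^ p) ^ (2 / p - 1) * energy p T U ^ (1 - 2 / p) with ha
  set D := 2 * ε * energy p T U ^ (1 - 2 / p) with hD
  have hD0 : 0 ≤ D := mul_nonneg (by linarith) (Real.rpow_nonneg hE.le _)
  set f : ℝ → ℝ := fun u => a * u ^ (p - 1) - C * u ^ (q - 1) + D * u ^ (-5 : ℝ) with hf
  have hfc : ContinuousOn (fun t => f (U t)) (Icc 0 T) := by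
    have hr : ∀ r : ℝ, ContinuousOn (fun t => U t ^ r) (Icc 0 T) := fun r =>
      hUc.rpow_const fun t ht => Or.inl (hpos t ht).ne'
    exact (((hr _).const_mul a).sub ((hr _).const_mul C)).add ((hr _).const_mul D)
  -- `F` is continuous on the line, and equal to `f ∘ U` on the period
  set F : ℝ → ℝ := fun t => f (U (projIcc 0 T hT.le t)) with hF
  have hFc : Continuous F := by
    have : F = IccExtend hT.le ((Icc 0 T).domRestrict fun t => f (U t)) := rfl
    rw [this]
    exact hfc.domRestrict.Icc_extend'
  have hFU : ∀ t ∈ Icc 0 T, F t = f (U t) := fun t ht => by simp [hF, projIcc_of_mem hT.le ht]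
  set Φ : ℝ → ℝ := fun t => ∫ x in 0..t, F x with hΦ
  have hΦd : ∀ t, HasDerivAt Φ (F t) t := fun t =>
    intervalIntegral.integral_hasDerivAt_right (hFc.intervalIntegrable _ _)
      (hFc.stronglyMeasurableAtFilter _ _) hFc.continuousAt
  have hΦac : AbsolutelyContinuousOnInterval Φ 0 T :=
    (hFc.intervalIntegrable 0 T).absolutelyContinuousOnInterval_intervalIntegral (by simp)
  have hΦc : Continuous Φ := continuous_iff_continuousAt.2 fun t => (hΦd t).continuousAt
  have hEL' : ∀ (η : ℝ → ℝ) (H : ℝ), AbsolutelyContinuousOnInterval η 0 T → η 0 = η T →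
      (∀ᵐ t, t ∈ Ioc 0 T → |deriv η t| ≤ H) →
      ∫ t in 0..T, spow (p - 1) (deriv U t) * deriv η t = ∫ t in 0..T, F t * η t := by
    intro η H h1 h2 h3
    rw [hEL η H h1 h2 h3]
    refine intervalIntegral.integral_congr fun t ht => ?_
    rw [uIcc_of_le hT.le] at ht
    simp only [hFU t ht, hf]
  have hΦT : Φ T = 0 := by
    have := hEL' (fun _ => 1) 0 (perAC_const (p := p) (by linarith) 1).ac rfl (by simp)
    simpa using this.symm
  have hΦ0 : Φ 0 = 0 := by simp [hΦ]
  have hψi : IntervalIntegrable (fun t => spow (p - 1) (deriv U t) + Φ t) volume 0 T :=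
    (hU.intervalIntegrable_spow (by linarith)).add (hΦc.intervalIntegrable _ _)
  obtain ⟨c, hc⟩ := ae_eq_const_of_integral_mul_eq_zero hT hψi (by
    intro h H hi hH hm
    set η : ℝ → ℝ := fun t => ∫ x in 0..t, h x with hη
    have hηac : AbsolutelyContinuousOnInterval η 0 T :=
      hi.absolutelyContinuousOnInterval_intervalIntegral (by simp)
    have hηd : ∀ᵐ t, t ∈ Ioc 0 T → deriv η t = h t := by
      filter_upwards [hi.ae_hasDerivAt_integral] with t ht hmem
      exact (ht (by rw [uIcc_of_le hT.le]; exact Ioc_subset_Icc_self hmem) 0 (by simp)).deriv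
    have hη0 : η 0 = η T := by simp only [hη, hm, intervalIntegral.integral_same]
    have h1 := hEL' η H hηac hη0 (by
      filter_upwards [hηd] with t ht hmem
      rw [ht hmem]; exact hH t)
    have h2 := hΦac.integral_mul_deriv_eq_deriv_mul hηac
    rw [hΦT, hΦ0] at h2
    have h3 : ∫ t in 0..T, deriv Φ t * η t = ∫ t in 0..T, F t * η t := by
      simp only [(hΦd _).deriv]
    have h4 : ∫ t in 0..T, (spow (p - 1) (deriv U t) + Φ t) * h t =
        ∫ t in 0..T, (spow (p - 1) (deriv U t) * deriv η t + Φ t * deriv η t) := by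
      refine intervalIntegral.integral_congr_ae ?_
      rw [uIoc_of_le hT.le]
      filter_upwards [hηd] with t ht hmem
      rw [ht hmem, add_mul]
    have hbd : ∀ {g : ℝ → ℝ}, IntervalIntegrable g volume 0 T →
        IntervalIntegrable (fun t => g t * deriv η t) volume 0 T := by
      intro g hg
      refine (hg.norm.mul_const H).mono_fun ?_ ?_
      · have h5 := hg.aestronglyMeasurable
        rw [← uIoc_of_le hT.le] at h5
        exact h5.mul (measurable_deriv η).aestronglyMeasurable
      · rw [uIoc_of_le hT.le, EventuallyLE, ae_restrict_iff' measurableSet_Ioc]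
        filter_upwards [hηd] with t ht hmem
        rw [norm_mul, norm_mul, norm_norm, ht hmem]
        gcongr
        exact (hH t).trans (le_abs_self H)
    rw [h4, intervalIntegral.integral_add (hbd (hU.intervalIntegrable_spow (by linarith)))
      (hbd (hΦc.intervalIntegrable _ _)), h1, h2, h3]
    ring)
  -- a `C^1` representative of `U` solves the Hamiltonian system
  set Y : ℝ → ℝ := fun t => c - Φ t with hY
  have hYd : ∀ t, HasDerivAt Y (-F t) t := fun t => (hΦd t).const_sub c
  set G : ℝ → ℝ := fun t => spow (1 / (p - 1)) (Y t) with hG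
  have hGc : Continuous G := (continuous_spow (by positivity)).comp (continuous_const.sub hΦc)
  have hGU : ∀ᵐ t, t ∈ Ioc 0 T → deriv U t = G t := by
    filter_upwards [hc] with t ht hmem
    have h1 : Y t = spow (p - 1) (deriv U t) := by
      simp only [hY]; linarith [ht hmem]
    simp only [hG]
    rw [h1, spow_spow hp1, one_div_mul_cancel hp1.ne', spow_one]
  set U₁ : ℝ → ℝ := fun t => U 0 + ∫ x in 0..t, G x with hU₁
  have hU₁d : ∀ t, HasDerivAt U₁ (G t) t := fun t =>
    (intervalIntegral.integral_hasDerivAt_right (hGc.intervalIntegrable _ _)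
      (hGc.stronglyMeasurableAtFilter _ _) hGc.continuousAt).const_add _
  have hUU : ∀ t ∈ Icc 0 T, U₁ t = U t := by
    intro t ht
    have hac : AbsolutelyContinuousOnInterval U 0 t :=
      hU.ac.mono (uIcc_subset_uIcc (by simp) (by rwa [uIcc_of_le hT.le]))
    have h1 := hac.integral_deriv_eq_sub
    have h2 : ∫ x in 0..t, deriv U x = ∫ x in 0..t, G x := by
      refine intervalIntegral.integral_congr_ae ?_
      rw [uIoc_of_le ht.1]
      filter_upwards [hGU] with x hx hmem using hx ⟨hmem.1, hmem.2.trans ht.2⟩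
    simp only [hU₁, ← h2, h1]
    ring
  have hEG : ∫ t in 0..T, |G t| ^ p = energy p T U := by
    refine intervalIntegral.integral_congr_ae ?_
    rw [uIoc_of_le hT.le]
    filter_upwards [hGU] with t ht hmem
    rw [ht hmem]
  obtain ⟨m, hm⟩ := hpoin
  have hcongr : ∀ g : ℝ → ℝ, ∫ t in 0..T, g (U₁ t) = ∫ t in 0..T, g (U t) := fun g =>
    intervalIntegral.integral_congr fun t ht => by
      rw [uIcc_of_le hT.le] at ht
      simp only [hUU t ht]
  have m0 : (0 : ℝ) ∈ Icc 0 T := ⟨le_rfl, hT.le⟩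
  have mT : T ∈ Icc 0 T := ⟨hT.le, le_rfl⟩
  have hG0 := rigidity (U := U₁) (Y := Y) (G := G) (w := fun t => -f (U₁ t)) (m := m) (lam := lam)
    (a := a) (C := C) (D := D) hT hp hq hD0 hlam
    (fun t ht => by rw [hUU t ht]; exact hpos t ht) (fun t _ => hU₁d t) hGc.continuousOn
    (fun t => by simp only [hG]; rw [spow_spow (by positivity), mul_one_div_cancel hp1.ne',
      spow_one])
    (fun t ht => by rw [hUU t ht, ← hFU t ht]; exact hYd t) (fun t => rfl)
    (by rw [hUU 0 m0, hUU T mT, hU.per]) (by simp only [hY, hΦ0, hΦT])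
    (by rw [hEG, hcongr fun u => |u - m| ^ p]; exact hm)
    (by rw [hEG, hcongr fun u => u ^ p, ha, ← hκ]; ring)
  apply hE0
  rw [← hEG]
  refine (intervalIntegral.integral_congr (g := fun _ => 0) fun t ht => ?_).trans (by simp)
  rw [uIcc_of_le hT.le] at ht
  simp [hG0 t ht, Real.zero_rpow (show p ≠ 0 by linarith)]

theorem PerAC.const_mul {p T : ℝ} {U : ℝ → ℝ} (hU : PerAC p T U) (c : ℝ) :
    PerAC p T (fun t => c * U t) ∧ energy p T (fun t => c * U t) = |c| ^ p * energy p T U := by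
  have h : ∀ t, |deriv (fun t => c * U t) t| ^ p = |c| ^ p * |deriv U t| ^ p := by
    intro t
    rw [deriv_const_mul_field, abs_mul, Real.mul_rpow (abs_nonneg _) (abs_nonneg _)]
  refine ⟨⟨hU.ac.const_mul c, by simp only [hU.per], ?_⟩, ?_⟩
  · simp only [h]; exact hU.int.const_mul _
  · simp only [energy, h, intervalIntegral.integral_const_mul]

theorem PerAC.eq_of_energy_eq_zero {p T : ℝ} {U : ℝ → ℝ} (hU : PerAC p T U) (hT : 0 ≤ T)
    (hp : 1 < p) (hE : energy p T U = 0) {t : ℝ} (ht : t ∈ Icc 0 T) : U t = U 0 := by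
  have h := hU.osc_le hT hp ⟨le_rfl, hT⟩ ht
  rw [hE, Real.zero_rpow (by positivity), mul_zero] at h
  exact sub_eq_zero.1 (abs_nonpos_iff.1 h)

/-- The interpolation inequality for positive functions. -/
theorem PerAC.deficit_of_pos {p q T lam : ℝ} (hT : 0 < T) (hp : 2 < p) (hq : p - 1 < q)
    (hpq : p ≠ q) (hlam : 0 ≤ lam)
    (hpoin : ∀ U, PerAC p T U →
      ∃ m, lam * (∫ t in 0..T, |U t - m| ^ p) ^ (2 / p) ≤ energy p T U ^ (2 / p))
    {U : ℝ → ℝ} (hU : PerAC p T U) (hpos : ∀ t ∈ Icc 0 T, 0 < U t) :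
    lam / (p - q) * ((∫ t in 0..T, U t ^ p) ^ (2 / p)
      - T ^ (2 / p - 2 / q) * (∫ t in 0..T, U t ^ q) ^ (2 / q)) ≤ energy p T U ^ (2 / p) := by
  have hp0 : 0 < p := by linarith
  have hq0 : 0 < q := by linarith
  set κ := lam / (p - q) with hκ
  set γ := κ * T ^ (2 / p - 2 / q) with hγ
  have hpq' : p - q ≠ 0 := sub_ne_zero.2 hpq
  have hTpos : 0 < T ^ (2 / p - 2 / q) := by positivity
  have hsign : (q ≤ p ∧ 0 ≤ κ ∧ 0 ≤ γ) ∨ (κ ≤ 0 ∧ γ ≤ 0) := by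
    rcases lt_or_gt_of_ne hpq with h | h
    · right
      have h1 : κ ≤ 0 := div_nonpos_of_nonneg_of_nonpos hlam (by linarith)
      exact ⟨h1, mul_nonpos_of_nonpos_of_nonneg h1 hTpos.le⟩
    · left
      have h1 : 0 ≤ κ := div_nonneg hlam (by linarith)
      exact ⟨h.le, h1, mul_nonneg h1 hTpos.le⟩
  -- normalised functions
  have hnorm : ∀ V, PerAC p T V → (∀ t ∈ Icc 0 T, 0 < V t) → ∫ t in 0..T, V t ^ q = 1 →
      κ * (∫ t in 0..T, V t ^ p) ^ (2 / p) - γ ≤ energy p T V ^ (2 / p) := by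
    intro V hV hVpos hR
    obtain ⟨B, hB, hmin⟩ := exists_minimiser hT hp hq hsign
    have hN := integral_rpow_nonneg hT.le hVpos (-4)
    set N := ∫ t in 0..T, V t ^ (-4 : ℝ) with hNdef
    -- the penalised deficit is nonnegative, since it is so at its constant minimiser
    have key : ∀ ε > 0, κ * (∫ t in 0..T, V t ^ p) ^ (2 / p) - γ
        ≤ energy p T V ^ (2 / p) + ε * N := by
      intro ε hε
      obtain ⟨W, hW, hWpos, hWmin⟩ := hmin ε hε
      have hEW := energy_eq_zero_of_minimiser hT hp hq hε.le hlam (mul_div_cancel₀ _ hpq') hW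
        hWpos (hpoin W hW) hWmin
      have hconst := fun t ht => hW.eq_of_energy_eq_zero hT.le (by linarith) hEW (t := t) ht
      have m0 : (0 : ℝ) ∈ Icc 0 T := ⟨le_rfl, hT.le⟩
      have hw := hWpos 0 m0
      have hi : ∀ r : ℝ, ∫ t in 0..T, W t ^ r = T * W 0 ^ r := by
        intro r
        rw [intervalIntegral.integral_congr (g := fun _ => W 0 ^ r) fun t ht => by
          rw [uIcc_of_le hT.le] at ht; simp only [hconst t ht]]
        simp
      have h1 := hWmin V hV hVpos
      have h2 : 0 ≤ penalised p q T κ γ B ε W := by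
        rw [penalised, potentialPart, hEW, Real.zero_rpow (by positivity), hi, hi, hi,
          Real.mul_rpow hT.le (by positivity), Real.mul_rpow hT.le (by positivity),
          ← Real.rpow_mul hw.le, ← Real.rpow_mul hw.le, mul_div_cancel₀ _ hp0.ne',
          mul_div_cancel₀ _ hq0.ne', hγ, Real.rpow_sub hT]
        have h3 : κ * (T ^ (2 / p) / T ^ (2 / q)) * (T ^ (2 / q) * W 0 ^ (2 : ℝ))
            = κ * (T ^ (2 / p) * W 0 ^ (2 : ℝ)) := by
          field_simp
        rw [h3]
        have h4 : 0 ≤ B * (T * W 0 ^ q - 1) ^ 2 := by positivity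
        have h5 : 0 ≤ ε * (T * W 0 ^ (-4 : ℝ)) := by positivity
        linarith
      have h6 := h2.trans h1
      rw [penalised, potentialPart, hR, ← hNdef, Real.one_rpow] at h6
      linarith
    have hlim : Tendsto (fun ε : ℝ => energy p T V ^ (2 / p) + ε * N) (𝓝[>] 0)
        (𝓝 (energy p T V ^ (2 / p))) := by
      have : Continuous fun ε : ℝ => energy p T V ^ (2 / p) + ε * N := by fun_prop
      have h := this.tendsto 0
      rw [zero_mul, add_zero] at h
      exact h.mono_left nhdsWithin_le_nhds
    exact ge_of_tendsto hlim (eventually_of_mem self_mem_nhdsWithin key)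
  -- reduction to normalised functions by homogeneity
  have hc := hU.continuousOn hT.le
  have hR : 0 < ∫ t in 0..T, U t ^ q :=
    intervalIntegral.intervalIntegral_pos_of_pos_on
      ((hc.rpow_const fun t ht => Or.inl (hpos t ht).ne').intervalIntegrable_of_Icc hT.le)
      (fun t ht => Real.rpow_pos_of_pos (hpos t (Ioo_subset_Icc_self ht)) _) hT
  set R := ∫ t in 0..T, U t ^ q with hRdef
  set c := R ^ (-(1 / q)) with hcdef
  have hc0 : 0 < c := by positivity
  have hscale : ∀ r : ℝ, ∫ t in 0..T, (c * U t) ^ r = c ^ r * ∫ t in 0..T, U t ^ r := by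
    intro r
    rw [← intervalIntegral.integral_const_mul]
    refine intervalIntegral.integral_congr fun t ht => ?_
    rw [uIcc_of_le hT.le] at ht
    exact Real.mul_rpow hc0.le (hpos t ht).le
  obtain ⟨hV, hVE⟩ := hU.const_mul c
  have h := hnorm _ hV (fun t ht => mul_pos hc0 (hpos t ht)) (by
    rw [hscale, ← hRdef, hcdef, ← Real.rpow_mul hR.le, ← Real.rpow_add_one hR.ne',
      show -(1 / q) * q + 1 = 0 by field_simp; ring, Real.rpow_zero])
  have hS := integral_rpow_nonneg hT.le hpos p
  rw [hVE, hscale, Real.mul_rpow (by positivity) hS,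
    Real.mul_rpow (by positivity) (energy_nonneg hT.le U), abs_of_pos hc0,
    ← Real.rpow_mul hc0.le, mul_div_cancel₀ _ hp0.ne'] at h
  have hcR : c ^ (2 : ℝ) * R ^ (2 / q) = 1 := by
    rw [hcdef, ← Real.rpow_mul hR.le, ← Real.rpow_add hR,
      show -(1 / q) * 2 + 2 / q = 0 by ring, Real.rpow_zero]
  have hc2 : 0 < c ^ (2 : ℝ) := by positivity
  refine le_of_mul_le_mul_left ?_ hc2
  calc c ^ (2 : ℝ) * (κ * ((∫ t in 0..T, U t ^ p) ^ (2 / p) - T ^ (2 / p - 2 / q) * R ^ (2 / q)))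
      = κ * (c ^ (2 : ℝ) * (∫ t in 0..T, U t ^ p) ^ (2 / p)) - γ * (c ^ (2 : ℝ) * R ^ (2 / q)) := by
        rw [hγ]; ring
    _ ≤ _ := by rw [hcR, mul_one]; exact h

/-! ### From positive functions to all functions -/

theorem abs_sqrt_sub_sqrt_le (δ x y : ℝ) :
    |√(x ^ 2 + δ ^ 2) - √(y ^ 2 + δ ^ 2)| ≤ |x - y| := by
  have h1 := Real.sq_sqrt (show 0 ≤ x ^ 2 + δ ^ 2 by positivity)
  have h2 := Real.sq_sqrt (show 0 ≤ y ^ 2 + δ ^ 2 by positivity)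
  have h3 : x * y + δ ^ 2 ≤ √(x ^ 2 + δ ^ 2) * √(y ^ 2 + δ ^ 2) := by
    rw [← Real.sqrt_mul (by positivity)]
    refine Real.le_sqrt_of_sq_le ?_
    nlinarith [sq_nonneg (δ * (x - y))]
  refine sq_le_sq.1 ?_
  nlinarith

/-- The positive approximation `√(U² + δ²)` of `|U|` does not increase the energy. -/
theorem PerAC.sqrt_sq_add {p T δ : ℝ} {U : ℝ → ℝ} (hU : PerAC p T U) (hT : 0 ≤ T) (hp : 0 ≤ p)
    (hδ : 0 < δ) : PerAC p T (fun t => √(U t ^ 2 + δ ^ 2)) ∧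
      energy p T (fun t => √(U t ^ 2 + δ ^ 2)) ≤ energy p T U := by
  have hac : AbsolutelyContinuousOnInterval (fun t => √(U t ^ 2 + δ ^ 2)) 0 T := by
    refine squeeze_zero (fun E => Finset.sum_nonneg fun _ _ => dist_nonneg)
      (fun E => Finset.sum_le_sum fun i _ => ?_) hU.ac
    rw [Real.dist_eq, Real.dist_eq]
    exact abs_sqrt_sub_sqrt_le δ _ _
  have hd : ∀ᵐ t, t ∈ Ioc 0 T →
      |deriv (fun t => √(U t ^ 2 + δ ^ 2)) t| ^ p ≤ |deriv U t| ^ p := by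
    filter_upwards [hU.ac.ae_differentiableAt] with t ht hmem
    have h1 := (ht (by rw [uIcc_of_le hT]; exact Ioc_subset_Icc_self hmem)).hasDerivAt
    have h0 : 0 < U t ^ 2 + δ ^ 2 := by positivity
    have hs : 0 < √(U t ^ 2 + δ ^ 2) := Real.sqrt_pos.2 h0
    have h2 : HasDerivAt (fun t => √(U t ^ 2 + δ ^ 2))
        (2 * U t * deriv U t / (2 * √(U t ^ 2 + δ ^ 2))) t := by
      simpa using ((h1.fun_pow 2).add_const (δ ^ 2)).sqrt h0.ne'
    rw [h2.deriv]
    have h3 : |U t| ≤ √(U t ^ 2 + δ ^ 2) := Real.abs_le_sqrt (by nlinarith)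
    refine Real.rpow_le_rpow (abs_nonneg _) ?_ hp
    rw [abs_div, div_le_iff₀ (by positivity), abs_of_pos (a := 2 * _) (by positivity)]
    simp only [abs_mul, abs_two]
    nlinarith [mul_le_mul_of_nonneg_left h3 (abs_nonneg (deriv U t))]
  have hint : IntervalIntegrable (fun t => |deriv (fun t => √(U t ^ 2 + δ ^ 2)) t| ^ p)
      volume 0 T := by
    refine hU.int.mono_fun ?_ ?_
    · have := measurable_deriv fun t => √(U t ^ 2 + δ ^ 2)
      exact (by fun_prop : Measurable fun t =>
        |deriv (fun t => √(U t ^ 2 + δ ^ 2)) t| ^ p).aestronglyMeasurable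
    · rw [uIoc_of_le hT, EventuallyLE, ae_restrict_iff' measurableSet_Ioc]
      filter_upwards [hd] with t ht hmem
      rw [Real.norm_of_nonneg (by positivity), Real.norm_of_nonneg (by positivity)]
      exact ht hmem
  refine ⟨⟨hac, by simp only [hU.per], hint⟩, ?_⟩
  rw [energy, energy, intervalIntegral.integral_of_le hT, intervalIntegral.integral_of_le hT]
  refine setIntegral_mono_on_ae ?_ ?_ measurableSet_Ioc hd
  · exact (intervalIntegrable_iff_integrableOn_Ioc_of_le hT).1 hint
  · exact (intervalIntegrable_iff_integrableOn_Ioc_of_le hT).1 hU.int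

theorem tendsto_integral_sqrt_rpow {T r : ℝ} (hT : 0 ≤ T) (hr : 0 < r) {U : ℝ → ℝ}
    (hU : ContinuousOn U (Icc 0 T)) :
    Tendsto (fun δ : ℝ => ∫ t in 0..T, √(U t ^ 2 + δ ^ 2) ^ r) (𝓝[>] 0)
      (𝓝 (∫ t in 0..T, |U t| ^ r)) := by
  obtain ⟨C, hC⟩ := isCompact_Icc.exists_bound_of_continuousOn hU
  refine intervalIntegral.tendsto_integral_filter_of_dominated_convergence
    (fun _ => √(C ^ 2 + 1 ^ 2) ^ r) ?_ ?_ intervalIntegrable_const ?_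
  · refine Eventually.of_forall fun δ => ?_
    rw [uIoc_of_le hT]
    have : ContinuousOn (fun t => √(U t ^ 2 + δ ^ 2) ^ r) (Icc 0 T) :=
      (((hU.pow 2).add continuousOn_const).sqrt).rpow_const fun _ _ => Or.inr hr.le
    exact (this.mono Ioc_subset_Icc_self).aestronglyMeasurable measurableSet_Ioc
  · filter_upwards [Ioo_mem_nhdsGT (zero_lt_one' ℝ)] with δ hδ
    refine Eventually.of_forall fun t ht => ?_
    rw [uIoc_of_le hT] at ht
    rw [Real.norm_of_nonneg (by positivity)]
    have h1 := hC t (Ioc_subset_Icc_self ht)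
    rw [Real.norm_eq_abs] at h1
    have h2 : U t ^ 2 ≤ C ^ 2 := by rw [← sq_abs]; gcongr
    have h3 : δ ^ 2 ≤ 1 ^ 2 := pow_le_pow_left₀ hδ.1.le hδ.2.le 2
    gcongr
  · refine Eventually.of_forall fun t _ => ?_
    have h : Continuous fun δ : ℝ => √(U t ^ 2 + δ ^ 2) ^ r :=
      ((continuous_const.add (continuous_id.pow 2)).sqrt).rpow_const fun _ => Or.inr hr.le
    have h0 := h.tendsto 0
    simp only [ne_eq, OfNat.ofNat_ne_zero, not_false_eq_true, zero_pow, add_zero,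
      Real.sqrt_sq_eq_abs] at h0
    exact h0.mono_left nhdsWithin_le_nhds

/-- The interpolation inequality on a period, with the Poincaré constant. -/
theorem PerAC.deficit {p q T lam : ℝ} (hT : 0 < T) (hp : 2 < p) (hq : p - 1 < q)
    (hpq : p ≠ q) (hlam : 0 ≤ lam)
    (hpoin : ∀ U, PerAC p T U →
      ∃ m, lam * (∫ t in 0..T, |U t - m| ^ p) ^ (2 / p) ≤ energy p T U ^ (2 / p))
    {U : ℝ → ℝ} (hU : PerAC p T U) :
    lam / (p - q) * ((∫ t in 0..T, |U t| ^ p) ^ (2 / p)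
      - T ^ (2 / p - 2 / q) * (∫ t in 0..T, |U t| ^ q) ^ (2 / q)) ≤ energy p T U ^ (2 / p) := by
  have hp0 : 0 < p := by linarith
  have hq0 : 0 < q := by linarith
  have hUc := hU.continuousOn hT.le
  have l1 := (tendsto_integral_sqrt_rpow hT.le hp0 hUc).rpow_const (p := 2 / p)
    (Or.inr (by positivity))
  have l2 := (tendsto_integral_sqrt_rpow hT.le hq0 hUc).rpow_const (p := 2 / q)
    (Or.inr (by positivity))
  refine le_of_tendsto ((l1.sub (l2.const_mul (T ^ (2 / p - 2 / q)))).const_mul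
    (lam / (p - q))) ?_
  filter_upwards [self_mem_nhdsWithin] with δ hδ
  have hδ : 0 < δ := hδ
  obtain ⟨hV, hVE⟩ := hU.sqrt_sq_add hT.le hp0.le hδ
  refine (PerAC.deficit_of_pos hT hp hq hpq hlam hpoin hV fun t _ => by positivity).trans ?_
  exact Real.rpow_le_rpow (energy_nonneg hT.le _) hVE (by positivity)

/-! ### Functions on the circle and functions on a period -/

theorem integral_circMeasure {E : Type*} [NormedAddCommGroup E] [NormedSpace ℝ E]
    (f : Circ → E) :
    ∫ x, f x ∂circMeasure = (2 * Real.pi)⁻¹ • ∫ t in 0..(2 * Real.pi), f (t : Circ) := by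
  have := AddCircle.intervalIntegral_preimage (2 * Real.pi) 0 f
  rw [zero_add] at this
  rw [this, circMeasure, AddCircle.integral_haarAddCircle]

instance : IsProbabilityMeasure circMeasure :=
  inferInstanceAs (IsProbabilityMeasure AddCircle.haarAddCircle)

theorem volume_eq_smul_circMeasure :
    (volume : Measure Circ) = ENNReal.ofReal (2 * Real.pi) • circMeasure := rfl

theorem circMeasure_eq_smul :
    circMeasure = (ENNReal.ofReal (2 * Real.pi))⁻¹ • (volume : Measure Circ) := by
  rw [volume_eq_smul_circMeasure, smul_smul, ENNReal.inv_mul_cancel, one_smul]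
  · simp [Real.pi_pos]
  · exact ENNReal.ofReal_ne_top

theorem measurePreserving_coe : MeasurePreserving (fun t : ℝ => (t : Circ))
    (volume.restrict (Ioc 0 (2 * Real.pi))) volume := by
  have := AddCircle.measurePreserving_mk (2 * Real.pi) 0
  rwa [zero_add] at this

theorem ae_circMeasure_of_ae_volume {P : Circ → Prop} (h : ∀ᵐ x, P x) :
    ∀ᵐ x ∂circMeasure, P x := by
  rw [circMeasure_eq_smul]
  exact Measure.ae_smul_measure h _

theorem ae_volume_of_ae_circMeasure {P : Circ → Prop} (h : ∀ᵐ x ∂circMeasure, P x) :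
    ∀ᵐ x, P x := by
  rw [volume_eq_smul_circMeasure]
  exact Measure.ae_smul_measure h _

theorem ae_period_of_ae_circMeasure {P : Circ → Prop} (h : ∀ᵐ x ∂circMeasure, P x) :
    ∀ᵐ t : ℝ, t ∈ Ioc 0 (2 * Real.pi) → P t := by
  have := measurePreserving_coe.quasiMeasurePreserving.ae (ae_volume_of_ae_circMeasure h)
  rwa [ae_restrict_iff' measurableSet_Ioc] at this

theorem integrable_circMeasure_iff {E : Type*} [NormedAddCommGroup E] {f : Circ → E}
    (hf : AEStronglyMeasurable f circMeasure) :
    Integrable f circMeasure ↔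
      IntegrableOn (fun t : ℝ => f t) (Ioc 0 (2 * Real.pi)) := by
  have hf' : AEStronglyMeasurable f (volume : Measure Circ) := by
    rw [volume_eq_smul_circMeasure]; exact hf.smul_measure _
  have h := measurePreserving_coe.integrable_comp hf'
  rw [IntegrableOn]
  refine Iff.trans ?_ h.symm
  rw [volume_eq_smul_circMeasure]
  exact (integrable_smul_measure (by simp [Real.pi_pos]) ENNReal.ofReal_ne_top).symm

/-- The representative in `(0, 2π]` of a point of the circle. -/
noncomputable def angle (x : Circ) : ℝ := AddCircle.equivIoc (2 * Real.pi) 0 x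

theorem angle_coe {t : ℝ} (ht : t ∈ Ioc 0 (2 * Real.pi)) : angle (t : Circ) = t := by
  have : t ∈ Ioc 0 (0 + 2 * Real.pi) := by rwa [zero_add]
  exact congrArg Subtype.val (AddCircle.equivIoc_coe_eq this)

theorem coe_angle (x : Circ) : ((angle x : ℝ) : Circ) = x :=
  (AddCircle.equivIoc (2 * Real.pi) 0).symm_apply_apply x

theorem measurePreserving_angle :
    MeasurePreserving angle volume (volume.restrict (Ioc 0 (2 * Real.pi))) := by
  have h : MeasurePreserving angle volume (volume.restrict (Ioc 0 (0 + 2 * Real.pi))) :=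
    (measurePreserving_subtype_coe measurableSet_Ioc).comp
      (AddCircle.measurePreserving_equivIoc (2 * Real.pi) (a := 0))
  rwa [zero_add] at h

theorem ae_circMeasure_of_ae_period {P : Circ → Prop}
    (h : ∀ᵐ t : ℝ, t ∈ Ioc 0 (2 * Real.pi) → P t) : ∀ᵐ x ∂circMeasure, P x := by
  rw [← ae_restrict_iff' measurableSet_Ioc] at h
  refine ae_circMeasure_of_ae_volume ?_
  filter_upwards [measurePreserving_angle.quasiMeasurePreserving.ae h] with x hx
  rwa [coe_angle] at hx

theorem aestronglyMeasurable_comp_angle {U : ℝ → ℝ}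
    (hU : AEStronglyMeasurable U (volume.restrict (Ioc 0 (2 * Real.pi)))) :
    AEStronglyMeasurable (fun x => U (angle x)) circMeasure := by
  have h := hU.comp_measurePreserving measurePreserving_angle
  rw [circMeasure_eq_smul]
  exact h.smul_measure _

theorem integral_comp_angle (U : ℝ → ℝ) :
    ∫ x, U (angle x) ∂circMeasure = (2 * Real.pi)⁻¹ * ∫ t in 0..(2 * Real.pi), U t := by
  rw [integral_circMeasure, smul_eq_mul]
  congr 1
  refine intervalIntegral.integral_congr_ae (Eventually.of_forall fun t ht => ?_)
  rw [uIoc_of_le Real.two_pi_pos.le] at ht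
  rw [angle_coe ht]

theorem circDeriv_coe (φ : Circ → ℝ) (t : ℝ) :
    circDeriv φ (t : Circ) = deriv (fun s : ℝ => φ (s : Circ)) t := by
  have : (fun s : ℝ => φ ((t : Circ) + (s : Circ)))
      = fun s => (fun r : ℝ => φ (r : Circ)) (t + s) := by
    funext s; simp
  rw [circDeriv, this, deriv_comp_const_add (f := fun r : ℝ => φ (r : Circ)), add_zero]

theorem coe_two_pi_eq : ((2 * Real.pi : ℝ) : Circ) = ((0 : ℝ) : Circ) := by
  rw [AddCircle.coe_period]; rfl

theorem memLp_iff_integrable_abs_rpow {α : Type*} [MeasurableSpace α] {μ : Measure α} {p : ℝ}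
    (hp : 0 < p) {f : α → ℝ} (hf : AEStronglyMeasurable f μ) :
    MemLp f (ENNReal.ofReal p) μ ↔ Integrable (fun x => |f x| ^ p) μ := by
  rw [← integrable_norm_rpow_iff hf (by simpa using hp) (by simp), ENNReal.toReal_ofReal hp.le]
  rfl

theorem CircSmooth.absolutelyContinuousOnInterval {φ : Circ → ℝ} (hφ : CircSmooth φ) (a b : ℝ) :
    AbsolutelyContinuousOnInterval (fun t : ℝ => φ t) a b :=
  (hφ.contDiffOn.of_le (by exact_mod_cast le_top)).absolutelyContinuousOnInterval

theorem integral_circDeriv {φ : Circ → ℝ} (hφ : CircSmooth φ) :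
    ∫ x, circDeriv φ x ∂circMeasure = 0 := by
  rw [integral_circMeasure]
  simp only [circDeriv_coe]
  rw [(hφ.absolutelyContinuousOnInterval _ _).integral_deriv_eq_sub, coe_two_pi_eq, sub_self,
    smul_zero]

theorem CircSmooth.continuous {φ : Circ → ℝ} (hφ : CircSmooth φ) : Continuous φ := by
  rw [(QuotientAddGroup.isOpenQuotientMap_mk.isQuotientMap).continuous_iff]
  exact ContDiff.continuous hφ

theorem CircSmooth.continuous_circDeriv {φ : Circ → ℝ} (hφ : CircSmooth φ) :
    Continuous (circDeriv φ) := by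
  rw [(QuotientAddGroup.isOpenQuotientMap_mk.isQuotientMap).continuous_iff]
  have : circDeriv φ ∘ QuotientAddGroup.mk = deriv fun s : ℝ => φ (s : Circ) :=
    funext fun t => circDeriv_coe φ t
  rw [this]
  exact ContDiff.continuous_deriv hφ (by exact_mod_cast le_top)

theorem integrable_mul_of_continuous {f ψ : Circ → ℝ} (hf : Integrable f circMeasure)
    (hψ : Continuous ψ) : Integrable (fun x => f x * ψ x) circMeasure := by
  obtain ⟨C, hC⟩ := isCompact_univ.exists_bound_of_continuousOn hψ.continuousOn
  exact hf.mul_bdd hψ.aestronglyMeasurable (Eventually.of_forall fun x => hC x (mem_univ x))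

/-- A function of class `PerAC` on a period defines a Sobolev function on the circle. -/
theorem PerAC.isSobolev {p : ℝ} (hp : 0 < p) {U : ℝ → ℝ} (hU : PerAC p (2 * Real.pi) U) :
    IsSobolev p (fun x => U (angle x)) (fun x => deriv U (angle x)) := by
  have hT := Real.two_pi_pos
  have hUc := hU.continuousOn hT.le
  have m1 : AEStronglyMeasurable (fun x => U (angle x)) circMeasure :=
    aestronglyMeasurable_comp_angle
      ((hUc.mono Ioc_subset_Icc_self).aestronglyMeasurable measurableSet_Ioc)
  have m2 : AEStronglyMeasurable (fun x => deriv U (angle x)) circMeasure :=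
    aestronglyMeasurable_comp_angle (measurable_deriv U).aestronglyMeasurable
  have hi : ∀ {g : ℝ → ℝ}, AEStronglyMeasurable (fun x => g (angle x)) circMeasure →
      IntervalIntegrable (fun t => |g t| ^ p) volume 0 (2 * Real.pi) →
      MemLp (fun x => g (angle x)) (ENNReal.ofReal p) circMeasure := by
    intro g hg hgi
    rw [memLp_iff_integrable_abs_rpow hp hg, integrable_circMeasure_iff]
    · refine ((intervalIntegrable_iff_integrableOn_Ioc_of_le hT.le).1 hgi).congr_fun
        (fun t ht => ?_) measurableSet_Ioc
      simp only [angle_coe ht]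
    · exact (hg.aemeasurable.norm.pow_const p).aestronglyMeasurable
  refine ⟨hi m1 ((hUc.abs.rpow_const fun _ _ => Or.inr hp.le).intervalIntegrable_of_Icc hT.le),
    hi m2 hU.int, fun φ hφ => ?_⟩
  have hφac := hφ.absolutelyContinuousOnInterval 0 (2 * Real.pi)
  have h := hU.ac.integral_mul_deriv_eq_deriv_mul hφac
  rw [coe_two_pi_eq, ← hU.per, sub_self, zero_sub] at h
  rw [integral_circMeasure, integral_circMeasure, smul_eq_mul, smul_eq_mul, ← mul_neg]
  congr 1
  refine Eq.trans ?_ (h.trans (congrArg Neg.neg ?_))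
  · refine intervalIntegral.integral_congr_ae (Eventually.of_forall fun t ht => ?_)
    rw [uIoc_of_le hT.le] at ht
    rw [angle_coe ht, circDeriv_coe]
  · refine intervalIntegral.integral_congr_ae (Eventually.of_forall fun t ht => ?_)
    rw [uIoc_of_le hT.le] at ht
    simp only [angle_coe ht]

theorem fourier_coe_two_pi (n : ℤ) (t : ℝ) :
    (fourier n (t : Circ) : ℂ) = Real.cos (n * t) + Real.sin (n * t) * Complex.I := by
  rw [fourier_coe_apply, Complex.ofReal_cos, Complex.ofReal_sin, ← Complex.exp_mul_I]
  congr 1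
  have : (Real.pi : ℂ) ≠ 0 := by exact_mod_cast Real.pi_ne_zero
  push_cast
  field_simp

theorem fourier_re_coe (n : ℤ) (t : ℝ) :
    (fourier n (t : Circ) : ℂ).re = Real.cos (n * t) := by
  rw [fourier_coe_two_pi]; simp [-Complex.ofReal_cos, -Complex.ofReal_sin]

theorem fourier_im_coe (n : ℤ) (t : ℝ) :
    (fourier n (t : Circ) : ℂ).im = Real.sin (n * t) := by
  rw [fourier_coe_two_pi]; simp [-Complex.ofReal_cos, -Complex.ofReal_sin]

theorem circDeriv_fourier_re (n : ℤ) (x : Circ) :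
    circDeriv (fun x => (fourier n x : ℂ).re) x = -n * (fourier n x : ℂ).im := by
  rw [← coe_angle x, circDeriv_coe, fourier_im_coe]
  simp only [fourier_re_coe]
  have h := ((hasDerivAt_id (angle x)).const_mul (n : ℝ)).cos
  rw [show (fun t : ℝ => Real.cos (n * t)) = fun t : ℝ => Real.cos (n * id t) from rfl, h.deriv]
  simp
  ring

theorem circDeriv_fourier_im (n : ℤ) (x : Circ) :
    circDeriv (fun x => (fourier n x : ℂ).im) x = n * (fourier n x : ℂ).re := by
  rw [← coe_angle x, circDeriv_coe, fourier_re_coe]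
  simp only [fourier_im_coe]
  have h := ((hasDerivAt_id (angle x)).const_mul (n : ℝ)).sin
  rw [show (fun t : ℝ => Real.sin (n * t)) = fun t : ℝ => Real.sin (n * id t) from rfl, h.deriv]
  simp
  ring

theorem circSmooth_fourier_re (n : ℤ) : CircSmooth fun x => (fourier n x : ℂ).re := by
  simp only [CircSmooth, fourier_re_coe]
  exact Real.contDiff_cos.comp (contDiff_const.mul contDiff_id)

theorem circSmooth_fourier_im (n : ℤ) : CircSmooth fun x => (fourier n x : ℂ).im := by
  simp only [CircSmooth, fourier_im_coe]
  exact Real.contDiff_sin.comp (contDiff_const.mul contDiff_id)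

/-- The lemma of du Bois-Reymond on the circle, through Fourier coefficients: those of
index `n ≠ 0` vanish by testing against `cos (n t)` and `sin (n t)`. -/
theorem ae_eq_const_of_integral_mul_circDeriv_eq_zero {f : Circ → ℝ}
    (hf : MemLp f 2 circMeasure)
    (h : ∀ φ, CircSmooth φ → ∫ x, f x * circDeriv φ x ∂circMeasure = 0) :
    ∃ c, f =ᵐ[circMeasure] fun _ => c := by
  have hfi : Integrable f circMeasure := hf.integrable (by norm_num)
  set c := ∫ x, f x ∂circMeasure with hc
  have hfc : Integrable (fun x => f x - c) circMeasure := hfi.sub (integrable_const c)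
  have h' : ∀ φ, CircSmooth φ → ∫ x, (f x - c) * circDeriv φ x ∂circMeasure = 0 := by
    intro φ hφ
    have e : ∀ x, (f x - c) * circDeriv φ x = f x * circDeriv φ x - c * circDeriv φ x :=
      fun x => sub_mul _ _ _
    simp only [e]
    rw [integral_sub (integrable_mul_of_continuous hfi hφ.continuous_circDeriv)
      (integrable_mul_of_continuous (integrable_const c) hφ.continuous_circDeriv), h φ hφ,
      integral_const_mul, integral_circDeriv hφ, mul_zero, sub_zero]
  set g : Circ → ℂ := fun x => ((f x - c : ℝ) : ℂ) with hg
  have hgm : MemLp g 2 AddCircle.haarAddCircle := (hf.sub (memLp_const c)).ofReal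
  have hcoef : ∀ n : ℤ, fourierCoeff g n = 0 := by
    intro n
    rcases eq_or_ne n 0 with rfl | hn
    · have : fourierCoeff g 0 = ((∫ x, (f x - c) ∂circMeasure : ℝ) : ℂ) := by
        rw [fourierCoeff, ← integral_complex_ofReal]
        simp [hg, circMeasure]
      rw [this, integral_sub hfi (integrable_const c)]
      simp [hc]
    · have hn' : (n : ℝ) ≠ 0 := by exact_mod_cast hn
      have hre := h' _ (circSmooth_fourier_im n)
      have him := h' _ (circSmooth_fourier_re n)
      simp only [circDeriv_fourier_im, circDeriv_fourier_re, mul_left_comm _ (n : ℝ),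
        mul_left_comm _ (-n : ℝ), integral_const_mul, mul_eq_zero, neg_eq_zero, hn',
        false_or] at hre him
      have e : ∀ x, fourier (-n) x • g x = (((f x - c) * (fourier n x : ℂ).re : ℝ) : ℂ)
          - (((f x - c) * (fourier n x : ℂ).im : ℝ) : ℂ) * Complex.I := by
        intro x
        rw [fourier_neg, smul_eq_mul]
        apply Complex.ext <;> simp [hg, -fourier_apply] <;> ring
      have hc1 : Continuous fun x : Circ => (fourier n x : ℂ).re :=
        (circSmooth_fourier_re n).continuous
      have hc2 : Continuous fun x : Circ => (fourier n x : ℂ).im :=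
        (circSmooth_fourier_im n).continuous
      rw [fourierCoeff]
      simp only [e]
      change ∫ x, _ ∂circMeasure = 0
      rw [integral_sub (integrable_mul_of_continuous hfc hc1).ofReal
        ((integrable_mul_of_continuous hfc hc2).ofReal.mul_const _), integral_mul_const]
      rw [integral_complex_ofReal, integral_complex_ofReal, hre, him]
      simp
  have hzero : hgm.toLp g = 0 := by
    have : (fourierBasis (T := 2 * Real.pi)).repr (hgm.toLp g) = 0 := by
      ext n
      rw [fourierBasis_repr, fourierCoeff_congr_ae hgm.coeFn_toLp, hcoef]
      rfl
    simpa using this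
  refine ⟨c, ?_⟩
  have h1 := hgm.coeFn_toLp
  rw [hzero] at h1
  have h2 := Lp.coeFn_zero ℂ 2 (AddCircle.haarAddCircle (T := 2 * Real.pi))
  change ∀ᵐ x ∂AddCircle.haarAddCircle, f x = c
  filter_upwards [h1, h2] with x hx hx0
  rw [hx0] at hx
  have : f x - c = 0 := by
    have := hx.symm
    simp only [hg, Pi.zero_apply] at this
    exact_mod_cast this
  linarith

/-! ### Absolutely continuous representatives -/

/-- A Sobolev function on the circle has an absolutely continuous representative on a period, whose
derivative is the weak one: the primitive of `u'` has the same weak derivative as `u`. -/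
theorem IsSobolev.exists_perAC {p : ℝ} (hp : 2 < p) {u u' : Circ → ℝ} (hu : IsSobolev p u u') :
    ∃ U : ℝ → ℝ, PerAC p (2 * Real.pi) U ∧
      (∀ᵐ t : ℝ, t ∈ Ioc 0 (2 * Real.pi) → u t = U t) ∧
      (∀ᵐ t : ℝ, t ∈ Ioc 0 (2 * Real.pi) → u' t = deriv U t) := by
  have hp0 : 0 < p := by linarith
  have hT := Real.two_pi_pos
  have hle : (2 : ENNReal) ≤ ENNReal.ofReal p := by
    rw [show (2 : ENNReal) = ENNReal.ofReal 2 by simp]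
    exact ENNReal.ofReal_le_ofReal hp.le
  have hu2 : MemLp u 2 circMeasure := hu.memLp.mono_exponent hle
  have hu'i : Integrable u' circMeasure :=
    (hu.memLp_deriv.mono_exponent hle).integrable (by norm_num)
  set g : ℝ → ℝ := fun t => u' t with hg
  have hgi : IntervalIntegrable g volume 0 (2 * Real.pi) :=
    (intervalIntegrable_iff_integrableOn_Ioc_of_le hT.le).2
      ((integrable_circMeasure_iff hu'i.1).1 hu'i)
  set U₀ : ℝ → ℝ := fun t => ∫ s in 0..t, g s with hU₀
  have hac : AbsolutelyContinuousOnInterval U₀ 0 (2 * Real.pi) :=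
    hgi.absolutelyContinuousOnInterval_intervalIntegral (by simp)
  have hd : ∀ᵐ t : ℝ, t ∈ Ioc 0 (2 * Real.pi) → g t = deriv U₀ t := by
    filter_upwards [hgi.ae_hasDerivAt_integral] with t ht hmem
    exact (ht (by rw [uIcc_of_le hT.le]; exact Ioc_subset_Icc_self hmem) 0 (by simp)).deriv.symm
  have hper : U₀ 0 = U₀ (2 * Real.pi) := by
    have h := hu.weak_deriv (fun _ => 1) contDiff_const
    simp only [circDeriv, deriv_const, mul_zero, integral_zero, mul_one] at h
    rw [integral_circMeasure, smul_eq_mul, eq_comm, neg_eq_zero, mul_eq_zero] at h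
    simp only [hU₀, intervalIntegral.integral_same]
    exact (h.resolve_left (by positivity)).symm
  have hp' : IntervalIntegrable (fun t => |deriv U₀ t| ^ p) volume 0 (2 * Real.pi) := by
    have h1 := (memLp_iff_integrable_abs_rpow hp0 hu.memLp_deriv.1).1 hu.memLp_deriv
    have h2 := (intervalIntegrable_iff_integrableOn_Ioc_of_le hT.le).2
      ((integrable_circMeasure_iff h1.1).1 h1)
    refine h2.congr_ae ?_
    rw [uIoc_of_le hT.le, EventuallyEq, ae_restrict_iff' measurableSet_Ioc]
    filter_upwards [hd] with t ht hmem
    rw [← ht hmem]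
  have hU₀P : PerAC p (2 * Real.pi) U₀ := ⟨hac, hper, hp'⟩
  have hS := hU₀P.isSobolev hp0
  have hU₀2 : MemLp (fun x => U₀ (angle x)) 2 circMeasure := hS.memLp.mono_exponent hle
  -- the two functions have the same weak derivative
  obtain ⟨c, hc⟩ := ae_eq_const_of_integral_mul_circDeriv_eq_zero (hu2.sub hU₀2) (by
    intro φ hφ
    have e : ∀ x, (u - fun x => U₀ (angle x)) x * circDeriv φ x
        = u x * circDeriv φ x - U₀ (angle x) * circDeriv φ x := fun x => sub_mul _ _ _
    simp only [e]
    rw [integral_sub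
      (integrable_mul_of_continuous (hu2.integrable (by norm_num)) hφ.continuous_circDeriv)
      (integrable_mul_of_continuous (hU₀2.integrable (by norm_num)) hφ.continuous_circDeriv),
      hu.weak_deriv φ hφ, hS.weak_deriv φ hφ, sub_eq_zero, neg_inj]
    rw [integral_circMeasure, integral_circMeasure]
    congr 1
    refine intervalIntegral.integral_congr_ae ?_
    rw [uIoc_of_le hT.le]
    filter_upwards [hd] with t ht hmem
    rw [angle_coe hmem, ← ht hmem])
  have hcc := perAC_const (p := p) (T := 2 * Real.pi) hp0 c
  refine ⟨fun t => U₀ t + c, ⟨hac.add hcc.ac, by simp only [hper], ?_⟩, ?_, ?_⟩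
  · simpa only [deriv_add_const] using hp'
  · filter_upwards [ae_period_of_ae_circMeasure hc] with t ht hmem
    have := ht hmem
    simp only [Pi.sub_apply, angle_coe hmem] at this
    linarith
  · filter_upwards [hd] with t ht hmem
    rw [deriv_add_const, ← ht hmem]

theorem integral_circMeasure_eq_of_ae {f : Circ → ℝ} {F : ℝ → ℝ}
    (h : ∀ᵐ t : ℝ, t ∈ Ioc 0 (2 * Real.pi) → f t = F t) :
    ∫ x, f x ∂circMeasure = (2 * Real.pi)⁻¹ * ∫ t in 0..(2 * Real.pi), F t := by
  rw [integral_circMeasure, smul_eq_mul]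
  congr 1
  refine intervalIntegral.integral_congr_ae ?_
  rwa [uIoc_of_le Real.two_pi_pos.le]

theorem sq_circNorm_eq (r : ℝ) (u : Circ → ℝ) :
    circNorm r u ^ 2 = (∫ x, |u x| ^ r ∂circMeasure) ^ (2 / r) := by
  rw [circNorm, ← Real.rpow_natCast, ← Real.rpow_mul (integral_nonneg fun _ => by positivity)]
  congr 1
  push_cast
  ring

theorem sq_circNorm_eq_of_ae {r : ℝ} {u : Circ → ℝ} {U : ℝ → ℝ}
    (h : ∀ᵐ t : ℝ, t ∈ Ioc 0 (2 * Real.pi) → u t = U t) :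
    circNorm r u ^ 2
      = ((2 * Real.pi)⁻¹) ^ (2 / r) * (∫ t in 0..(2 * Real.pi), |U t| ^ r) ^ (2 / r) := by
  have hT := Real.two_pi_pos
  rw [sq_circNorm_eq, integral_circMeasure_eq_of_ae (F := fun t => |U t| ^ r), Real.mul_rpow
    (by positivity) (intervalIntegral.integral_nonneg hT.le fun _ _ => by positivity)]
  filter_upwards [h] with t ht hmem
  rw [ht hmem]

theorem IsSobolev.ae_bounded {p : ℝ} (hp : 2 < p) {u u' : Circ → ℝ} (hu : IsSobolev p u u') :
    ∃ M, ∀ᵐ x ∂circMeasure, |u x| ≤ M := by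
  obtain ⟨U, hU, h1, -⟩ := hu.exists_perAC hp
  obtain ⟨M, hM⟩ := isCompact_Icc.exists_bound_of_continuousOn (hU.continuousOn Real.two_pi_pos.le)
  refine ⟨M, ae_circMeasure_of_ae_period ?_⟩
  filter_upwards [h1] with t ht hmem
  rw [ht hmem]
  exact hM t (Ioc_subset_Icc_self hmem)

/-! ### The Poincaré constants -/

theorem rayleighInf_bddBelow (p r : ℝ) :
    BddBelow {y : ℝ | ∃ v v' : Circ → ℝ, IsSobolev p v v' ∧ ¬ (v =ᵐ[circMeasure] 0) ∧
      ∫ x, v x ∂circMeasure = 0 ∧ y = circNorm p v' ^ 2 / circNorm r v ^ 2} := by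
  refine ⟨0, ?_⟩
  rintro _ ⟨v, v', -, -, -, rfl⟩
  positivity

/-- The set defining the Rayleigh quotient is nonempty, as the sine shows: the infimum is not the
junk value at the empty set. -/
theorem rayleighInf_nonempty {p : ℝ} (hp : 0 < p) (r : ℝ) :
    {y : ℝ | ∃ v v' : Circ → ℝ, IsSobolev p v v' ∧ ¬ (v =ᵐ[circMeasure] 0) ∧
      ∫ x, v x ∂circMeasure = 0 ∧ y = circNorm p v' ^ 2 / circNorm r v ^ 2}.Nonempty := by
  have hT := Real.two_pi_pos
  have hP : PerAC p (2 * Real.pi) Real.sin := by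
    refine ⟨Real.contDiff_sin.contDiffOn.absolutelyContinuousOnInterval, by simp, ?_⟩
    rw [Real.deriv_sin]
    exact (Real.continuous_cos.abs.rpow_const fun _ => Or.inr hp.le).intervalIntegrable _ _
  refine ⟨_, _, _, hP.isSobolev hp, fun h => ?_, ?_, rfl⟩
  · have h1 := integral_comp_angle fun t => Real.sin t ^ 2
    rw [integral_congr_ae (g := fun _ => (0 : ℝ)) (by
      filter_upwards [h] with x hx
      simp only [Pi.zero_apply] at hx
      simp [hx]), integral_zero, integral_sin_sq] at h1
    simp [Real.pi_pos.ne'] at h1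
  · rw [integral_comp_angle, integral_sin]
    simp

theorem integral_abs_rpow_eq_zero_iff {r : ℝ} (hr : 0 < r) {u : Circ → ℝ}
    (hu : Integrable (fun x => |u x| ^ r) circMeasure) :
    ∫ x, |u x| ^ r ∂circMeasure = 0 ↔ u =ᵐ[circMeasure] 0 := by
  rw [integral_eq_zero_iff_of_nonneg (fun x => by positivity) hu]
  refine ⟨fun h => ?_, fun h => ?_⟩
  · filter_upwards [h] with x hx
    simpa [Real.rpow_eq_zero_iff_of_nonneg (abs_nonneg _), hr.ne'] using hx
  · filter_upwards [h] with x hx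
    simp [hx, Real.zero_rpow hr.ne']

/-- The Poincaré inequality with the constant `λ₁`, on a period. -/
theorem PerAC.poincare {p : ℝ} (hp : 2 < p) {U : ℝ → ℝ} (hU : PerAC p (2 * Real.pi) U) :
    ∃ m, lambdaOne p * (∫ t in 0..(2 * Real.pi), |U t - m| ^ p) ^ (2 / p)
      ≤ energy p (2 * Real.pi) U ^ (2 / p) := by
  have hp0 : 0 < p := by linarith
  have hT := Real.two_pi_pos
  set m := (2 * Real.pi)⁻¹ * ∫ t in 0..(2 * Real.pi), U t with hm
  refine ⟨m, ?_⟩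
  have hE0 : 0 ≤ energy p (2 * Real.pi) U ^ (2 / p) := Real.rpow_nonneg (energy_nonneg hT.le U) _
  set V : ℝ → ℝ := fun t => U t - m with hV
  have hVd : deriv V = deriv U := funext fun t => deriv_sub_const m
  have hVP : PerAC p (2 * Real.pi) V :=
    ⟨hU.ac.sub (perAC_const hp0 m).ac, by simp only [hV, hU.per], by rw [hVd]; exact hU.int⟩
  have hS := hVP.isSobolev hp0
  have hint := (memLp_iff_integrable_abs_rpow hp0 hS.memLp.1).1 hS.memLp
  have hX0 : 0 ≤ ∫ t in 0..(2 * Real.pi), |V t| ^ p :=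
    intervalIntegral.integral_nonneg hT.le fun _ _ => by positivity
  rcases hX0.eq_or_lt with hX | hX
  · change lambdaOne p * (∫ t in 0..(2 * Real.pi), |V t| ^ p) ^ (2 / p) ≤ _
    rw [← hX, Real.zero_rpow (by positivity), mul_zero]
    exact hE0
  have hne : ¬ ((fun x => V (angle x)) =ᵐ[circMeasure] 0) := by
    rw [← integral_abs_rpow_eq_zero_iff hp0 hint, integral_comp_angle fun t => |V t| ^ p]
    positivity
  have hmean : ∫ x, V (angle x) ∂circMeasure = 0 := by
    have hUi := (hU.continuousOn hT.le).intervalIntegrable_of_Icc (μ := volume) hT.le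
    rw [integral_comp_angle, hV, intervalIntegral.integral_sub hUi intervalIntegrable_const,
      intervalIntegral.integral_const, sub_zero, smul_eq_mul, hm]
    field_simp
    ring
  have h := csInf_le (rayleighInf_bddBelow p p) ⟨_, _, hS, hne, hmean, rfl⟩
  have ae1 : ∀ W : ℝ → ℝ, ∀ᵐ t : ℝ, t ∈ Ioc 0 (2 * Real.pi) →
      (fun x : Circ => W (angle x)) t = W t := fun W =>
    Eventually.of_forall fun t ht => by simp only [angle_coe ht]
  have n1 := sq_circNorm_eq_of_ae (r := p) (u := fun x => V (angle x)) (U := V) (ae1 V)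
  have n2 := sq_circNorm_eq_of_ae (r := p) (u := fun x => deriv V (angle x))
    (U := deriv V) (ae1 (deriv V))
  rw [n1, n2, mul_div_mul_left _ _
    (by positivity), le_div_iff₀ (Real.rpow_pos_of_pos hX _), hVd] at h
  exact h

/-- The infimum is positive because a function of zero mean is bounded by its oscillation. -/
theorem lambdaOne_pos {p : ℝ} (hp : 2 < p) : 0 < lambdaOne p := by
  have hp0 : 0 < p := by linarith
  have hT := Real.two_pi_pos
  refine lt_of_lt_of_le (show 0 < ((2 * Real.pi) ^ 2)⁻¹ by positivity)
    (le_csInf (rayleighInf_nonempty hp0 p) ?_)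
  rintro _ ⟨v, v', hv, hne, hmean, rfl⟩
  obtain ⟨U, hU, h1, h2⟩ := hv.exists_perAC hp
  have hint := (memLp_iff_integrable_abs_rpow hp0 hv.memLp.1).1 hv.memLp
  have hX : 0 < circNorm p v ^ 2 := by
    rw [sq_circNorm_eq]
    refine Real.rpow_pos_of_pos (lt_of_le_of_ne (integral_nonneg fun _ => by positivity) ?_) _
    exact fun h => hne ((integral_abs_rpow_eq_zero_iff hp0 hint).1 h.symm)
  rw [le_div_iff₀ hX, sq_circNorm_eq_of_ae h1, sq_circNorm_eq_of_ae h2]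
  rw [integral_circMeasure_eq_of_ae h1, mul_eq_zero] at hmean
  have hmean := hmean.resolve_left (by positivity)
  have hUc := hU.continuousOn hT.le
  have hUi := hUc.intervalIntegrable_of_Icc (μ := volume) hT.le
  have hE0 := energy_nonneg (p := p) hT.le U
  set E := energy p (2 * Real.pi) U with hE
  set T := 2 * Real.pi with hTdef
  set K := T ^ (1 - 1 / p) * E ^ (1 / p) with hK
  have hK0 : 0 ≤ K := by positivity
  -- a function of zero mean is bounded by its oscillation
  have hb : ∀ t ∈ Icc 0 T, |U t| ≤ K := by
    intro t ht
    have h3 : T * U t = ∫ s in 0..T, (U t - U s) := by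
      rw [intervalIntegral.integral_sub intervalIntegrable_const hUi, hmean,
        intervalIntegral.integral_const, smul_eq_mul, sub_zero, sub_zero]
    have h4 : |∫ s in 0..T, (U t - U s)| ≤ K * |T - 0| := by
      rw [← Real.norm_eq_abs (∫ s in 0..T, (U t - U s))]
      refine intervalIntegral.norm_integral_le_of_norm_le_const fun s hs => ?_
      rw [uIoc_of_le hT.le] at hs
      exact hU.osc_le hT.le (by linarith) (Ioc_subset_Icc_self hs) ht
    rw [← h3, abs_mul, sub_zero, mul_comm, abs_of_pos hT] at h4
    exact le_of_mul_le_mul_right h4 hT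
  have hXle : ∫ t in 0..T, |U t| ^ p ≤ T ^ p * E := by
    calc ∫ t in 0..T, |U t| ^ p ≤ ∫ t in 0..T, K ^ p := by
          refine intervalIntegral.integral_mono_on hT.le
            ((hUc.abs.rpow_const fun _ _ => Or.inr hp0.le).intervalIntegrable_of_Icc hT.le)
            intervalIntegrable_const fun t ht => ?_
          have := hb t ht
          gcongr
      _ = T * K ^ p := by simp
      _ = T ^ p * E := by
          rw [hK, Real.mul_rpow (by positivity) (by positivity), ← Real.rpow_mul hT.le,
            ← Real.rpow_mul hE0, one_div_mul_cancel hp0.ne', Real.rpow_one, ← mul_assoc,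
            ← Real.rpow_one_add' hT.le (by field_simp; linarith)]
          congr 2
          field_simp
          ring
  have h5 : (∫ t in 0..T, |U t| ^ p) ^ (2 / p) ≤ T ^ 2 * E ^ (2 / p) := by
    calc (∫ t in 0..T, |U t| ^ p) ^ (2 / p) ≤ (T ^ p * E) ^ (2 / p) := by
          gcongr
          exact intervalIntegral.integral_nonneg hT.le fun _ _ => by positivity
      _ = T ^ 2 * E ^ (2 / p) := by
          rw [Real.mul_rpow (by positivity) hE0, ← Real.rpow_mul hT.le,
            mul_div_cancel₀ _ hp0.ne', Real.rpow_two]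
  rw [inv_mul_le_iff₀ (by positivity)]
  change _ ≤ T ^ 2 * (T⁻¹ ^ (2 / p) * E ^ (2 / p))
  calc T⁻¹ ^ (2 / p) * (∫ t in 0..T, |U t| ^ p) ^ (2 / p)
      ≤ T⁻¹ ^ (2 / p) * (T ^ 2 * E ^ (2 / p)) := by gcongr
    _ = _ := by ring

/-- The interpolation inequality with the constant `λ₁`. -/
theorem interpolationInequality_lambdaOne {p q : ℝ} (hp : 2 < p) (hq : p - 1 < q) (hpq : p ≠ q) :
    InterpolationInequality p q (lambdaOne p) := by
  intro u u' hu
  have hT := Real.two_pi_pos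
  obtain ⟨U, hU, h1, h2⟩ := hu.exists_perAC hp
  have h := hU.deficit hT hp hq hpq (lambdaOne_pos hp).le fun U hU => hU.poincare hp
  rw [sq_circNorm_eq_of_ae h1, sq_circNorm_eq_of_ae h1, sq_circNorm_eq_of_ae h2]
  have e : ((2 * Real.pi)⁻¹) ^ (2 / p) * (2 * Real.pi) ^ (2 / p - 2 / q)
      = ((2 * Real.pi)⁻¹) ^ (2 / q) := by
    rw [Real.inv_rpow hT.le, Real.inv_rpow hT.le, Real.rpow_sub hT]
    field_simp
  have h3 := mul_le_mul_of_nonneg_left h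
    (show 0 ≤ ((2 * Real.pi)⁻¹) ^ (2 / p) by positivity)
  refine le_of_eq_of_le ?_ h3
  rw [← e]
  ring

/-! ### The logarithmic inequality as a limit -/

theorem hasDerivAt_rpow_exponent {x s : ℝ} (hx : 0 ≤ x) (hs : 0 < s) :
    HasDerivAt (fun r => x ^ r) (x ^ s * Real.log x) s := by
  rcases hx.eq_or_lt with rfl | hx
  · rw [Real.log_zero, mul_zero]
    refine (hasDerivAt_const s (0 : ℝ)).congr_of_eventuallyEq ?_
    filter_upwards [lt_mem_nhds hs] with r hr
    exact Real.zero_rpow hr.ne'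
  · exact (Real.hasStrictDerivAt_const_rpow hx s).hasDerivAt

/-- A bound of `x^s log x`, uniform for `x` in `[0, M]` and `s` in `[1, r]`. -/
theorem abs_rpow_mul_log_le {x s r M : ℝ} (hx : 0 ≤ x) (hxM : x ≤ M) (hM : 1 ≤ M) (hs : 1 ≤ s)
    (hsr : s ≤ r) : |x ^ s * Real.log x| ≤ M ^ (r + 1) := by
  have hM0 : 0 < M := by linarith
  rw [Real.rpow_add_one hM0.ne', abs_mul, abs_of_nonneg (Real.rpow_nonneg hx s)]
  rcases hx.eq_or_lt with rfl | hx
  · rw [Real.log_zero, abs_zero, mul_zero]; positivity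
  rcases le_total x 1 with h1 | h1
  · have h2 := Real.abs_log_mul_self_lt x hx h1
    have h3 : x ^ s ≤ x := by
      simpa using Real.rpow_le_rpow_of_exponent_ge hx h1 hs
    have h4 : (1 : ℝ) ≤ M ^ r := Real.one_le_rpow hM (by linarith)
    rw [abs_mul, abs_of_pos hx] at h2
    calc x ^ s * |Real.log x| ≤ x * |Real.log x| := by gcongr
      _ ≤ 1 := by linarith
      _ ≤ M ^ r * M := by nlinarith
  · have h2 : x ^ s ≤ M ^ r :=
      (Real.rpow_le_rpow hx.le hxM (by linarith)).trans (Real.rpow_le_rpow_of_exponent_le hM hsr)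
    have h3 : |Real.log x| ≤ M := by
      rw [abs_of_nonneg (Real.log_nonneg h1)]
      linarith [Real.log_le_sub_one_of_pos hx]
    gcongr

section Bounded

variable {α : Type*} [MeasurableSpace α] {μ : Measure α} {u : α → ℝ} {M : ℝ}

theorem aestronglyMeasurable_abs_rpow (hu : AEStronglyMeasurable u μ) (s : ℝ) :
    AEStronglyMeasurable (fun x => |u x| ^ s) μ :=
  (hu.aemeasurable.norm.pow_const s).aestronglyMeasurable

theorem aestronglyMeasurable_abs_rpow_mul_log (hu : AEStronglyMeasurable u μ) (s : ℝ) :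
    AEStronglyMeasurable (fun x => |u x| ^ s * Real.log |u x|) μ :=
  (aestronglyMeasurable_abs_rpow hu s).mul
    (Real.measurable_log.comp_aemeasurable hu.aemeasurable.norm).aestronglyMeasurable

variable [IsFiniteMeasure μ]

theorem integrable_abs_rpow_of_bounded (hu : AEStronglyMeasurable u μ)
    (hM : ∀ᵐ x ∂μ, |u x| ≤ M) {s : ℝ} (hs : 0 ≤ s) : Integrable (fun x => |u x| ^ s) μ := by
  refine Integrable.of_bound (aestronglyMeasurable_abs_rpow hu s) (M ^ s) ?_
  filter_upwards [hM] with x hx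
  rw [Real.norm_of_nonneg (by positivity)]
  gcongr

theorem integrable_abs_rpow_mul_log_of_bounded (hu : AEStronglyMeasurable u μ)
    (hM : ∀ᵐ x ∂μ, |u x| ≤ M) {s : ℝ} (hs : 1 ≤ s) :
    Integrable (fun x => |u x| ^ s * Real.log |u x|) μ := by
  refine Integrable.of_bound (aestronglyMeasurable_abs_rpow_mul_log hu s) (max M 1 ^ (s + 1)) ?_
  filter_upwards [hM] with x hx
  exact abs_rpow_mul_log_le (abs_nonneg _) (hx.trans (le_max_left _ _)) (le_max_right _ _) hs le_rfl

theorem rpow_mul_log_div {x s N : ℝ} (hs : s ≠ 0) (hN : N ≠ 0) :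
    x ^ s * Real.log (x / N) = x ^ s * Real.log x - Real.log N * x ^ s := by
  rcases eq_or_ne x 0 with rfl | hx
  · simp [Real.zero_rpow hs]
  · rw [Real.log_div hx hN]; ring

theorem integrable_abs_rpow_mul_log_div (hu : AEStronglyMeasurable u μ)
    (hM : ∀ᵐ x ∂μ, |u x| ≤ M) {s : ℝ} (hs : 1 ≤ s) (N : ℝ) :
    Integrable (fun x => |u x| ^ s * Real.log (|u x| / N)) μ := by
  rcases eq_or_ne N 0 with rfl | hN
  · simp
  · simp only [rpow_mul_log_div (by linarith : s ≠ 0) hN]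
    exact (integrable_abs_rpow_mul_log_of_bounded hu hM hs).sub
      ((integrable_abs_rpow_of_bounded hu hM (by linarith)).const_mul _)

theorem integral_abs_rpow_mul_log_div (hu : AEStronglyMeasurable u μ)
    (hM : ∀ᵐ x ∂μ, |u x| ≤ M) {s : ℝ} (hs : 1 ≤ s) {N : ℝ} (hN : N ≠ 0) :
    ∫ x, |u x| ^ s * Real.log (|u x| / N) ∂μ
      = ∫ x, |u x| ^ s * Real.log |u x| ∂μ - Real.log N * ∫ x, |u x| ^ s ∂μ := by
  simp only [rpow_mul_log_div (by linarith : s ≠ 0) hN]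
  rw [integral_sub (integrable_abs_rpow_mul_log_of_bounded hu hM hs)
    ((integrable_abs_rpow_of_bounded hu hM (by linarith)).const_mul _), integral_const_mul]

theorem hasDerivAt_integral_rpow_exponent (hu : AEStronglyMeasurable u μ)
    (hM : ∀ᵐ x ∂μ, |u x| ≤ M) {s : ℝ} (hs : 1 < s) :
    HasDerivAt (fun r => ∫ x, |u x| ^ r ∂μ) (∫ x, |u x| ^ s * Real.log |u x| ∂μ) s := by
  have hnhds : Ioo 1 (s + 1) ∈ 𝓝 s := Ioo_mem_nhds hs (by linarith)
  refine (hasDerivAt_integral_of_dominated_loc_of_deriv_le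
    (F' := fun r x => |u x| ^ r * Real.log |u x|)
    (bound := fun _ => max M 1 ^ (s + 1 + 1)) hnhds
    (Eventually.of_forall fun r => aestronglyMeasurable_abs_rpow hu r)
    (integrable_abs_rpow_of_bounded hu hM (by linarith))
    (aestronglyMeasurable_abs_rpow_mul_log hu s) ?_ (integrable_const _) ?_).2
  · filter_upwards [hM] with x hx r hr
    exact abs_rpow_mul_log_le (abs_nonneg _) (hx.trans (le_max_left _ _)) (le_max_right _ _)
      hr.1.le hr.2.le
  · refine Eventually.of_forall fun x r hr => ?_
    exact hasDerivAt_rpow_exponent (abs_nonneg _) (by linarith [hr.1])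

/-- The derivative in the exponent of the squared norm is the logarithmic entropy. -/
theorem hasDerivAt_sq_norm_exponent (hu : AEStronglyMeasurable u μ)
    (hM : ∀ᵐ x ∂μ, |u x| ≤ M) {s : ℝ} (hs : 1 < s) (hpos : 0 < ∫ x, |u x| ^ s ∂μ) :
    HasDerivAt (fun r => (∫ x, |u x| ^ r ∂μ) ^ (2 / r))
      (2 / s * ((∫ x, |u x| ^ s ∂μ) ^ (1 / s)) ^ (2 - s)
        * ∫ x, |u x| ^ s * Real.log (|u x| / (∫ x, |u x| ^ s ∂μ) ^ (1 / s)) ∂μ) s := by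
  have hs0 : s ≠ 0 := by linarith
  have h1 := hasDerivAt_integral_rpow_exponent hu hM hs
  have h2 : HasDerivAt (fun r : ℝ => 2 / r) (-2 / s ^ 2) s := by
    simpa [div_eq_mul_inv] using (hasDerivAt_inv hs0).const_mul 2
  refine (h1.rpow h2 hpos).congr_deriv ?_
  rw [integral_abs_rpow_mul_log_div hu hM hs.le (Real.rpow_pos_of_pos hpos _).ne',
    Real.log_rpow hpos, ← Real.rpow_mul hpos.le,
    show 1 / s * (2 - s) = 2 / s - 1 by field_simp, Real.rpow_sub_one hpos.ne']
  field_simp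
  ring

end Bounded

/-- The logarithmic Sobolev inequality with the constant `λ₁`: the limit `q → p` of the
interpolation inequalities. -/
theorem logSobolevInequality_lambdaOne {p : ℝ} (hp : 2 < p) :
    LogSobolevInequality p (lambdaOne p) := by
  intro u u' hu hne
  have hp0 : 0 < p := by linarith
  obtain ⟨M, hM⟩ := hu.ae_bounded hp
  have hint := (memLp_iff_integrable_abs_rpow hp0 hu.memLp.1).1 hu.memLp
  have hpos : 0 < ∫ x, |u x| ^ p ∂circMeasure :=
    lt_of_le_of_ne (integral_nonneg fun _ => by positivity)
      fun h => hne ((integral_abs_rpow_eq_zero_iff hp0 hint).1 h.symm)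
  have h := ((hasDerivAt_sq_norm_exponent hu.memLp.1 hM (by linarith) hpos).tendsto_slope).const_mul
    (lambdaOne p)
  have e : circNorm p u = (∫ x, |u x| ^ p ∂circMeasure) ^ (1 / p) := rfl
  rw [← e] at h
  refine le_of_eq_of_le (by ring) (le_of_tendsto h ?_)
  filter_upwards [self_mem_nhdsWithin,
    nhdsWithin_le_nhds (lt_mem_nhds (sub_one_lt p))] with q hqp hq
  have := interpolationInequality_lambdaOne hp hq (Ne.symm hqp) u u' hu
  rw [slope_def_field, ← sq_circNorm_eq, ← sq_circNorm_eq]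
  refine le_of_eq_of_le ?_ this
  have h3 : q - p ≠ 0 := sub_ne_zero.2 hqp
  have h4 : p - q ≠ 0 := sub_ne_zero.2 (Ne.symm hqp)
  field_simp
  ring

/-! ### Expansion at the constant function -/

/-- Taylor's formula of order two at the origin. -/
theorem tendsto_sub_sub_div_sq {h g : ℝ → ℝ} {c : ℝ} (hh : ∀ᶠ y in 𝓝 0, HasDerivAt h (g y) y)
    (hg : HasDerivAt g c 0) :
    Tendsto (fun y => (h y - h 0 - g 0 * y) / y ^ 2) (𝓝[≠] 0) (𝓝 (c / 2)) := by
  have hh' := hh.filter_mono (nhdsWithin_le_nhds (s := {0}ᶜ))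
  refine HasDerivAt.lhopital_zero_nhdsNE (f' := fun y => g y - g 0) (g' := fun y => 2 * y)
    ?_ ?_ ?_ ?_ ?_ ?_
  · filter_upwards [hh'] with y hy
    exact ((hy.sub_const (h 0)).sub ((hasDerivAt_id y).const_mul (g 0))).congr_deriv (by simp)
  · exact Eventually.of_forall fun y => by simpa using hasDerivAt_pow 2 y
  · filter_upwards [self_mem_nhdsWithin] with y hy
    exact mul_ne_zero two_ne_zero hy
  · have hc : ContinuousAt (fun y => h y - h 0 - g 0 * y) 0 :=
      (hh.self_of_nhds.continuousAt.sub_const _).sub (continuousAt_id.const_mul _)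
    simpa using hc.tendsto.mono_left nhdsWithin_le_nhds
  · have hc : Continuous fun y : ℝ => y ^ 2 := continuous_pow 2
    simpa using (hc.tendsto 0).mono_left nhdsWithin_le_nhds
  · refine (hg.tendsto_slope.div_const 2).congr fun y => ?_
    rw [slope_def_field, sub_zero, div_div, mul_comm]

theorem hasDerivAt_one_add_rpow (s : ℝ) {y : ℝ} (hy : -1 < y) :
    HasDerivAt (fun y => (1 + y) ^ s) (s * (1 + y) ^ (s - 1)) y := by
  simpa using ((hasDerivAt_id y).const_add 1).rpow_const (p := s) (Or.inl (by simp; linarith))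

theorem hasDerivAt_one_add_log {y : ℝ} (hy : -1 < y) :
    HasDerivAt (fun y => Real.log (1 + y)) (1 + y)⁻¹ y := by
  simpa using ((hasDerivAt_id y).const_add 1).log (by simp; linarith)

theorem eventually_neg_one_lt : ∀ᶠ y : ℝ in 𝓝 0, -1 < y := lt_mem_nhds (by norm_num)

/-- The quadratic coefficient of `|1 + y|^s` at the origin. The value at the origin is left
unsimplified to match `tendsto_integral_comp_const_mul`. -/
theorem tendsto_abs_one_add_rpow (s : ℝ) :
    Tendsto (fun y : ℝ => (|1 + y| ^ s - |1 + 0| ^ s - s * y) / y ^ 2) (𝓝[≠] 0)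
      (𝓝 (s * (s - 1) / 2)) := by
  have h := tendsto_sub_sub_div_sq (h := fun y => |1 + y| ^ s) (c := s * (s - 1))
    (g := fun y => s * (1 + y) ^ (s - 1)) ?_ ?_
  · simpa using h
  · filter_upwards [eventually_neg_one_lt] with y hy
    refine (hasDerivAt_one_add_rpow s hy).congr_of_eventuallyEq ?_
    filter_upwards [lt_mem_nhds hy] with z hz
    rw [abs_of_pos (by linarith)]
  · simpa using (hasDerivAt_one_add_rpow (s - 1) (y := 0) (by norm_num)).const_mul s

theorem tendsto_abs_one_add_rpow_mul_log (s : ℝ) :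
    Tendsto (fun y : ℝ => (|1 + y| ^ s * Real.log |1 + y| - |1 + 0| ^ s * Real.log |1 + 0| - 1 * y)
      / y ^ 2) (𝓝[≠] 0) (𝓝 ((2 * s - 1) / 2)) := by
  have h := tendsto_sub_sub_div_sq (h := fun y => |1 + y| ^ s * Real.log |1 + y|) (c := 2 * s - 1)
    (g := fun y => s * (1 + y) ^ (s - 1) * Real.log (1 + y) + (1 + y) ^ s * (1 + y)⁻¹) ?_ ?_
  · simpa using h
  · filter_upwards [eventually_neg_one_lt] with y hy
    refine ((hasDerivAt_one_add_rpow s hy).mul (hasDerivAt_one_add_log hy)).congr_of_eventuallyEq ?_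
    filter_upwards [lt_mem_nhds hy] with z hz
    simp only [Pi.mul_apply]
    rw [abs_of_pos (by linarith)]
  · have h0 : (-1 : ℝ) < 0 := by norm_num
    have hl := hasDerivAt_one_add_log h0
    have hi : HasDerivAt (fun y : ℝ => (1 + y)⁻¹) (-1) 0 := by
      exact (((hasDerivAt_id (0 : ℝ)).const_add 1).inv (by simp)).congr_deriv (by simp)
    refine ((((hasDerivAt_one_add_rpow (s - 1) h0).const_mul s).mul hl).add
      ((hasDerivAt_one_add_rpow s h0).mul hi)).congr_deriv ?_
    simp
    ring

section Expansion

variable {α : Type*} [MeasurableSpace α] {μ : Measure α} [IsProbabilityMeasure μ] {v : α → ℝ}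
  {M : ℝ}

/-- Second-order expansion of `ε ↦ ∫ h (ε v)` at zero for bounded `v` of zero mean; the linear
term of `h` integrates to zero. -/
theorem tendsto_integral_comp_const_mul (hv : AEStronglyMeasurable v μ)
    (hM : ∀ᵐ x ∂μ, |v x| ≤ M) (hmean : ∫ x, v x ∂μ = 0) {h : ℝ → ℝ} (hm : Measurable h)
    {h₁ h₂ : ℝ}
    (hh : Tendsto (fun y => (h y - h 0 - h₁ * y) / y ^ 2) (𝓝[≠] 0) (𝓝 h₂)) :
    Tendsto (fun ε => (∫ x, h (ε * v x) ∂μ - h 0) / ε ^ 2) (𝓝[≠] 0)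
      (𝓝 (h₂ * ∫ x, v x ^ 2 ∂μ)) := by
  set F : ℝ → α → ℝ := fun ε x => (h (ε * v x) - h 0 - h₁ * (ε * v x)) / ε ^ 2 with hF
  have hvi : Integrable v μ := Integrable.of_bound hv M hM
  have hFm : ∀ ε, AEStronglyMeasurable (F ε) μ := fun ε =>
    ((((hm.comp_aemeasurable (hv.aemeasurable.const_mul ε)).sub_const _).sub
      ((hv.aemeasurable.const_mul ε).const_mul h₁)).div_const _).aestronglyMeasurable
  have hev : ∀ᶠ y in 𝓝[≠] (0 : ℝ), |(h y - h 0 - h₁ * y) / y ^ 2| ≤ |h₂| + 1 :=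
    (hh.abs.eventually_lt_const (lt_add_one |h₂|)).mono fun _ => le_of_lt
  rw [eventually_nhdsWithin_iff, Metric.eventually_nhds_iff] at hev
  obtain ⟨δ, hδ, hev⟩ := hev
  have hbound : ∀ᶠ ε in 𝓝[≠] (0 : ℝ), ∀ᵐ x ∂μ, ‖F ε x‖ ≤ (|h₂| + 1) * M ^ 2 := by
    have hsmall : ∀ᶠ ε in 𝓝[≠] (0 : ℝ), |ε| * (|M| + 1) < δ := by
      have : Tendsto (fun ε : ℝ => |ε| * (|M| + 1)) (𝓝 0) (𝓝 (|0| * (|M| + 1))) :=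
        (continuous_abs.mul continuous_const).tendsto 0
      rw [abs_zero, zero_mul] at this
      exact (this.eventually_lt_const hδ).filter_mono nhdsWithin_le_nhds
    filter_upwards [hsmall, self_mem_nhdsWithin] with ε hε hε0
    filter_upwards [hM] with x hx
    have hM2 : v x ^ 2 ≤ M ^ 2 := sq_le_sq' (by linarith [abs_le.1 hx]) (abs_le.1 hx).2
    rcases eq_or_ne (v x) 0 with h0 | h0
    · simp only [hF, h0, mul_zero, sub_self, zero_div, norm_zero]
      positivity
    have hne : ε * v x ≠ 0 := mul_ne_zero hε0 h0
    have hd : dist (ε * v x) 0 < δ := by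
      rw [dist_zero_right, Real.norm_eq_abs, abs_mul]
      refine lt_of_le_of_lt ?_ hε
      gcongr
      linarith [le_abs_self M]
    have h3 := hev hd hne
    have e : F ε x = (h (ε * v x) - h 0 - h₁ * (ε * v x)) / (ε * v x) ^ 2 * v x ^ 2 := by
      simp only [hF]
      have : ε ≠ 0 := hε0
      field_simp
    rw [e, Real.norm_eq_abs, abs_mul, abs_of_nonneg (sq_nonneg (v x))]
    gcongr
  have hlim : ∀ᵐ x ∂μ, Tendsto (fun ε => F ε x) (𝓝[≠] 0) (𝓝 (h₂ * v x ^ 2)) := by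
    refine Eventually.of_forall fun x => ?_
    rcases eq_or_ne (v x) 0 with h0 | h0
    · simp [hF, h0]
    have hmul : Tendsto (fun ε : ℝ => ε * v x) (𝓝[≠] 0) (𝓝[≠] 0) := by
      refine tendsto_nhdsWithin_iff.2 ⟨?_, ?_⟩
      · have : Continuous fun ε : ℝ => ε * v x := continuous_mul_const _
        simpa using (this.tendsto 0).mono_left nhdsWithin_le_nhds
      · filter_upwards [self_mem_nhdsWithin] with ε hε
        exact mul_ne_zero hε h0
    refine ((hh.comp hmul).mul_const (v x ^ 2)).congr' ?_
    filter_upwards [self_mem_nhdsWithin] with ε hε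
    have : ε ≠ 0 := hε
    simp only [hF, Function.comp]
    field_simp
  have hT := tendsto_integral_filter_of_dominated_convergence (fun _ => (|h₂| + 1) * M ^ 2)
    (Eventually.of_forall hFm) hbound (integrable_const _) hlim
  rw [integral_const_mul] at hT
  refine hT.congr' ?_
  filter_upwards [hbound, self_mem_nhdsWithin] with ε hε hε0
  have hε0 : ε ≠ 0 := hε0
  have hFi : Integrable (F ε) μ := Integrable.of_bound (hFm ε) _ hε
  have e : ∀ x, h (ε * v x) = h 0 + h₁ * (ε * v x) + ε ^ 2 * F ε x := by
    intro x
    simp only [hF]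
    field_simp
    ring
  have e2 : ∫ x, h (ε * v x) ∂μ = h 0 + ε ^ 2 * ∫ x, F ε x ∂μ := by
    have i1 : Integrable (fun x => h₁ * (ε * v x)) μ := (hvi.const_mul ε).const_mul h₁
    have i2 : Integrable (fun x => h 0 + h₁ * (ε * v x)) μ := (integrable_const _).add i1
    simp only [e]
    rw [integral_add i2 (hFi.const_mul _), integral_add (integrable_const _) i1,
      integral_const_mul, integral_const_mul, integral_const_mul, hmean]
    simp
  rw [e2]
  field_simp
  ring

end Expansion

theorem tendsto_one_of_tendsto_sub_div_sq {A : ℝ → ℝ} {a : ℝ}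
    (hA : Tendsto (fun ε => (A ε - 1) / ε ^ 2) (𝓝[≠] 0) (𝓝 a)) : Tendsto A (𝓝[≠] 0) (𝓝 1) := by
  have h2 : Tendsto (fun ε : ℝ => ε ^ 2) (𝓝[≠] 0) (𝓝 0) := by
    simpa using ((continuous_pow 2).tendsto (0 : ℝ)).mono_left nhdsWithin_le_nhds
  have h := (hA.mul h2).add_const 1
  rw [mul_zero, zero_add] at h
  refine h.congr' ?_
  filter_upwards [self_mem_nhdsWithin] with ε hε
  have : ε ≠ 0 := hε
  field_simp
  ring

/-- The chain rule for the expansion of `f (A ε)` to second order, when `A ε = 1 + a ε² + o(ε²)`. -/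
theorem HasDerivAt.tendsto_comp_sub_div_sq {f A : ℝ → ℝ} {a d : ℝ} (hf : HasDerivAt f d 1)
    (hA : Tendsto (fun ε => (A ε - 1) / ε ^ 2) (𝓝[≠] 0) (𝓝 a)) :
    Tendsto (fun ε => (f (A ε) - f 1) / ε ^ 2) (𝓝[≠] 0) (𝓝 (d * a)) := by
  have h1 := (continuousAt_dslope_same.2 hf.differentiableAt).tendsto
  rw [dslope_same, hf.deriv] at h1
  refine ((h1.comp (tendsto_one_of_tendsto_sub_div_sq hA)).mul hA).congr fun ε => ?_
  rw [← sub_smul_dslope f 1 (A ε), smul_eq_mul, Function.comp]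
  ring

theorem IsSobolev.one_add_const_mul {p : ℝ} (hp : 1 ≤ p) {v v' : Circ → ℝ}
    (hv : IsSobolev p v v') (ε : ℝ) :
    IsSobolev p (fun x => 1 + ε * v x) (fun x => ε * v' x) := by
  have hc : MemLp (fun _ : Circ => (1 : ℝ)) (ENNReal.ofReal p) circMeasure := memLp_const 1
  have hεv : MemLp (fun x => ε * v x) (ENNReal.ofReal p) circMeasure := hv.memLp.const_mul ε
  refine ⟨hc.add hεv, hv.memLp_deriv.const_mul ε, fun φ hφ => ?_⟩
  have hvi : Integrable v circMeasure :=
    hv.memLp.integrable (ENNReal.one_le_ofReal.2 hp)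
  have h1 : Integrable (circDeriv φ) circMeasure := by
    have := integrable_mul_of_continuous (integrable_const (1 : ℝ)) hφ.continuous_circDeriv
    simpa only [one_mul] using this
  simp only [add_mul, one_mul, mul_assoc]
  rw [integral_add h1 ((integrable_mul_of_continuous hvi hφ.continuous_circDeriv).const_mul ε),
    integral_circDeriv hφ, integral_const_mul, integral_const_mul, hv.weak_deriv φ hφ]
  ring

theorem sq_circNorm_const_mul {p : ℝ} (hp : 0 < p) (ε : ℝ) (u : Circ → ℝ) :
    circNorm p (fun x => ε * u x) ^ 2 = ε ^ 2 * circNorm p u ^ 2 := by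
  have h0 : 0 ≤ ∫ x, |u x| ^ p ∂circMeasure := integral_nonneg fun _ => by positivity
  rw [sq_circNorm_eq, sq_circNorm_eq]
  simp only [abs_mul, Real.mul_rpow (abs_nonneg _) (abs_nonneg _)]
  rw [integral_const_mul, Real.mul_rpow (by positivity) h0, ← Real.rpow_mul (abs_nonneg _),
    mul_div_cancel₀ _ hp.ne', Real.rpow_two, sq_abs]

theorem IsSobolev.tendsto_integral_one_add_rpow {p : ℝ} (hp : 2 < p) {v v' : Circ → ℝ}
    (hv : IsSobolev p v v') (hmean : ∫ x, v x ∂circMeasure = 0) (s : ℝ) :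
    Tendsto (fun ε => (∫ x, |1 + ε * v x| ^ s ∂circMeasure - 1) / ε ^ 2) (𝓝[≠] 0)
      (𝓝 (s * (s - 1) / 2 * ∫ x, v x ^ 2 ∂circMeasure)) := by
  obtain ⟨M, hM⟩ := hv.ae_bounded hp
  simpa using tendsto_integral_comp_const_mul hv.memLp.1 hM hmean (h := fun y => |1 + y| ^ s)
    (by fun_prop) (tendsto_abs_one_add_rpow s)

theorem IsSobolev.tendsto_sq_circNorm_one_add {p : ℝ} (hp : 2 < p) {v v' : Circ → ℝ}
    (hv : IsSobolev p v v') (hmean : ∫ x, v x ∂circMeasure = 0) {s : ℝ} (hs : s ≠ 0) :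
    Tendsto (fun ε => (circNorm s (fun x => 1 + ε * v x) ^ 2 - 1) / ε ^ 2) (𝓝[≠] 0)
      (𝓝 ((s - 1) * ∫ x, v x ^ 2 ∂circMeasure)) := by
  have hd : HasDerivAt (fun y : ℝ => y ^ (2 / s)) (2 / s) 1 := by
    simpa using Real.hasDerivAt_rpow_const (x := 1) (p := 2 / s) (Or.inl one_ne_zero)
  have h := hd.tendsto_comp_sub_div_sq (hv.tendsto_integral_one_add_rpow hp hmean s)
  simp only [sq_circNorm_eq]
  convert h using 2
  · simp
  · field_simp

/-- The interpolation inequality, tested on perturbations of the constant function. -/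
theorem InterpolationInequality.le_of_mean_zero {p q L : ℝ} (hp : 2 < p) (hq : p - 1 < q)
    (hpq : p ≠ q) (hL : InterpolationInequality p q L) {v v' : Circ → ℝ} (hv : IsSobolev p v v')
    (hmean : ∫ x, v x ∂circMeasure = 0) :
    L * ∫ x, v x ^ 2 ∂circMeasure ≤ circNorm p v' ^ 2 := by
  have hpq' : p - q ≠ 0 := sub_ne_zero.2 hpq
  have h := ((hv.tendsto_sq_circNorm_one_add hp hmean (s := p) (by linarith)).sub
    (hv.tendsto_sq_circNorm_one_add hp hmean (s := q) (by linarith))).const_mul (L / (p - q))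
  refine le_of_eq_of_le (by field_simp; ring) (le_of_tendsto h ?_)
  filter_upwards [self_mem_nhdsWithin] with ε hε
  have hε2 : 0 < ε ^ 2 := by have : ε ≠ 0 := hε; positivity
  have h1 := hL _ _ (hv.one_add_const_mul (by linarith) ε)
  rw [sq_circNorm_const_mul (by linarith)] at h1
  rw [← sub_div, mul_div_assoc', div_le_iff₀ hε2]
  linarith

/-- The logarithmic Sobolev inequality, tested on perturbations of the constant function. -/
theorem LogSobolevInequality.le_of_mean_zero {p L : ℝ} (hp : 2 < p)
    (hL : LogSobolevInequality p L) {v v' : Circ → ℝ} (hv : IsSobolev p v v')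
    (hmean : ∫ x, v x ∂circMeasure = 0) :
    L * ∫ x, v x ^ 2 ∂circMeasure ≤ circNorm p v' ^ 2 := by
  have hp0 : 0 < p := by linarith
  obtain ⟨M, hM⟩ := hv.ae_bounded hp
  set S := ∫ x, v x ^ 2 ∂circMeasure with hS
  set A : ℝ → ℝ := fun ε => ∫ x, |1 + ε * v x| ^ p ∂circMeasure with hA
  have hAlim := hv.tendsto_integral_one_add_rpow hp hmean p
  have hA1 : Tendsto A (𝓝[≠] 0) (𝓝 1) := tendsto_one_of_tendsto_sub_div_sq hAlim
  have hB : Tendsto (fun ε => (∫ x, |1 + ε * v x| ^ p * Real.log |1 + ε * v x| ∂circMeasure)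
      / ε ^ 2) (𝓝[≠] 0) (𝓝 ((2 * p - 1) / 2 * S)) := by
    simpa using tendsto_integral_comp_const_mul hv.memLp.1 hM hmean
      (h := fun y => |1 + y| ^ p * Real.log |1 + y|) (by fun_prop)
      (tendsto_abs_one_add_rpow_mul_log p)
  have hlog : Tendsto (fun ε => Real.log (A ε) / ε ^ 2) (𝓝[≠] 0)
      (𝓝 (p * (p - 1) / 2 * S)) := by
    have := (Real.hasDerivAt_log one_ne_zero).tendsto_comp_sub_div_sq hAlim
    simpa using this
  have hN : Tendsto (fun ε => (A ε ^ (1 / p)) ^ (2 - p)) (𝓝[≠] 0) (𝓝 1) := by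
    have := (hA1.rpow_const (p := 1 / p) (Or.inl one_ne_zero)).rpow_const (p := 2 - p)
      (Or.inl (by simp))
    simpa using this
  have h := (hN.mul (hB.sub ((hlog.mul hA1).div_const p))).const_mul (2 / p * L)
  refine le_of_eq_of_le (by field_simp; ring) (le_of_tendsto h ?_)
  filter_upwards [self_mem_nhdsWithin, hA1.eventually_const_lt one_pos] with ε hε hpos
  have hε2 : 0 < ε ^ 2 := by have : ε ≠ 0 := hε; positivity
  have hu := hv.one_add_const_mul (by linarith : 1 ≤ p) ε
  obtain ⟨M', hM'⟩ := hu.ae_bounded hp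
  have hne : ¬ ((fun x => 1 + ε * v x) =ᵐ[circMeasure] 0) := by
    rw [← integral_abs_rpow_eq_zero_iff hp0
      ((memLp_iff_integrable_abs_rpow hp0 hu.memLp.1).1 hu.memLp)]
    exact hpos.ne'
  have h1 := hL _ _ hu hne
  have e : circNorm p (fun x => 1 + ε * v x) = A ε ^ (1 / p) := rfl
  rw [sq_circNorm_const_mul hp0, e, integral_abs_rpow_mul_log_div hu.memLp.1 hM' (by linarith)
    (Real.rpow_pos_of_pos hpos _).ne', Real.log_rpow hpos] at h1
  rw [← mul_le_mul_iff_right₀ hε2]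
  refine le_of_eq_of_le ?_ h1
  change _ = 2 / p * L * (A ε ^ (1 / p)) ^ (2 - p) *
    (∫ x, |1 + ε * v x| ^ p * Real.log |1 + ε * v x| ∂circMeasure - 1 / p * Real.log (A ε) * A ε)
  have hε0 : ε ≠ 0 := hε
  field_simp

theorem le_lambdaOneStar {p L : ℝ} (hp : 2 < p)
    (h : ∀ v v' : Circ → ℝ, IsSobolev p v v' → ∫ x, v x ∂circMeasure = 0 →
      L * ∫ x, v x ^ 2 ∂circMeasure ≤ circNorm p v' ^ 2) : L ≤ lambdaOneStar p := by
  refine le_csInf (rayleighInf_nonempty (by linarith) 2) ?_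
  rintro _ ⟨v, v', hv, hne, hmean, rfl⟩
  have e : circNorm 2 v ^ 2 = ∫ x, v x ^ 2 ∂circMeasure := by
    rw [sq_circNorm_eq, div_self two_ne_zero, Real.rpow_one]
    simp
  obtain ⟨M, hM⟩ := hv.ae_bounded hp
  have hint := integrable_abs_rpow_of_bounded hv.memLp.1 hM (s := 2) (by norm_num)
  have hpos : 0 < ∫ x, v x ^ 2 ∂circMeasure := by
    have h1 := integral_abs_rpow_eq_zero_iff two_pos hint
    simp only [Real.rpow_two, sq_abs] at h1
    exact lt_of_le_of_ne (integral_nonneg fun _ => sq_nonneg _) fun h => hne (h1.1 h.symm)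
  rw [e, le_div_iff₀ hpos]
  exact h v v' hv hmean

/-! ### The sharp constant -/

theorem isClosed_setOf_interpolationInequality (p q : ℝ) :
    IsClosed {L : ℝ | InterpolationInequality p q L} := by
  simp only [InterpolationInequality, ge_iff_le, ofPred_forall]
  exact isClosed_iInter fun u => isClosed_iInter fun u' => isClosed_iInter fun _ =>
    isClosed_le (by fun_prop) continuous_const

theorem isClosed_setOf_logSobolevInequality (p : ℝ) :
    IsClosed {L : ℝ | LogSobolevInequality p L} := by
  simp only [LogSobolevInequality, ge_iff_le, ofPred_forall]
  exact isClosed_iInter fun u => isClosed_iInter fun u' => isClosed_iInter fun _ =>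
    isClosed_iInter fun _ => isClosed_le (by fun_prop) continuous_const

theorem IsClosed.exists_isGreatest {S : Set ℝ} (hS : IsClosed S) {l b : ℝ} (hl : l ∈ S)
    (hb : ∀ L ∈ S, L ≤ b) : ∃ Λ, IsGreatest S Λ ∧ l ≤ Λ ∧ Λ ≤ b := by
  have hbdd : BddAbove S := ⟨b, hb⟩
  have hmem := hS.csSup_mem ⟨l, hl⟩ hbdd
  exact ⟨sSup S, ⟨hmem, fun _ hx => le_csSup hbdd hx⟩, le_csSup hbdd hl, hb _ hmem⟩

theorem theorem1 (p q : ℝ) (hp : 2 < p) (hq : p - 1 < q) :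
    -- all the integrals in the inequalities are finite
    (∀ u u' : Circ → ℝ, IsSobolev p u u' →
      Integrable (fun x => |u x| ^ q) circMeasure ∧
      Integrable (fun x => |u x| ^ p * Real.log (|u x| / circNorm p u)) circMeasure) ∧
    -- `Λ` is the sharp (largest admissible) constant
    ∃ Λ : ℝ, 0 < Λ ∧
      (p ≠ q → IsGreatest {L : ℝ | InterpolationInequality p q L} Λ) ∧
      (p = q → IsGreatest {L : ℝ | LogSobolevInequality p L} Λ) ∧
      lambdaOne p ≤ Λ ∧ Λ ≤ lambdaOneStar p := by
  refine ⟨fun u u' hu => ?_, ?_⟩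
  · obtain ⟨M, hM⟩ := hu.ae_bounded hp
    exact ⟨integrable_abs_rpow_of_bounded hu.memLp.1 hM (by linarith),
      integrable_abs_rpow_mul_log_div hu.memLp.1 hM (by linarith) _⟩
  · rcases eq_or_ne p q with hpq | hpq
    · obtain ⟨Λ, h1, h2, h3⟩ := (isClosed_setOf_logSobolevInequality p).exists_isGreatest
        (logSobolevInequality_lambdaOne hp)
        fun L hL => le_lambdaOneStar hp fun v v' hv hmean => hL.le_of_mean_zero hp hv hmean
      exact ⟨Λ, (lambdaOne_pos hp).trans_le h2, fun h => absurd hpq h, fun _ => h1, h2, h3⟩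
    · obtain ⟨Λ, h1, h2, h3⟩ := (isClosed_setOf_interpolationInequality p q).exists_isGreatest
        (interpolationInequality_lambdaOne hp hq hpq)
        fun L hL => le_lambdaOneStar hp fun v v' hv hmean =>
          hL.le_of_mean_zero hp hq hpq hv hmean
      exact ⟨Λ, (lambdaOne_pos hp).trans_le h2, fun _ => h1, fun h => absurd h hpq, h2, h3⟩
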